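/- Let $p,q:\mathbb N\to\mathbb Z$ satisfy $p(n+1)-p(n)\to+\infty$ and $q(n+1)-q(n)\to+\infty$ as $n\to\infty$. Then there exist a standard Borel space $X$ with a $\sigma$-finite non-atomic measure $m$, $m(X)=\infty$, and two rank-one automorphisms $s,t$ of $(X,m)$ whose Poisson suspensions $S=\mathring s$, $T=\mathring t$ are automorphisms of the Poisson probability space $(X_\circ,\mu)$ over $(X,m)$ with simple singular spectrum, and for which there is a measurable set $C\subset X_\circ$ such that the sequence $$\frac1N\sum_{n=1}^{N}\mu\bigl(S^{p(n)}C\cap T^{q(n)}C\bigr),\qquad N=1,2,\dots,$$ does not converge. Here: * An automorphism of a measure space is an invertible, bimeasurable, measure-preserving map. An automorphism $T$ of $(X,m)$ is of rank one if it is obtained by cutting and stacking: there are $h_1\ge1$, integers $r_j\ge2$ and $s_j(1),\dots,s_j(r_j)\ge0$ ($j\ge1$), and measurable sets $E_j$ with $0<m(E_1)<\infty$ such that, with $h_{j+1}=h_jr_j+\sum_{i\le r_j}s_j(i)$, the floors $E_j,TE_j,\dots,T^{h_j-1}E_j$ are pairwise disjoint for every $j$; $E_j=\bigcup_{i=1}^{r_j}T^{(i-1)h_j+s_j(1)+\dots+s_j(i-1)}E_{j+1}$;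 the floors of all stages cover $X$; and every measurable set of finite measure is approximated in measure, arbitrarily well, by unions of floors of a single stage. * $X_\circ$ is the space of countable subsets $x_\circ\subset X$ with the $\sigma$-algebra generated by the maps $x_\circ\mapsto|x_\circ\cap A|$, $A$ measurable. The Poisson measure $\mu$ over $(X,m)$ is the probability measure on $X_\circ$ with $\mu\{x_\circ:|x_\circ\cap A_i|=k_i,\ i\le N\}=\prod_{i=1}^N\frac{m(A_i)^{k_i}}{k_i!}e^{-m(A_i)}$ for all disjoint measurable $A_1,\dots,A_N$ of finite measure and all integers $k_i\ge0$. The Poisson suspension of $T$ is the map $x_\circ\mapsto T(x_\circ)$ of $X_\circ$. * An automorphism $S$ of a probability space $(\Omega,\mu)$ has simple singular spectrum if the unitary operator $Uf=f\circ S$ on the complex space $L_2(\Omega,\mu)$ has a cyclic vector $f$ (the closed linear span of $\{U^nf:n\in\mathbb Z\}$ is $L_2(\Omega,\mu)$), and for every $f\in L_2(\Omega,\mu)$ the spectral measure $\sigma_f$ on the circle, given by $\int_{\mathbb T} z^n\,d\sigma_f=\langle U^nf,f\rangle$ for $n\in\mathbb Z$, is singular with respect to Lebesgue measure. -/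

import Mathlib

open MeasureTheory Filter Topology Set
open scoped ENNReal

noncomputable section

namespace PoissonRankOne

/-! ### Spectral notions for a unitary operator -/

section Spectrum

variable {H : Type*} [NormedAddCommGroup H] [InnerProductSpace ℂ H]

/-- `σ` is the spectral measure of the vector `v` for the unitary operator `U`: a finite Borel
measure on the circle `ℝ / ℤ` with `∫ e^{2πint} dσ(t) = ⟨Uⁿ v, v⟩` for all `n ∈ ℤ` (the inner
product of Mathlib is linear in its second argument). -/
def IsSpectralMeasure (U : H ≃ₗᵢ[ℂ] H) (v : H) (σ : Measure UnitAddCircle) : Prop :=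
  IsFiniteMeasure σ ∧ ∀ n : ℤ, ∫ t, fourier n t ∂σ = inner ℂ v ((U ^ n) v)

/-- Simple spectrum: there is a cyclic vector. -/
def HasSimpleSpectrum (U : H ≃ₗᵢ[ℂ] H) : Prop :=
  ∃ v : H, (Submodule.span ℂ (range fun n : ℤ => (U ^ n) v)).topologicalClosure = ⊤

/-- Singular spectrum: every spectral measure is singular with respect to Lebesgue measure on
the circle. -/
def HasSingularSpectrum (U : H ≃ₗᵢ[ℂ] H) : Prop :=
  ∀ v : H, ∃ σ : Measure UnitAddCircle,
    IsSpectralMeasure U v σ ∧ σ ⟂ₘ (AddCircle.haarAddCircle : Measure UnitAddCircle)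

end Spectrum

/-! ### Automorphisms -/

section Automorphism

variable {Ω : Type*} [MeasurableSpace Ω]

/-- Integer powers of an invertible bimeasurable map. -/
def iter (T : Ω ≃ᵐ Ω) (n : ℤ) : Equiv.Perm Ω :=
  (T.toEquiv : Equiv.Perm Ω) ^ n

/-- The unitary operator `f ↦ f ∘ T` on the complex space `L²(P)` induced by an
automorphism `T` of `(Ω, P)`. -/
def koopman {P : Measure Ω} {T : Ω ≃ᵐ Ω} (hT : MeasurePreserving T P P) :
    Lp ℂ 2 P ≃ₗᵢ[ℂ] Lp ℂ 2 P :=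
  LinearIsometryEquiv.ofSurjective (Lp.compMeasurePreservingₗᵢ ℂ T hT) (by
    intro f
    have hT' : MeasurePreserving T.symm P P := hT.symm T
    refine ⟨Lp.compMeasurePreserving T.symm hT' f, ?_⟩
    change Lp.compMeasurePreserving T hT (Lp.compMeasurePreserving T.symm hT' f) = f
    rw [← Lp.compMeasurePreserving_comp_apply f hT' hT]
    have h : (T.symm ∘ T : Ω → Ω) = id := by ext x; simp
    simp [h])

end Automorphism

/-! ### Rank-one automorphisms -/

section RankOne

/-- The heights of the towers: `h_{j+1} = h_j r_j + s_j(1) + ⋯ + s_j(r_j)`. Stages, columns and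
spacer parameters are numbered from `0`. -/
def height (h₀ : ℕ) (r : ℕ → ℕ) (s : ℕ → ℕ → ℕ) : ℕ → ℕ
  | 0 => h₀
  | j + 1 => height h₀ r s j * r j + ∑ i ∈ Finset.range (r j), s j i

/-- The position, in the tower of stage `j + 1`, of the base of column `i` of the tower of
stage `j`. -/
def columnStart (h₀ : ℕ) (r : ℕ → ℕ) (s : ℕ → ℕ → ℕ) (j i : ℕ) : ℕ :=
  i * height h₀ r s j + ∑ k ∈ Finset.range i, s j k

variable {X : Type*} [MeasurableSpace X]

/-- `T` is the rank-one automorphism of `(X, μ)` obtained by cutting and stacking from the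
initial height `h₀`, the numbers of columns `r j ≥ 2` and the spacer parameters `s j i`,
with the bases `E j` of the towers: the tower of stage `j` consists of the disjoint floors
`E j, T (E j), …, T ^ (h j - 1) (E j)`; its base `E j` is cut into `r j` pieces (of equal
measure, since `T` preserves `μ`), the first of which is `E (j + 1)` and each of which is carried
to the next one by `T ^ (h j + s j i)`; the towers fill `X`, and every measurable set of finite
measure can be approximated by unions of floors. -/
structure IsRankOneConstruction (μ : Measure X) (T : X ≃ᵐ X) (h₀ : ℕ) (r : ℕ → ℕ)
    (s : ℕ → ℕ → ℕ) (E : ℕ → Set X) : Prop where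
  measurePreserving : MeasurePreserving T μ μ
  height_pos : 1 ≤ h₀
  two_le_columns : ∀ j, 2 ≤ r j
  measurableSet_base : ∀ j, MeasurableSet (E j)
  base_pos : 0 < μ (E 0)
  base_lt_top : μ (E 0) < ∞
  disjoint_floors : ∀ j, ∀ a < height h₀ r s j, ∀ b < height h₀ r s j, a ≠ b →
    Disjoint (iter T a '' E j) (iter T b '' E j)
  cut : ∀ j, E j = ⋃ i ∈ Finset.range (r j), iter T (columnStart h₀ r s j i) '' E (j + 1)
  fill : ⋃ j, ⋃ a ∈ Finset.range (height h₀ r s j), iter T a '' E j = univ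
  approx : ∀ A : Set X, MeasurableSet A → μ A < ∞ → ∀ ε : ℝ≥0∞, 0 < ε →
    ∃ j, ∃ F ⊆ Finset.range (height h₀ r s j),
      μ (symmDiff A (⋃ a ∈ F, iter T a '' E j)) < ε

/-- `T` is a rank-one automorphism of `(X, μ)`. -/
def IsRankOne (μ : Measure X) (T : X ≃ᵐ X) : Prop :=
  ∃ (h₀ : ℕ) (r : ℕ → ℕ) (s : ℕ → ℕ → ℕ) (E : ℕ → Set X), IsRankOneConstruction μ T h₀ r s E

end RankOne

/-! ### Poisson suspensions -/

section Poisson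

/-- Configurations: countable subsets of `X`. (Under the Poisson measure of a `σ`-finite
measure, almost every configuration meets each set of a given countable family of sets of finite
measure in finitely many points, and it is infinite if the measure is infinite.) -/
def Configuration (X : Type*) : Type _ := {x : Set X // x.Countable}

variable {X : Type*}

/-- The number of points of a configuration in `A`. -/
def Configuration.count (A : Set X) (x : Configuration X) : ℕ∞ := (x.1 ∩ A).encard

/-- The cylinder `C(A, k)`: configurations with exactly `k` points in `A`. -/
def cylinder (A : Set X) (k : ℕ) : Set (Configuration X) :=
  {x | x.count A = (k : ℕ∞)}

variable [MeasurableSpace X]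

/-- The `σ`-algebra generated by the counting maps of measurable sets. -/
instance Configuration.instMeasurableSpace : MeasurableSpace (Configuration X) :=
  ⨆ A : {A : Set X // MeasurableSet A}, MeasurableSpace.comap (Configuration.count A.1) ⊤

/-- `P` is the Poisson measure over `(X, μ)`. -/
def IsPoissonMeasure (μ : Measure X) (P : Measure (Configuration X)) : Prop :=
  IsProbabilityMeasure P ∧
  ∀ (N : ℕ) (A : Fin N → Set X) (k : Fin N → ℕ),
    (∀ i, MeasurableSet (A i)) → (∀ i, μ (A i) < ∞) → Pairwise (Function.onFun Disjoint A) →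
    P (⋂ i, cylinder (A i) (k i)) =
      ENNReal.ofReal
        (∏ i, μ.real (A i) ^ k i / (Nat.factorial (k i) : ℝ) * Real.exp (-μ.real (A i)))

/-- The image of a configuration. -/
def Configuration.map (T : X ≃ᵐ X) (x : Configuration X) : Configuration X :=
  ⟨T '' x.1, x.2.image T⟩

theorem Configuration.count_map (T : X ≃ᵐ X) (A : Set X) (x : Configuration X) :
    (x.map T).count A = x.count (T ⁻¹' A) := by
  change (T '' x.1 ∩ A).encard = (x.1 ∩ T ⁻¹' A).encard
  rw [← T.injective.encard_image (x.1 ∩ T ⁻¹' A), image_inter_preimage]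

theorem Configuration.measurable_count {A : Set X} (hA : MeasurableSet A) :
    Measurable (Configuration.count A) :=
  Measurable.of_comap_le
    (le_iSup (fun A : {A : Set X // MeasurableSet A} =>
      MeasurableSpace.comap (Configuration.count A.1) ⊤) ⟨A, hA⟩)

theorem Configuration.measurable_map (T : X ≃ᵐ X) : Measurable (Configuration.map T) := by
  refine Measurable.of_le_map (iSup_le fun A => ?_)
  rw [← MeasurableSpace.comap_le_iff_le_map, MeasurableSpace.comap_comp]
  have h : Configuration.count A.1 ∘ Configuration.map T = Configuration.count (T ⁻¹' A.1) := by
    funext x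
    exact Configuration.count_map T A.1 x
  rw [h]
  exact (Configuration.measurable_count (T.measurable A.2)).comap_le

/-- The Poisson suspension of `T`: the action of `T` on configurations. -/
def poissonSuspension (T : X ≃ᵐ X) : Configuration X ≃ᵐ Configuration X where
  toFun := Configuration.map T
  invFun := Configuration.map T.symm
  left_inv x := Subtype.ext (by
    change T.symm '' (T '' x.1) = x.1
    rw [image_image]; simp)
  right_inv x := Subtype.ext (by
    change T '' (T.symm '' x.1) = x.1
    rw [image_image]; simp)
  measurable_toFun := Configuration.measurable_map T
  measurable_invFun := Configuration.measurable_map T.symm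

end Poisson

end PoissonRankOne

end

open PoissonRankOne

/-! The space is the line with Lebesgue measure. The automorphism `s` is built by cutting and
stacking so that every finite list of spacers is the pattern of infinitely many stages, repeated
many times there, and so that the last spacer of each stage is as long as desired. The first
property yields the spectrum, the second the divergence.

Divergence. Let `t` be the conjugate of `s` by a map `φ` that only permutes floors inside the last
spacers. It fixes the initial base `E 0`, so a power of `t` moves `E 0` to the image under `φ⁻¹` of
its copy under the same power of `s`. Since the gaps of `p` and `q` grow, the copies of `E 0` under
the powers `p n` and `q n` of `s` occupy, for `n` in a long interval `[N, N']`, disjoint blocks of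
floors in one last spacer, and `φ` may match them at will. At even stages `t ^ q n` moves `E 0` onto
`s ^ p n` of `E 0`; at odd stages onto `s ^ p (N + N' - n)` of `E 0`, which is disjoint from it
(`exists_rearrangement`, `iter_conjugate_base`). If `C` is the event that `E 0` is void and `c` the
measure of `E 0`, the correlations are `exp (-c)` or `exp (-2c)` throughout `[N, N']`, and the
averages accumulate at both values (`not_tendsto_average`).

Spectrum. Let `A'` be a disjoint union of translates of `A`. Along stages whose pattern has each of
these shifts with the same frequency and high spacers otherwise, the images of the void indicator of
`A` under the Koopman powers at the tower heights converge weakly to a multiple of `z ^ |x ∩ A'|`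
(`tendsto_inner_koopman_height`). Patterns give infinitely many `z` accumulating inside the unit
disc. A vector asymptotically orthogonal to these images is orthogonal to all those functions; its
inner product with them is a power series in `z`, which therefore vanishes, and its constant term is
the inner product with the void indicator of `A'` (`inner_voidLp_eq_zero_of_tendsto`). With `A` the
base of a tower, all void indicators of unions of its floors lie in the cyclic space of the void
indicator of the base, and a Baire argument produces a cyclic vector. With `A' = A`, a vector with
correlations vanishing at infinity is zero, which excludes an absolutely continuous part. Void
indicators span a dense subspace because void events form a generating `π`-system; they also
determine the Poisson measure. -/

set_option linter.unusedSectionVars false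

namespace PoissonRankOne

noncomputable section

/-! ### Continuous functional calculus and cyclic vectors of a unitary operator. -/

section FunctionalCalculus

variable {H : Type*} [NormedAddCommGroup H] [InnerProductSpace ℂ H] [CompleteSpace H]

/-- A unitary operator as an element of the algebra of bounded operators. -/
def toOp (U : H ≃ₗᵢ[ℂ] H) : H →L[ℂ] H := (U.toContinuousLinearEquiv : H →L[ℂ] H)

theorem toOp_mem_unitary (U : H ≃ₗᵢ[ℂ] H) : toOp U ∈ unitary (H →L[ℂ] H) := by
  have h := (Unitary.linearIsometryEquiv (𝕜 := ℂ) (H := H)).symm U |>.2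
  exact h

instance (U : H ≃ₗᵢ[ℂ] H) : IsStarNormal (toOp U) :=
  isStarNormal_of_mem_unitary (toOp_mem_unitary U)

theorem spectrum_toOp_subset (U : H ≃ₗᵢ[ℂ] H) {z : ℂ} (hz : z ∈ spectrum ℂ (toOp U)) :
    z ∈ Submonoid.unitSphere ℂ := by
  have h := (unitary_iff_isStarNormal_and_spectrum_subset_unitary.1 (toOp_mem_unitary U)).2 hz
  have h1 : star z * z = 1 := h.1
  have h2 : ‖z‖ = 1 := by
    have := congrArg norm h1
    rw [norm_mul, norm_star, norm_one] at this
    nlinarith [norm_nonneg z]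
  simpa [Submonoid.unitSphere] using h2

/-- The angle of a point of the spectrum of a unitary operator. -/
def spectrumAngle (U : H ≃ₗᵢ[ℂ] H) : C(spectrum ℂ (toOp U), UnitAddCircle) where
  toFun z := (AddCircle.homeomorphCircle one_ne_zero).symm ⟨z.1, spectrum_toOp_subset U z.2⟩
  continuous_toFun := (AddCircle.homeomorphCircle one_ne_zero).symm.continuous.comp
    (Continuous.subtype_mk continuous_subtype_val _)

/-- The continuous functional calculus of a unitary operator. -/
def funCalc (U : H ≃ₗᵢ[ℂ] H) : C(UnitAddCircle, ℂ) →⋆ₐ[ℂ] (H →L[ℂ] H) :=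
  (cfcHom (R := ℂ) (a := toOp U) (p := IsStarNormal) inferInstance).comp
    (ContinuousMap.compStarAlgHom' ℂ ℂ (spectrumAngle U))

theorem continuous_funCalc (U : H ≃ₗᵢ[ℂ] H) : Continuous (funCalc U) := by
  refine (cfcHom_continuous (R := ℂ) (a := toOp U) (p := IsStarNormal) inferInstance).comp ?_
  exact ContinuousMap.continuous_precomp _

theorem funCalc_fourier_one (U : H ≃ₗᵢ[ℂ] H) : funCalc U (fourier 1) = toOp U := by
  have h : ContinuousMap.compStarAlgHom' ℂ ℂ (spectrumAngle U) (fourier 1) =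
      (ContinuousMap.id ℂ).restrict (spectrum ℂ (toOp U)) := by
    ext z
    change fourier 1 (spectrumAngle U z) = z.1
    rw [fourier_one]
    have : AddCircle.toCircle (spectrumAngle U z) =
      AddCircle.homeomorphCircle one_ne_zero (spectrumAngle U z) :=
      (AddCircle.homeomorphCircle_apply one_ne_zero _).symm
    rw [this]
    exact congrArg (fun c : Circle => (c : ℂ))
      ((AddCircle.homeomorphCircle one_ne_zero).apply_symm_apply _)
  rw [funCalc, StarAlgHom.comp_apply, h]
  exact cfcHom_id (R := ℂ) (a := toOp U) (p := IsStarNormal) inferInstance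

theorem fourier_add_fun (m n : ℤ) :
    (fourier (m + n) : C(UnitAddCircle, ℂ)) = fourier m * fourier n := by
  ext x; exact fourier_add

theorem funCalc_fourier (U : H ≃ₗᵢ[ℂ] H) (n : ℤ) : funCalc U (fourier n) = toOp (U ^ n) := by
  have h1 : ∀ n : ℤ, funCalc U (fourier (n + 1)) = funCalc U (fourier n) * toOp U := fun n => by
    rw [fourier_add_fun, map_mul, funCalc_fourier_one]
  have h2 : ∀ n : ℤ, toOp (U ^ (n + 1)) = toOp (U ^ n) * toOp U := fun n => by
    rw [zpow_add_one]; rfl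
  have inv : toOp U * toOp U⁻¹ = 1 := by
    ext v; change U (U⁻¹ v) = v; exact U.apply_symm_apply v
  induction n with
  | zero =>
    have : (fourier 0 : C(UnitAddCircle, ℂ)) = 1 := by ext x; exact fourier_zero
    rw [this, map_one]; rfl
  | succ n ih => rw [h1, ih, ← h2]
  | pred n ih =>
    have e1 := h1 (-(n : ℤ) - 1)
    have e2 := h2 (-(n : ℤ) - 1)
    rw [sub_add_cancel] at e1 e2
    rw [ih, e2] at e1
    have := congrArg (· * toOp U⁻¹) e1
    simpa only [mul_assoc, inv, mul_one] using this.symm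

/-- The cyclic subspace of a vector. -/
def cyclic (U : H ≃ₗᵢ[ℂ] H) (v : H) : Submodule ℂ H :=
  (Submodule.span ℂ (range fun n : ℤ => (U ^ n) v)).topologicalClosure

theorem zpow_mem_cyclic (U : H ≃ₗᵢ[ℂ] H) (v : H) (n : ℤ) : (U ^ n) v ∈ cyclic U v :=
  Submodule.le_topologicalClosure _ (Submodule.subset_span ⟨n, rfl⟩)

theorem isClosed_cyclic (U : H ≃ₗᵢ[ℂ] H) (v : H) : IsClosed (cyclic U v : Set H) :=
  Submodule.isClosed_topologicalClosure _

/-- Trigonometric polynomials are uniformly dense and the calculus is continuous. -/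
theorem funCalc_mem_cyclic (U : H ≃ₗᵢ[ℂ] H) (v : H) (f : C(UnitAddCircle, ℂ)) :
    funCalc U f v ∈ cyclic U v := by
  have hf : f ∈ (Submodule.span ℂ (range <| @fourier 1)).topologicalClosure := by
    rw [span_fourier_closure_eq_top]; trivial
  let L : C(UnitAddCircle, ℂ) →ₗ[ℂ] H :=
    (ContinuousLinearMap.apply ℂ H v).toLinearMap ∘ₗ (funCalc U).toAlgHom.toLinearMap
  have hL : Continuous L :=
    (ContinuousLinearMap.apply ℂ H v).continuous.comp (continuous_funCalc U)
  have hcl : IsClosed (L ⁻¹' (cyclic U v : Set H)) := (isClosed_cyclic U v).preimage hL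
  have hsub : Submodule.span ℂ (range <| @fourier 1) ≤ (cyclic U v).comap L := by
    rw [Submodule.span_le]
    rintro _ ⟨n, rfl⟩
    change funCalc U (fourier n) v ∈ cyclic U v
    rw [funCalc_fourier]
    exact zpow_mem_cyclic U v n
  exact (Submodule.topologicalClosure_minimal _ hsub hcl) hf

theorem cyclic_le_of_mem {U : H ≃ₗᵢ[ℂ] H} {v : H} {K : Submodule ℂ H} (hK : IsClosed (K : Set H))
    (h : ∀ n : ℤ, (U ^ n) v ∈ K) : cyclic U v ≤ K :=
  Submodule.topologicalClosure_minimal _ (Submodule.span_le.2 (by rintro _ ⟨n, rfl⟩; exact h n)) hK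

theorem funCalc_mul_apply (U : H ≃ₗᵢ[ℂ] H) (f g : C(UnitAddCircle, ℂ)) (v : H) :
    funCalc U (f * g) v = funCalc U f (funCalc U g v) := by
  rw [map_mul]; rfl

theorem cyclic_invariant {U : H ≃ₗᵢ[ℂ] H} {v w : H} (hw : w ∈ cyclic U v) (n : ℤ) :
    (U ^ n) w ∈ cyclic U v := by
  have hcl : IsClosed ((toOp (U ^ n)) ⁻¹' (cyclic U v : Set H)) :=
    (isClosed_cyclic U v).preimage (toOp (U ^ n)).continuous
  have : cyclic U v ≤ (cyclic U v).comap (toOp (U ^ n)).toLinearMap := by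
    refine cyclic_le_of_mem hcl fun k => ?_
    change (U ^ n) ((U ^ k) v) ∈ cyclic U v
    have : (U ^ n) ((U ^ k) v) = (U ^ (n + k)) v := by rw [zpow_add]; rfl
    rw [this]
    exact zpow_mem_cyclic U v _
  exact this hw

theorem cyclic_le_cyclic {U : H ≃ₗᵢ[ℂ] H} {v w : H} (hw : w ∈ cyclic U v) :
    cyclic U w ≤ cyclic U v :=
  cyclic_le_of_mem (isClosed_cyclic U v) (cyclic_invariant hw)

/-- The inverse `1 / f` is continuous, and its calculus recovers `v` from `funCalc U f v`. -/
theorem cyclic_funCalc_of_ne_zero (U : H ≃ₗᵢ[ℂ] H) (v : H) (f : C(UnitAddCircle, ℂ))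
    (hf : ∀ t, f t ≠ 0) : cyclic U v ≤ cyclic U (funCalc U f v) := by
  let g : C(UnitAddCircle, ℂ) := ⟨fun t => (f t)⁻¹, f.continuous.inv₀ hf⟩
  have hgf : g * f = 1 := by ext t; exact inv_mul_cancel₀ (hf t)
  have h := funCalc_mem_cyclic U (funCalc U f v) g
  rw [← funCalc_mul_apply, hgf, map_one] at h
  exact cyclic_le_cyclic h

/-- The approximation is by trigonometric polynomials, whose smoothness allows them to be perturbed
into functions without zeros. -/
theorem exists_fourier_span_near {U : H ≃ₗᵢ[ℂ] H} {v w : H} (hw : w ∈ cyclic U v) {ε : ℝ}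
    (hε : 0 < ε) : ∃ f ∈ Submodule.span ℂ (range <| @fourier 1), ‖funCalc U f v - w‖ < ε := by
  let L : C(UnitAddCircle, ℂ) →ₗ[ℂ] H :=
    (ContinuousLinearMap.apply ℂ H v).toLinearMap ∘ₗ (funCalc U).toAlgHom.toLinearMap
  have hspan : Submodule.span ℂ (range fun n : ℤ => (U ^ n) v) =
      (Submodule.span ℂ (range <| @fourier 1)).map L := by
    rw [Submodule.map_span, ← range_comp]
    congr 2
    funext n
    change (U ^ n) v = funCalc U (fourier n) v
    rw [funCalc_fourier]; rfl
  have hw' : w ∈ closure (Submodule.span ℂ (range fun n : ℤ => (U ^ n) v) : Set H) := hw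
  obtain ⟨b, hb, hbw⟩ := Metric.mem_closure_iff.1 hw' ε hε
  rw [hspan] at hb
  obtain ⟨f, hf, rfl⟩ := hb
  refine ⟨f, hf, ?_⟩
  rw [← dist_eq_norm, dist_comm]
  exact hbw

/-- A trigonometric polynomial traces a `C¹` curve in the plane, whose range has dense complement; a
small translation moves it off the origin. -/
theorem exists_add_const_ne_zero {f : C(UnitAddCircle, ℂ)}
    (hf : f ∈ Submodule.span ℂ (range <| @fourier 1)) {ε : ℝ} (hε : 0 < ε) :
    ∃ δ : ℂ, ‖δ‖ < ε ∧ ∀ t, (f + ContinuousMap.const UnitAddCircle δ) t ≠ 0 := by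
  have hsm : ContDiff ℝ 1 fun x : ℝ => f (x : UnitAddCircle) := by
    induction hf using Submodule.span_induction with
    | mem f hf =>
      obtain ⟨n, rfl⟩ := hf
      simp only [fourier_coe_apply]
      have : ContDiff ℝ 1 fun x : ℝ => (x : ℂ) := Complex.ofRealCLM.contDiff
      fun_prop
    | zero => exact contDiff_const
    | add f g _ _ hf hg => exact hf.add hg
    | smul c f _ hf => exact hf.const_smul c
  have hd := hsm.dense_compl_range_of_finrank_lt_finrank (by simp)
  obtain ⟨δ, hδ, hδ'⟩ := Metric.dense_iff.1 hd 0 ε hε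
  refine ⟨-δ, by simpa using hδ, fun t h => ?_⟩
  obtain ⟨x, rfl⟩ := QuotientAddGroup.mk_surjective t
  refine hδ' ⟨x, ?_⟩
  have hx : f (x : UnitAddCircle) + -δ = 0 := h
  linear_combination hx

/-- If the cyclic subspaces of a sequence of vectors eventually contain every vector of a total
sequence, then the operator has simple spectrum. -/
theorem hasSimpleSpectrum_of_eventually_mem_cyclic (U : H ≃ₗᵢ[ℂ] H) (f v : ℕ → H)
    (hf : (Submodule.span ℂ (range f)).topologicalClosure = ⊤)
    (h : ∀ i, ∀ᶠ j in atTop, f i ∈ cyclic U (v j)) : HasSimpleSpectrum U := by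
  -- Baire category: a vector in all of these sets comes arbitrarily close to every `f i` under
  -- functions of `U`, so it is cyclic. For density, a vector is first moved into the cyclic space
  -- of some `v j` that also contains `f i`.
  let G : ℕ × ℕ → Set H := fun p =>
    ⋃ g : C(UnitAddCircle, ℂ), {w | ‖funCalc U g w - f p.1‖ < 1 / ((p.2 : ℝ) + 1)}
  have hopen : ∀ p, IsOpen (G p) := fun p => isOpen_iUnion fun g =>
    isOpen_lt ((((funCalc U g).continuous).sub continuous_const).norm) continuous_const
  have hdense : ∀ p, Dense (G p) := by
    rintro ⟨i, k⟩
    rw [Metric.dense_iff]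
    intro w ε hε
    have hwcl : w ∈ closure (Submodule.span ℂ (range f) : Set H) := by
      have : w ∈ (Submodule.span ℂ (range f)).topologicalClosure := by rw [hf]; trivial
      exact this
    obtain ⟨w₀, hw₀, hww₀⟩ := Metric.mem_closure_iff.1 hwcl (ε / 3) (by positivity)
    have hev : ∀ᶠ j in atTop, w₀ ∈ cyclic U (v j) := by
      clear hww₀
      induction hw₀ using Submodule.span_induction with
      | mem x hx => obtain ⟨i, rfl⟩ := hx; exact h i
      | zero => exact Eventually.of_forall fun j => Submodule.zero_mem _
      | add x y _ _ hx hy => filter_upwards [hx, hy] with j h1 h2 using Submodule.add_mem _ h1 h2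
      | smul c x _ hx => filter_upwards [hx] with j h1 using Submodule.smul_mem _ c h1
    obtain ⟨j, hj₀, hji⟩ := (hev.and (h i)).exists
    obtain ⟨g, hg, hgw⟩ := exists_fourier_span_near hj₀ (ε := ε / 3) (by positivity)
    -- Adding `δ` removes the zeros of `g`, so that `w₁` generates the whole cyclic space of `v j`,
    -- hence reaches `f i`.
    obtain ⟨δ, hδ, hδ0⟩ := exists_add_const_ne_zero hg
      (ε := ε / 3 / (‖v j‖ + 1)) (by positivity)
    set w₁ := funCalc U (g + ContinuousMap.const _ δ) (v j) with hw₁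
    have e1 : w₁ = funCalc U g (v j) + δ • v j := by
      have : (ContinuousMap.const _ δ : C(UnitAddCircle, ℂ)) = δ • 1 := by ext t; simp
      rw [hw₁, map_add, this, map_smul, map_one]
      rfl
    have hδv : ‖δ • v j‖ < ε / 3 := by
      rw [norm_smul]
      calc ‖δ‖ * ‖v j‖ ≤ ‖δ‖ * (‖v j‖ + 1) := by gcongr; linarith
        _ < ε / 3 := by rwa [← lt_div_iff₀ (by positivity)]
    have hmem : f i ∈ cyclic U w₁ := cyclic_funCalc_of_ne_zero U (v j) _ hδ0 hji
    obtain ⟨g', -, hg'⟩ := exists_fourier_span_near hmem (ε := 1 / ((k : ℝ) + 1)) (by positivity)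
    refine ⟨w₁, ?_, mem_iUnion.2 ⟨g', hg'⟩⟩
    rw [Metric.mem_ball, dist_comm]
    calc dist w w₁ ≤ dist w w₀ + dist w₀ w₁ := dist_triangle _ _ _
      _ < ε / 3 + (ε / 3 + ε / 3) := by
        refine add_lt_add hww₀ ?_
        rw [dist_comm, dist_eq_norm, e1]
        calc ‖funCalc U g (v j) + δ • v j - w₀‖ = ‖(funCalc U g (v j) - w₀) + δ • v j‖ := by
              congr 1; abel
          _ ≤ _ := norm_add_le _ _
          _ < _ := add_lt_add hgw hδv
      _ = ε := by ring
  obtain ⟨w, hw⟩ := (dense_iInter_of_isOpen hopen hdense).nonempty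
  refine ⟨w, ?_⟩
  change cyclic U w = ⊤
  rw [eq_top_iff, ← hf]
  refine Submodule.topologicalClosure_minimal _ (Submodule.span_le.2 ?_) (isClosed_cyclic U w)
  rintro _ ⟨i, rfl⟩
  rw [← (isClosed_cyclic U w).closure_eq]
  refine Metric.mem_closure_iff.2 fun ε hε => ?_
  obtain ⟨k, hk⟩ := exists_nat_one_div_lt hε
  obtain ⟨g, hg⟩ := mem_iUnion.1 (mem_iInter.1 hw (i, k))
  refine ⟨funCalc U g w, funCalc_mem_cyclic U w g, ?_⟩
  rw [dist_comm, dist_eq_norm]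
  exact lt_trans hg hk

end FunctionalCalculus

/-! ### Spectral measures and a criterion for singular spectrum. -/

section SpectralMeasure

variable {H : Type*} [NormedAddCommGroup H] [InnerProductSpace ℂ H]

/-- A bounded family converges weakly as soon as it does so on a total set of vectors. -/
theorem tendsto_inner_of_total {ι : Type*} {l : Filter ι} {x : ι → H} {y : H} {C : ℝ}
    (hC : ∀ i, ‖x i‖ ≤ C) {S : Set H} (hS : ∀ h ∈ S, Tendsto (fun i => inner ℂ h (x i)) l
      (𝓝 (inner ℂ h y))) {h : H} (hh : h ∈ (Submodule.span ℂ S).topologicalClosure) :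
    Tendsto (fun i => inner ℂ h (x i)) l (𝓝 (inner ℂ h y)) := by
  have hspan : ∀ h ∈ Submodule.span ℂ S, Tendsto (fun i => inner ℂ h (x i)) l
      (𝓝 (inner ℂ h y)) := by
    intro h hh
    induction hh using Submodule.span_induction with
    | mem x hx => exact hS x hx
    | zero => simpa only [inner_zero_left] using tendsto_const_nhds
    | add a b _ _ ha hb => simpa only [inner_add_left] using ha.add hb
    | smul c a _ ha => simpa only [inner_smul_left] using ha.const_mul _
  rw [Metric.tendsto_nhds]
  intro ε hε
  have hD : 0 < |C| + ‖y‖ + 1 := by positivity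
  obtain ⟨b, hb, hbh⟩ := Metric.mem_closure_iff.1
    (show h ∈ closure (Submodule.span ℂ S : Set H) from hh) (ε / 2 / (|C| + ‖y‖ + 1))
      (by positivity)
  filter_upwards [Metric.tendsto_nhds.1 (hspan b hb) (ε / 2) (by positivity)] with i hi
  rw [dist_eq_norm] at hi hbh ⊢
  have e : inner ℂ h (x i) - inner ℂ h y =
      inner ℂ (h - b) (x i - y) + (inner ℂ b (x i) - inner ℂ b y) := by
    simp only [inner_sub_left, inner_sub_right]; ring
  rw [e]
  have h1 : ‖x i - y‖ ≤ |C| + ‖y‖ :=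
    (norm_sub_le _ _).trans (add_le_add ((hC i).trans (le_abs_self C)) le_rfl)
  calc _ ≤ ‖h - b‖ * ‖x i - y‖ + ‖inner ℂ b (x i) - inner ℂ b y‖ :=
        (norm_add_le _ _).trans (add_le_add (norm_inner_le_norm _ _) le_rfl)
    _ < ε / 2 + ε / 2 := by
        refine add_lt_add_of_le_of_lt ?_ hi
        calc ‖h - b‖ * ‖x i - y‖ ≤ ε / 2 / (|C| + ‖y‖ + 1) * (|C| + ‖y‖ + 1) := by
              gcongr; linarith
          _ = ε / 2 := by field_simp
    _ = ε := by ring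

variable [CompleteSpace H]

/-- The positive functional on continuous functions on the circle given by a vector. -/
def spectralFunctional (U : H ≃ₗᵢ[ℂ] H) (v : H) :
    CompactlySupportedContinuousMap UnitAddCircle ℝ →ₚ[ℝ] ℝ :=
  PositiveLinearMap.mk₀
    { toFun := fun f => (inner ℂ v (funCalc U
        ((⟨Complex.ofReal, Complex.continuous_ofReal⟩ : C(ℝ, ℂ)).comp f.toContinuousMap) v)).re
      map_add' := fun f g => by
        have : (⟨Complex.ofReal, Complex.continuous_ofReal⟩ : C(ℝ, ℂ)).comp (f + g).toContinuousMap
            = (⟨Complex.ofReal, Complex.continuous_ofReal⟩ : C(ℝ, ℂ)).comp f.toContinuousMap +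
            (⟨Complex.ofReal, Complex.continuous_ofReal⟩ : C(ℝ, ℂ)).comp g.toContinuousMap := by
          ext t; exact Complex.ofReal_add _ _
        rw [this, map_add, add_apply, inner_add_right, Complex.add_re]
      map_smul' := fun c f => by
        have : (⟨Complex.ofReal, Complex.continuous_ofReal⟩ : C(ℝ, ℂ)).comp (c • f).toContinuousMap
            = (c : ℂ) • (⟨Complex.ofReal, Complex.continuous_ofReal⟩ : C(ℝ, ℂ)).comp
              f.toContinuousMap := by
          ext t; exact Complex.ofReal_mul _ _
        rw [this, map_smul, smul_apply, inner_smul_right,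
          Complex.re_ofReal_mul]
        rfl }
    (by
      intro f hf
      -- Positivity: with `g` the square root of `f`, the value of the functional is the squared
      -- norm of `funCalc U g v`.
      let g : C(UnitAddCircle, ℂ) := ⟨fun t => (Real.sqrt (f t) : ℂ), by fun_prop⟩
      have hg : (⟨Complex.ofReal, Complex.continuous_ofReal⟩ : C(ℝ, ℂ)).comp f.toContinuousMap
          = star g * g := by
        ext t
        change ((f t : ℝ) : ℂ) = star ((Real.sqrt (f t) : ℝ) : ℂ) * ((Real.sqrt (f t) : ℝ) : ℂ)
        rw [RCLike.star_def, Complex.conj_ofReal, ← Complex.ofReal_mul,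
          Real.mul_self_sqrt (hf t)]
      change 0 ≤ (inner ℂ v (funCalc U ((⟨Complex.ofReal, Complex.continuous_ofReal⟩ :
        C(ℝ, ℂ)).comp f.toContinuousMap) v)).re
      rw [hg, map_mul, map_star, ContinuousLinearMap.star_eq_adjoint]
      change 0 ≤ (inner ℂ v (ContinuousLinearMap.adjoint (funCalc U g) (funCalc U g v))).re
      rw [ContinuousLinearMap.adjoint_inner_right]
      exact inner_self_nonneg (𝕜 := ℂ))

theorem inner_funCalc_star_mul (U : H ≃ₗᵢ[ℂ] H) (v : H) (f g : C(UnitAddCircle, ℂ)) :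
    inner ℂ v (funCalc U (star f * g) v) = inner ℂ (funCalc U f v) (funCalc U g v) := by
  rw [map_mul, map_star, ContinuousLinearMap.star_eq_adjoint]
  change inner ℂ v (ContinuousLinearMap.adjoint (funCalc U f) (funCalc U g v)) = _
  rw [ContinuousLinearMap.adjoint_inner_right]

/-- Existence of spectral measures, with the functional calculus of all continuous functions. -/
theorem exists_spectralMeasure (U : H ≃ₗᵢ[ℂ] H) (v : H) :
    ∃ σ : Measure UnitAddCircle, IsFiniteMeasure σ ∧
      ∀ f : C(UnitAddCircle, ℂ), ∫ t, f t ∂σ = inner ℂ v (funCalc U f v) := by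
  refine ⟨RealRMK.rieszMeasure (spectralFunctional U v), inferInstance, fun f => ?_⟩
  set σ := RealRMK.rieszMeasure (spectralFunctional U v)
  have hreal : ∀ g : C(UnitAddCircle, ℝ), ∫ t, ((g t : ℝ) : ℂ) ∂σ = inner ℂ v (funCalc U
      ((⟨Complex.ofReal, Complex.continuous_ofReal⟩ : C(ℝ, ℂ)).comp g) v) := by
    intro g
    have h1 := RealRMK.integral_rieszMeasure (spectralFunctional U v)
      (CompactlySupportedContinuousMap.continuousMapEquiv g)
    have h2 : ∫ t, g t ∂σ = (inner ℂ v (funCalc U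
      ((⟨Complex.ofReal, Complex.continuous_ofReal⟩ : C(ℝ, ℂ)).comp g) v)).re := h1
    rw [integral_complex_ofReal, h2]
    have hsa : star ((⟨Complex.ofReal, Complex.continuous_ofReal⟩ : C(ℝ, ℂ)).comp g) =
        (⟨Complex.ofReal, Complex.continuous_ofReal⟩ : C(ℝ, ℂ)).comp g := by
      ext t; exact Complex.conj_ofReal _
    rw [← Complex.conj_eq_iff_re, inner_conj_symm]
    have := inner_funCalc_star_mul U v ((⟨Complex.ofReal, Complex.continuous_ofReal⟩ :
      C(ℝ, ℂ)).comp g) 1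
    rw [hsa, mul_one, map_one] at this
    rw [this]; rfl
  let fr : C(UnitAddCircle, ℝ) := ⟨fun t => (f t).re, by fun_prop⟩
  let fi : C(UnitAddCircle, ℝ) := ⟨fun t => (f t).im, by fun_prop⟩
  have hf : f = (⟨Complex.ofReal, Complex.continuous_ofReal⟩ : C(ℝ, ℂ)).comp fr +
      Complex.I • (⟨Complex.ofReal, Complex.continuous_ofReal⟩ : C(ℝ, ℂ)).comp fi := by
    ext t
    change f t = ((f t).re : ℂ) + Complex.I * ((f t).im : ℂ)
    rw [mul_comm, Complex.re_add_im]
  have hint : ∀ g : C(UnitAddCircle, ℂ), Integrable g σ := fun g =>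
    (BoundedContinuousFunction.mkOfCompact g).integrable σ
  conv_rhs => rw [hf]
  rw [map_add, map_smul, add_apply, smul_apply,
    inner_add_right, inner_smul_right, ← hreal, ← hreal, ← integral_const_mul, ← integral_add]
  · refine integral_congr_ae (Eventually.of_forall fun t => ?_)
    change f t = ((f t).re : ℂ) + Complex.I * ((f t).im : ℂ)
    rw [mul_comm, Complex.re_add_im]
  · exact hint ((⟨Complex.ofReal, Complex.continuous_ofReal⟩ : C(ℝ, ℂ)).comp fr)
  · exact (hint ((⟨Complex.ofReal, Complex.continuous_ofReal⟩ : C(ℝ, ℂ)).comp fi)).const_mul _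

/-- The map `f ↦ funCalc U f v` is therefore isometric for the norm of `L²(σ)`, and Cauchy sequences
of continuous functions there, such as approximations of an indicator, yield limit vectors in `H`.
-/
theorem inner_funCalc_eq_inner_toLp {U : H ≃ₗᵢ[ℂ] H} {v : H} {σ : Measure UnitAddCircle}
    [IsFiniteMeasure σ] (hσ : ∀ f : C(UnitAddCircle, ℂ), ∫ t, f t ∂σ = inner ℂ v (funCalc U f v))
    (f g : C(UnitAddCircle, ℂ)) : inner ℂ (funCalc U f v) (funCalc U g v) =
      inner ℂ (ContinuousMap.toLp 2 σ ℂ f) (ContinuousMap.toLp 2 σ ℂ g) := by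
  rw [← inner_funCalc_star_mul, ← hσ, ContinuousMap.inner_toLp]
  refine integral_congr_ae (Eventually.of_forall fun t => ?_)
  change star (f t) * g t = g t * _
  rw [mul_comm]; rfl

theorem norm_funCalc_eq_norm_toLp {U : H ≃ₗᵢ[ℂ] H} {v : H} {σ : Measure UnitAddCircle}
    [IsFiniteMeasure σ] (hσ : ∀ f : C(UnitAddCircle, ℂ), ∫ t, f t ∂σ = inner ℂ v (funCalc U f v))
    (f : C(UnitAddCircle, ℂ)) : ‖funCalc U f v‖ = ‖ContinuousMap.toLp 2 σ ℂ f‖ := by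
  have h := inner_funCalc_eq_inner_toLp hσ f f
  rw [inner_self_eq_norm_sq_to_K, inner_self_eq_norm_sq_to_K] at h
  have hsq : ‖funCalc U f v‖ ^ 2 = ‖ContinuousMap.toLp 2 σ ℂ f‖ ^ 2 := by exact_mod_cast h
  exact (sq_eq_sq₀ (norm_nonneg _) (norm_nonneg _)).1 hsq

/-- Fourier coefficients of a bounded measurable function vanish at infinity. -/
theorem tendsto_fourier_integral_zero {f : UnitAddCircle → ℂ}
    (hf : MemLp f 2 (AddCircle.haarAddCircle : Measure UnitAddCircle)) :
    Tendsto (fun n : ℤ => ∫ t, fourier n t * f t ∂AddCircle.haarAddCircle) cofinite (𝓝 0) := by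
  have h := (hasSum_sq_fourierCoeff hf.toLp).summable.tendsto_cofinite_zero
  have h2 : Tendsto (fun n : ℤ => ‖fourierCoeff hf.toLp n‖) cofinite (𝓝 0) := by
    simpa using h.sqrt
  have h3 : Tendsto (fun n : ℤ => fourierCoeff hf.toLp (-n)) cofinite (𝓝 0) :=
    (tendsto_zero_iff_norm_tendsto_zero.2 h2).comp (neg_injective.tendsto_cofinite)
  refine h3.congr fun n => ?_
  rw [fourierCoeff_congr_ae hf.coeFn_toLp, fourierCoeff, neg_neg]
  rfl

/-- A unitary operator has singular spectrum as soon as no nonzero vector has correlations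
that vanish at infinity. -/
theorem hasSingularSpectrum_of_forall_eq_zero (U : H ≃ₗᵢ[ℂ] H)
    (h : ∀ g : H, (∀ w : H, Tendsto (fun n : ℤ => inner ℂ w ((U ^ n) g)) cofinite (𝓝 0)) →
      g = 0) : HasSingularSpectrum U := by
  intro v
  obtain ⟨σ, hfin, hσ⟩ := exists_spectralMeasure U v
  refine ⟨σ, ⟨hfin, fun n => by rw [hσ, funCalc_fourier]; rfl⟩, ?_⟩
  rw [← Measure.rnDeriv_eq_zero]
  set lam : Measure UnitAddCircle := AddCircle.haarAddCircle
  obtain ⟨S, hS, hSσ, hSl⟩ := Measure.mutuallySingular_singularPart σ lam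
  -- the absolutely continuous part is carried by `S`
  have key : ∀ M : ℕ, lam ({t | σ.rnDeriv lam t ≠ 0} ∩ {t | σ.rnDeriv lam t ≤ M}) = 0 := by
    intro M
    -- On `B` the measure `σ` has a density bounded by `M`. The vector `g` that corresponds to the
    -- indicator of `B` has correlations given by Fourier coefficients of a bounded function; they
    -- vanish at infinity, so `g = 0` by hypothesis and `σ B = 0`.
    set B : Set UnitAddCircle := S ∩ ({t | σ.rnDeriv lam t ≠ 0} ∩ {t | σ.rnDeriv lam t ≤ M})
      with hB
    have hBm : MeasurableSet B := hS.inter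
      (((Measure.measurable_rnDeriv σ lam) (measurableSet_singleton 0).compl).inter
      (measurableSet_le (Measure.measurable_rnDeriv σ lam) measurable_const))
    have hrestr : σ.restrict B = (lam.restrict B).withDensity (σ.rnDeriv lam) := by
      conv_lhs => rw [Measure.haveLebesgueDecomposition_add σ lam]
      rw [Measure.restrict_add, restrict_withDensity hBm]
      have : (σ.singularPart lam).restrict B = 0 := by
        rw [Measure.restrict_eq_zero]
        exact measure_mono_null inter_subset_left hSσ
      rw [this, zero_add]
    set b : Lp ℂ 2 σ := indicatorConstLp 2 hBm (measure_ne_top σ B) (1 : ℂ) with hb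
    -- approximate the indicator of `B` by continuous functions
    obtain ⟨φ, hφ⟩ : ∃ φ : ℕ → C(UnitAddCircle, ℂ),
        Tendsto (fun k => ContinuousMap.toLp 2 σ ℂ (φ k)) atTop (𝓝 b) := by
      have hd := ContinuousMap.toLp_denseRange ℂ σ ℂ (p := 2) (by simp) b
      obtain ⟨x, hx, hxb⟩ := mem_closure_iff_seq_limit.1 hd
      choose φ hφ using hx
      exact ⟨φ, by simpa only [hφ] using hxb⟩
    have hcau : CauchySeq fun k => funCalc U (φ k) v := by
      have hc := hφ.cauchySeq
      rw [Metric.cauchySeq_iff] at hc ⊢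
      intro ε hε
      obtain ⟨N, hN⟩ := hc ε hε
      refine ⟨N, fun k hk l hl => ?_⟩
      have := hN k hk l hl
      rw [dist_eq_norm, ← map_sub] at this
      rwa [dist_eq_norm, ← sub_apply, ← map_sub, norm_funCalc_eq_norm_toLp hσ]
    obtain ⟨g, hg⟩ := cauchySeq_tendsto_of_complete hcau
    have hnorm : ‖g‖ = ‖b‖ := by
      refine tendsto_nhds_unique hg.norm ?_
      simpa only [norm_funCalc_eq_norm_toLp hσ] using hφ.norm
    have hgcyc : g ∈ cyclic U v := (isClosed_cyclic U v).mem_of_tendsto hg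
      (Eventually.of_forall fun k => funCalc_mem_cyclic U v (φ k))
    have hinner : ∀ f : C(UnitAddCircle, ℂ), inner ℂ (funCalc U f v) g =
        ∫ t in B, star (f t) ∂σ := by
      intro f
      have h1 : Tendsto (fun k => inner ℂ (funCalc U f v) (funCalc U (φ k) v)) atTop
          (𝓝 (inner ℂ (funCalc U f v) g)) := tendsto_const_nhds.inner hg
      have h2 : Tendsto (fun k => inner ℂ (funCalc U f v) (funCalc U (φ k) v)) atTop
          (𝓝 (inner ℂ (ContinuousMap.toLp 2 σ ℂ f) b)) := by
        simp only [inner_funCalc_eq_inner_toLp hσ]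
        exact tendsto_const_nhds.inner hφ
      rw [tendsto_nhds_unique h1 h2, ← inner_conj_symm, hb, L2.inner_indicatorConstLp_one,
        ← integral_conj]
      refine setIntegral_congr_ae hBm ?_
      filter_upwards [ContinuousMap.coeFn_toLp (𝕜 := ℂ) (p := 2) σ f] with t ht _
      rw [ht]; rfl
    have hweak : ∀ w ∈ cyclic U v, Tendsto (fun n : ℤ => inner ℂ w ((U ^ n) g)) cofinite
        (𝓝 (inner ℂ w (0 : H))) := by
      intro w hw
      refine tendsto_inner_of_total (C := ‖g‖) (fun n => ((U ^ n).norm_map g).le)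
        (S := range fun n : ℤ => (U ^ n) v) ?_ hw
      rintro _ ⟨k, rfl⟩
      rw [inner_zero_right]
      have hrw : ∀ n : ℤ, inner ℂ ((U ^ k) v) ((U ^ n) g) =
          ∫ t, fourier n t * B.indicator (fun t => star (fourier k t : ℂ) *
            ((σ.rnDeriv lam t).toReal : ℂ)) t ∂lam := by
        intro n
        have e1 : inner ℂ ((U ^ k) v) ((U ^ n) g) = inner ℂ ((U ^ (k - n)) v) g := by
          rw [← (U ^ n).inner_map_map ((U ^ (k - n)) v) g]
          congr 1
          have : (U ^ n) ((U ^ (k - n)) v) = (U ^ (n + (k - n))) v := by rw [zpow_add]; rfl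
          rw [this]; congr 2; ring
        have e2 : (U ^ (k - n)) v = funCalc U (fourier (k - n)) v := by
          rw [funCalc_fourier]; rfl
        rw [e1, e2, hinner, hrestr, integral_withDensity_eq_integral_toReal_smul
          (Measure.measurable_rnDeriv σ lam)
          (ae_restrict_of_ae (Measure.rnDeriv_lt_top σ lam)), ← integral_indicator hBm]
        refine integral_congr_ae (Eventually.of_forall fun t => ?_)
        by_cases ht : t ∈ B
        · simp only [indicator_of_mem ht, sub_eq_add_neg, fourier_add, fourier_neg, star_mul,
            RCLike.star_def, Complex.conj_conj, Complex.real_smul]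
          ring
        · simp only [indicator_of_notMem ht, mul_zero]
      simp only [hrw]
      refine tendsto_fourier_integral_zero (MemLp.of_bound ?_ (M : ℝ)
        (Eventually.of_forall fun t => ?_))
      · refine (Measurable.indicator ?_ hBm).aestronglyMeasurable
        have := Measure.measurable_rnDeriv σ lam
        exact ((continuous_star.comp (fourier k).continuous).measurable).mul
          (Complex.measurable_ofReal.comp this.ennreal_toReal)
      · by_cases ht : t ∈ B
        · rw [indicator_of_mem ht, norm_mul, norm_star]
          have h1 : ‖(fourier k t : ℂ)‖ = 1 := by rw [fourier_apply]; exact Circle.norm_coe _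
          rw [h1, one_mul, Complex.norm_real, Real.norm_of_nonneg ENNReal.toReal_nonneg]
          have := ENNReal.toReal_mono (by simp) ht.2.2
          simpa using this
        · rw [indicator_of_notMem ht, norm_zero]; positivity
    have hg0 : g = 0 := by
      refine h g fun w => ?_
      have : CompleteSpace (cyclic U v) := (isClosed_cyclic U v).completeSpace_coe
      -- The orbit of `g` stays in the cyclic space of `v`, so only the projection of `w` matters.
      set w' := (cyclic U v).starProjection w
      have hw' := hweak w' (Submodule.starProjection_apply_mem _ w)
      rw [inner_zero_right] at hw'
      refine hw'.congr fun n => ?_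
      have hz : inner ℂ (w - w') ((U ^ n) g) = 0 :=
        Submodule.starProjection_inner_eq_zero w _ (cyclic_invariant hgcyc n)
      rw [inner_sub_left, sub_eq_zero] at hz
      exact hz.symm
    have hσB : σ B = 0 := by
      rw [hg0, norm_zero, hb, norm_indicatorConstLp (by simp) (by simp)] at hnorm
      by_contra hne
      have : 0 < σ.real B := ENNReal.toReal_pos hne (measure_ne_top σ B)
      have h3 : 0 < ‖(1 : ℂ)‖ * σ.real B ^ (1 / (2 : ℝ≥0∞).toReal) := by
        rw [norm_one, one_mul]; positivity
      linarith
    have hlB : lam B = 0 := by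
      have h4 : (lam.withDensity (σ.rnDeriv lam)) B = 0 :=
        le_antisymm ((Measure.withDensity_rnDeriv_le σ lam B).trans hσB.le) zero_le
      rw [withDensity_apply_eq_zero (Measure.measurable_rnDeriv σ lam)] at h4
      exact measure_mono_null (t := {t | σ.rnDeriv lam t ≠ 0} ∩ B)
        (fun t ht => And.intro ht.2.1 ht) h4
    refine measure_mono_null (t := B ∪ Sᶜ) ?_ (measure_union_null hlB hSl)
    intro t ht
    by_cases hts : t ∈ S
    · exact Or.inl ⟨hts, ht⟩
    · exact Or.inr hts
  have hall : ∀ᵐ t ∂lam, ∀ M : ℕ, ¬ (σ.rnDeriv lam t ≠ 0 ∧ σ.rnDeriv lam t ≤ M) := by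
    rw [ae_all_iff]
    intro M
    rw [ae_iff]
    simpa using! key M
  filter_upwards [hall, Measure.rnDeriv_lt_top σ lam] with t ht ht'
  by_contra hne
  obtain ⟨M, hM⟩ := ENNReal.exists_nat_gt ht'.ne
  exact ht M ⟨hne, hM.le⟩

end SpectralMeasure

/-! ### Void events. -/

section Void

variable {X : Type*}

/-- Configurations without points in `A`. -/
def void (A : Set X) : Set (Configuration X) := cylinder A 0

theorem mem_void {A : Set X} {x : Configuration X} : x ∈ void A ↔ x.1 ∩ A = ∅ := by
  change (x.1 ∩ A).encard = ((0 : ℕ) : ℕ∞) ↔ _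
  rw [Nat.cast_zero, encard_eq_zero]

theorem void_iUnion {ι : Sort*} (A : ι → Set X) : void (⋃ i, A i) = ⋂ i, void (A i) := by
  ext x
  simp only [mem_iInter, mem_void, inter_iUnion, iUnion_eq_empty]

theorem void_union (A B : Set X) : void (A ∪ B) = void A ∩ void B := by
  ext x
  simp only [mem_inter_iff, mem_void, inter_union_distrib_left, union_empty_iff]

theorem void_empty : void (∅ : Set X) = univ := by
  ext x; simp [mem_void]

variable [MeasurableSpace X]

theorem measurableSet_cylinder {A : Set X} (hA : MeasurableSet A) (k : ℕ) :
    MeasurableSet (cylinder A k) :=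
  Configuration.measurable_count hA (MeasurableSpace.measurableSet_top (s := {(k : ℕ∞)}))

theorem measurableSet_void {A : Set X} (hA : MeasurableSet A) : MeasurableSet (void A) :=
  measurableSet_cylinder hA 0

end Void

/-! ### Counts as limits of numbers of occupied cells. -/

section Cells

variable {X : Type*} [MeasurableSpace X] [MeasurableSpace.CountablyGenerated X]

/-- The code of the cell of the `n`-th finite partition of a countably generated space. -/
def cellCode (n : ℕ) (a : X) : Fin n → Bool := fun i => MeasurableSpace.mapNatBool X a i

/-- The cells of the `n`-th finite partition. -/
def cell (n : ℕ) (e : Fin n → Bool) : Set X := cellCode n ⁻¹' {e}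

theorem measurable_cellCode (n : ℕ) : Measurable (cellCode n : X → Fin n → Bool) :=
  measurable_pi_lambda _ fun i =>
    (measurable_pi_apply (i : ℕ)).comp (MeasurableSpace.measurable_mapNatBool X)

theorem measurableSet_cell (n : ℕ) (e : Fin n → Bool) : MeasurableSet (cell n e : Set X) :=
  measurable_cellCode n (measurableSet_singleton e)

theorem iUnion_inter_cell (A : Set X) (n : ℕ) : ⋃ e, A ∩ cell n e = A := by
  ext x; simp [cell]

theorem disjoint_cell {n : ℕ} {e e' : Fin n → Bool} (h : e ≠ e') :
    Disjoint (cell n e : Set X) (cell n e') :=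
  Disjoint.preimage _ (disjoint_singleton.2 h)

/-- The number of cells in which a configuration has points of `A`. -/
def hits (A : Set X) (n : ℕ) (x : Configuration X) : ℕ := (cellCode n '' (x.1 ∩ A)).ncard

theorem hits_le_count (A : Set X) (n : ℕ) (x : Configuration X) :
    (hits A n x : ℕ∞) ≤ x.count A := by
  rw [hits, (toFinite _).cast_ncard_eq]
  exact encard_image_le _ _

/-- Each occupied cell contributes one. So `hits` depends on void events only, and refining the
cells turns it into the count. -/
theorem hits_eq_sum (A : Set X) (n : ℕ) (x : Configuration X) :
    hits A n x = ∑ e : Fin n → Bool, (void (A ∩ cell n e))ᶜ.indicator 1 x := by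
  classical
  have : (cellCode n '' (x.1 ∩ A)) =
      ((Finset.univ.filter fun e : Fin n → Bool => x ∈ (void (A ∩ cell n e))ᶜ : Finset _) :
        Set (Fin n → Bool)) := by
    ext e
    simp only [Finset.coe_filter, Finset.mem_univ, true_and, mem_compl_iff, mem_void, mem_ofPred_eq,
      mem_image, ← nonempty_iff_ne_empty]
    constructor
    · rintro ⟨a, ⟨h1, h2⟩, h3⟩; exact ⟨a, h1, h2, h3⟩
    · rintro ⟨a, h1, h2, h3⟩; exact ⟨a, ⟨h1, h2⟩, h3⟩
  rw [hits, this, ncard_coe_finset, Finset.card_filter]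
  refine Finset.sum_congr rfl fun e _ => ?_
  simp [indicator_apply]

variable [MeasurableSpace.SeparatesPoints X]

theorem eventually_cellCode_ne {a b : X} (h : a ≠ b) :
    ∀ᶠ n in atTop, cellCode n a ≠ cellCode n b := by
  have : MeasurableSpace.mapNatBool X a ≠ MeasurableSpace.mapNatBool X b := fun h' =>
    h (MeasurableSpace.injective_mapNatBool X h')
  obtain ⟨i, hi⟩ := Function.ne_iff.1 this
  filter_upwards [eventually_gt_atTop i] with n hn h'
  exact hi (congrFun h' ⟨i, hn⟩)

theorem eventually_injOn_cellCode {S : Set X} (hS : S.Finite) :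
    ∀ᶠ n in atTop, InjOn (cellCode n) S := by
  have h : ∀ a ∈ S, ∀ b ∈ S, ∀ᶠ n in atTop, cellCode n a = cellCode n b → a = b := by
    intro a _ b _
    by_cases hab : a = b
    · exact Eventually.of_forall fun n _ => hab
    · filter_upwards [eventually_cellCode_ne hab] with n hn h' using absurd h' hn
  have h2 : ∀ᶠ n in atTop, ∀ a ∈ S, ∀ b ∈ S, cellCode n a = cellCode n b → a = b :=
    (eventually_all_finite hS).2 fun a ha => (eventually_all_finite hS).2 fun b hb => h a ha b hb
  filter_upwards [h2] with n hn a ha b hb hab using hn a ha b hb hab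

theorem eventually_le_hits {A : Set X} {x : Configuration X} {k : ℕ}
    (hk : (k : ℕ∞) ≤ x.count A) : ∀ᶠ n in atTop, k ≤ hits A n x := by
  obtain ⟨S, hS, hSk⟩ := exists_subset_encard_eq hk
  have hfin : S.Finite := finite_of_encard_eq_coe hSk
  filter_upwards [eventually_injOn_cellCode hfin] with n hn
  have h1 : (cellCode n '' S).ncard = k := by
    rw [hn.ncard_image, ncard, hSk]; rfl
  rw [← h1]
  exact ncard_le_ncard (image_mono hS) (toFinite _)

theorem le_count_iff {A : Set X} {x : Configuration X} {k : ℕ} :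
    (k : ℕ∞) ≤ x.count A ↔ ∃ n, k ≤ hits A n x :=
  ⟨fun h => (eventually_le_hits h).exists, fun ⟨n, hn⟩ =>
    (Nat.cast_le.2 hn).trans (hits_le_count A n x)⟩

theorem eventually_hits_eq {A : Set X} {x : Configuration X} {k : ℕ}
    (hk : x.count A = k) : ∀ᶠ n in atTop, hits A n x = k := by
  filter_upwards [eventually_le_hits hk.ge] with n hn
  exact le_antisymm (by exact_mod_cast (hits_le_count A n x).trans hk.le) hn

/-- The `σ`-algebra of configurations is generated by the void events of sets of finite measure. -/
theorem configuration_measurableSpace_eq (m : Measure X) [SigmaFinite m] :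
    (Configuration.instMeasurableSpace : MeasurableSpace (Configuration X)) =
      MeasurableSpace.generateFrom {V | ∃ A, MeasurableSet A ∧ m A < ∞ ∧ V = void A} := by
  refine le_antisymm (iSup_le ?_) (MeasurableSpace.generateFrom_le ?_)
  · rintro ⟨A, hA⟩
    set M := MeasurableSpace.generateFrom {V | ∃ A : Set X, MeasurableSet A ∧ m A < ∞ ∧ V = void A}
    have hvoid : ∀ B : Set X, MeasurableSet B → MeasurableSet[M] (void B) := by
      intro B hB
      -- The void event of a set of infinite measure is a countable intersection of void events of
      -- sets of finite measure.
      have : B = ⋃ n, B ∩ spanningSets m n := by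
        rw [← inter_iUnion, iUnion_spanningSets, inter_univ]
      rw [this, void_iUnion]
      refine MeasurableSet.iInter fun n => MeasurableSpace.measurableSet_generateFrom
        ⟨_, hB.inter (measurableSet_spanningSets m n), ?_, rfl⟩
      exact (measure_mono inter_subset_right).trans_lt (measure_spanningSets_lt_top m n)
    have hhits : ∀ n, Measurable[M] (hits A n) := by
      intro n
      have : hits A n = fun x => ∑ e : Fin n → Bool, (void (A ∩ cell n e))ᶜ.indicator 1 x :=
        funext fun x => hits_eq_sum A n x
      rw [this]
      exact Finset.measurable_sum _ fun e _ => measurable_one.indicator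
        (hvoid _ (hA.inter (measurableSet_cell n e))).compl
    have hge : ∀ k : ℕ, MeasurableSet[M] {x : Configuration X | (k : ℕ∞) ≤ x.count A} := by
      intro k
      simp only [le_count_iff]
      have : {x : Configuration X | ∃ n, k ≤ hits A n x} = ⋃ n, (hits A n) ⁻¹' {l | k ≤ l} := by
        ext x; simp
      rw [this]
      exact MeasurableSet.iUnion fun n => hhits n (MeasurableSet.of_discrete)
    have hsing : ∀ k : ℕ∞, MeasurableSet[M] {x : Configuration X | x.count A = k} := by
      intro k
      induction k using ENat.recTopCoe with
      | top =>
        have : {x : Configuration X | x.count A = ⊤} =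
            ⋂ k : ℕ, {x : Configuration X | (k : ℕ∞) ≤ x.count A} := by
          ext x
          simp only [mem_ofPred_eq, mem_iInter, ENat.eq_top_iff_forall_ge]
        rw [this]
        exact MeasurableSet.iInter hge
      | coe k =>
        have : {x : Configuration X | x.count A = k} =
            {x : Configuration X | (k : ℕ∞) ≤ x.count A} \
              {x : Configuration X | ((k + 1 : ℕ) : ℕ∞) ≤ x.count A} := by
          ext x
          simp only [mem_ofPred_eq, Set.mem_sdiff, not_le]
          constructor
          · intro h; rw [h]; exact ⟨le_rfl, by exact_mod_cast Nat.lt_succ_self k⟩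
          · rintro ⟨h1, h2⟩
            refine le_antisymm ?_ h1
            rw [Nat.cast_add, Nat.cast_one] at h2
            exact Order.le_of_lt_add_one h2
        rw [this]
        exact (hge k).diff (hge (k + 1))
    rintro _ ⟨s, -, rfl⟩
    have : Configuration.count A ⁻¹' s = ⋃ k ∈ s, {x : Configuration X | x.count A = k} := by
      ext x; simp
    rw [this]
    exact MeasurableSet.biUnion (to_countable s) fun k _ => hsing k
  · rintro _ ⟨A, hA, -, rfl⟩
    exact measurableSet_void hA

end Cells

/-! ### The identity theorem for power series with summable coefficients. -/

section PowerSeries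

/-- A power series with summable coefficients whose zeros accumulate inside the unit disc
vanishes. -/
theorem coeff_eq_zero_of_frequently {a : ℕ → ℂ} (ha : Summable fun k => ‖a k‖) {z₀ : ℂ}
    (hz₀ : ‖z₀‖ < 1) (h : ∃ᶠ z in 𝓝[≠] z₀, ∑' k, a k * z ^ k = 0) (k : ℕ) : a k = 0 := by
  set p := FormalMultilinearSeries.ofScalars ℂ a with hp
  have hrad : (1 : ℝ≥0∞) ≤ p.radius := by
    have := p.le_radius_of_summable_norm (r := 1) (by
      refine Summable.of_nonneg_of_le (fun n => by positivity) (fun n => ?_) ha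
      rw [NNReal.coe_one, one_pow, mul_one, hp, FormalMultilinearSeries.ofScalars_norm])
    simpa using this
  have hps := p.hasFPowerSeriesOnBall (lt_of_lt_of_le one_pos hrad)
  have hsum : ∀ z, p.sum z = ∑' k, a k * z ^ k := by
    intro z
    rw [hp]
    change FormalMultilinearSeries.ofScalarsSum a z = _
    rw [FormalMultilinearSeries.ofScalars_sum_eq]
    simp
  have han : AnalyticOnNhd ℂ p.sum (Metric.ball 0 1) := by
    intro z hz
    refine hps.analyticOnNhd z ?_
    rw [Metric.mem_eball]
    refine lt_of_lt_of_le ?_ hrad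
    rw [edist_dist]
    have := Metric.mem_ball.1 hz
    rw [ENNReal.ofReal_lt_one]; exact this
  have hzero : EqOn p.sum 0 (Metric.ball 0 1) :=
    han.eqOn_zero_of_preconnected_of_frequently_eq_zero
      (convex_ball (0 : ℂ) 1).isPreconnected (z₀ := z₀) (by simpa using hz₀)
      (h.mono fun z hz => by rw [hsum]; exact hz)
  have hp0 : HasFPowerSeriesAt (0 : ℂ → ℂ) p 0 := by
    refine hps.hasFPowerSeriesAt.congr ?_
    filter_upwards [Metric.ball_mem_nhds (0 : ℂ) one_pos] with z hz using hzero hz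
  have := hp0.eq_zero
  have h2 := FormalMultilinearSeries.coeff_ofScalars (𝕜 := ℂ) (p := a) (n := k)
  rw [← h2, ← hp, this]
  rfl

end PowerSeries

/-! ### Generating functions of counts from void probabilities. -/

section GeneratingFunction

/-- `z ^ k` for `k ∈ ℕ∞` and `0 ≤ z < 1`. -/
def gen (z : ℝ) (k : ℕ∞) : ℝ := if k = ⊤ then 0 else z ^ k.toNat

theorem gen_coe (z : ℝ) (k : ℕ) : gen z k = z ^ k := by simp [gen]

theorem gen_top (z : ℝ) : gen z ⊤ = 0 := by simp [gen]

theorem gen_nonneg {z : ℝ} (hz : 0 ≤ z) (k : ℕ∞) : 0 ≤ gen z k := by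
  unfold gen; split_ifs <;> positivity

theorem gen_le_one {z : ℝ} (hz : 0 ≤ z) (hz1 : z ≤ 1) (k : ℕ∞) : gen z k ≤ 1 := by
  unfold gen; split_ifs
  · exact zero_le_one
  · exact pow_le_one₀ hz hz1

theorem norm_gen_le_one {z : ℝ} (hz : 0 ≤ z) (hz1 : z ≤ 1) (k : ℕ∞) : ‖gen z k‖ ≤ 1 := by
  rw [Real.norm_of_nonneg (gen_nonneg hz k)]; exact gen_le_one hz hz1 k

theorem measurable_gen_count {X : Type*} [MeasurableSpace X] {A : Set X} (hA : MeasurableSet A)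
    (z : ℝ) : Measurable fun x : Configuration X => gen z (x.count A) :=
  (measurable_from_top (f := gen z)).comp (Configuration.measurable_count hA)

theorem gen_zero_count {X : Type*} (A : Set X) (x : Configuration X) :
    gen 0 (x.count A) = (void A).indicator 1 x := by
  by_cases h : x ∈ void A
  · have : x.count A = ((0 : ℕ) : ℕ∞) := h
    rw [indicator_of_mem h, this, gen_coe, pow_zero, Pi.one_apply]
  · have h0 : x.count A ≠ 0 := h
    rw [indicator_of_notMem h, gen]
    split_ifs with h1
    · rfl
    · exact zero_pow fun h2 => h0 ((ENat.toNat_eq_zero.1 h2).resolve_right h1)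

/-- `P` has the void probabilities of the Poisson measure over `m`. -/
def HasVoidProbabilities {X : Type*} [MeasurableSpace X] (m : Measure X)
    (P : Measure (Configuration X)) : Prop :=
  IsProbabilityMeasure P ∧
    ∀ A : Set X, MeasurableSet A → m A < ∞ → P.real (void A) = Real.exp (-m.real A)

variable {X : Type*} [MeasurableSpace X] {m : Measure X} {P : Measure (Configuration X)}

/-- Expanding the product leaves void events of unions of the `B i`, and their probabilities factor
because `m` is additive on disjoint sets. -/
theorem integral_prod_void (hP : HasVoidProbabilities m P) {κ : Type*} [DecidableEq κ]
    (s : Finset κ) (B : κ → Set X) (z : κ → ℝ) (hB : ∀ i, MeasurableSet (B i))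
    (hBm : ∀ i, m (B i) < ∞) (hd : Pairwise (Function.onFun Disjoint B)) :
    ∫ x, ∏ i ∈ s, (z i + (1 - z i) * (void (B i)).indicator (1 : Configuration X → ℝ) x) ∂P =
      ∏ i ∈ s, (z i + (1 - z i) * Real.exp (-m.real (B i))) := by
  have := hP.1
  have hind : ∀ (t : Finset κ) (x : Configuration X),
      ∏ i ∈ t, (void (B i)).indicator (1 : Configuration X → ℝ) x =
        (void (⋃ i ∈ t, B i)).indicator (1 : Configuration X → ℝ) x := by
    intro t x
    rw [void_iUnion]
    simp only [void_iUnion]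
    induction t using Finset.induction_on with
    | empty => simp
    | insert i t hi ih =>
      rw [Finset.prod_insert hi, ih, Finset.set_biInter_insert, inter_indicator_one]
      rfl
  have hm : ∀ t : Finset κ, MeasurableSet (⋃ i ∈ t, B i) := fun t =>
    Finset.measurableSet_biUnion t fun i _ => hB i
  have hmu : ∀ t : Finset κ, P.real (void (⋃ i ∈ t, B i)) = ∏ i ∈ t, Real.exp (-m.real (B i)) := by
    intro t
    rw [hP.2 _ (hm t) (measure_biUnion_lt_top t.finite_toSet fun i _ => hBm i),
      measureReal_biUnion_finset (fun i _ j _ hij => hd hij) (fun i _ => hB i)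
        (fun i _ => (hBm i).ne), ← Finset.sum_neg_distrib, Real.exp_sum]
  simp only [Finset.prod_add, Finset.prod_mul_distrib, hind]
  rw [integral_finsetSum]
  · refine Finset.sum_congr rfl fun t _ => ?_
    rw [integral_const_mul, integral_const_mul, integral_indicator_one
      (measurableSet_void (hm _)), hmu]
  · intro t _
    refine Integrable.const_mul (Integrable.const_mul ?_ _) _
    exact (integrable_const (1 : ℝ)).indicator (measurableSet_void (hm _))

variable [MeasurableSpace.CountablyGenerated X]

theorem pow_hits (A : Set X) (n : ℕ) (x : Configuration X) (z : ℝ) :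
    z ^ hits A n x = ∏ e : Fin n → Bool,
      (z + (1 - z) * (void (A ∩ cell n e)).indicator (1 : Configuration X → ℝ) x) := by
  rw [hits_eq_sum, ← Finset.prod_pow_eq_pow_sum]
  refine Finset.prod_congr rfl fun e _ => ?_
  by_cases h : x ∈ void (A ∩ cell n e)
  · simp [h]
  · simp [h]

variable [MeasurableSpace.SeparatesPoints X]

/-- The condition `z < 1` takes care of infinite counts: there the powers tend to `gen z ⊤ = 0`. -/
theorem tendsto_pow_hits (A : Set X) (x : Configuration X) {z : ℝ} (hz : 0 ≤ z) (hz1 : z < 1) :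
    Tendsto (fun n => z ^ hits A n x) atTop (𝓝 (gen z (x.count A))) := by
  by_cases h : x.count A = ⊤
  · rw [h, gen_top]
    refine (tendsto_pow_atTop_nhds_zero_of_lt_one hz hz1).comp (tendsto_atTop.2 fun k => ?_)
    exact eventually_le_hits (h ▸ le_top)
  · obtain ⟨k, hk⟩ := ENat.ne_top_iff_exists.1 h
    rw [← hk, gen_coe]
    refine tendsto_const_nhds.congr' ?_
    filter_upwards [eventually_hits_eq hk.symm] with n hn
    rw [hn]

variable [SigmaFinite m] [NullSingletonClass m]

/-- The sum is the product measure of the pairs of points of `A` with equal codes. These sets of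
pairs decrease to the diagonal, which is null since points are null. -/
theorem tendsto_sum_sq_cell {A : Set X} (hA : m A < ∞) :
    Tendsto (fun n => ∑ e : Fin n → Bool, m.real (A ∩ cell n e) ^ 2) atTop (𝓝 0) := by
  have : Fact (m A < ∞) := ⟨hA⟩
  set ν := m.restrict A with hν
  let D : ℕ → Set (X × X) := fun n => {p | cellCode n p.1 = cellCode n p.2}
  have hDm : ∀ n, MeasurableSet (D n) := fun n =>
    measurableSet_eq_fun ((measurable_cellCode n).comp measurable_fst)
      ((measurable_cellCode n).comp measurable_snd)
  have hD : ∀ n, (ν.prod ν).real (D n) = ∑ e : Fin n → Bool, m.real (A ∩ cell n e) ^ 2 := by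
    intro n
    have h1 : D n = ⋃ e ∈ (Finset.univ : Finset (Fin n → Bool)), cell n e ×ˢ cell n e := by
      ext ⟨a, b⟩
      simp only [D, cell, mem_ofPred_eq, Finset.mem_univ, iUnion_true, mem_iUnion, mem_prod,
        mem_preimage, mem_singleton_iff]
      exact ⟨fun h => ⟨_, rfl, h.symm⟩, fun ⟨e, h1, h2⟩ => h1.trans h2.symm⟩
    rw [h1, measureReal_biUnion_finset]
    · refine Finset.sum_congr rfl fun e _ => ?_
      rw [measureReal_def, Measure.prod_prod, ENNReal.toReal_mul, ← measureReal_def, hν,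
        measureReal_restrict_apply (measurableSet_cell n e), inter_comm, sq]
    · intro e _ e' _ hee
      exact disjoint_prod.2 (Or.inl (disjoint_cell hee))
    · exact fun e _ => (measurableSet_cell n e).prod (measurableSet_cell n e)
  have hanti : Antitone D := by
    intro k l hkl p hp
    funext i
    exact congrFun hp ⟨i, i.2.trans_le hkl⟩
  have hlim := tendsto_measure_iInter_atTop (μ := ν.prod ν) (fun n => (hDm n).nullMeasurableSet)
    hanti ⟨0, measure_ne_top _ _⟩
  have hzero : (ν.prod ν) (⋂ n, D n) = 0 := by
    rw [Measure.measure_prod_null (MeasurableSet.iInter hDm)]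
    refine Eventually.of_forall fun a => ?_
    refine measure_mono_null (t := {a}) (fun b hb => ?_) (measure_singleton a)
    by_contra hne
    obtain ⟨n, hn⟩ := (eventually_cellCode_ne (Ne.symm hne)).exists
    exact hn (mem_iInter.1 hb n)
  rw [hzero] at hlim
  have := (ENNReal.tendsto_toReal (by simp)).comp hlim
  refine this.congr fun n => ?_
  rw [← hD n]; rfl

/-- With `u` the measure of a cell, each factor lies between `exp ((z - 1) u)`, by convexity, and
`exp ((z - 1) u + u ^ 2)`; the squares sum to a quantity that tends to zero. -/
theorem tendsto_prod_cell {A : Set X} (hA : MeasurableSet A) (hAm : m A < ∞) {z : ℝ} (hz : 0 ≤ z)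
    (hz1 : z ≤ 1) : Tendsto (fun n => ∏ e : Fin n → Bool,
      (z + (1 - z) * Real.exp (-m.real (A ∩ cell n e)))) atTop
      (𝓝 (Real.exp ((z - 1) * m.real A))) := by
  have hsum : ∀ n, ∑ e : Fin n → Bool, m.real (A ∩ cell n e) = m.real A := by
    intro n
    conv_rhs => rw [← iUnion_inter_cell A n]
    have h1 : (⋃ e, A ∩ cell n e) =
      ⋃ e ∈ (Finset.univ : Finset (Fin n → Bool)), A ∩ cell n e := by simp
    rw [h1, measureReal_biUnion_finset]
    · intro e _ e' _ hee
      exact (disjoint_cell hee).mono inter_subset_right inter_subset_right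
    · exact fun e _ => hA.inter (measurableSet_cell n e)
  have hlow : ∀ u : ℝ, Real.exp ((z - 1) * u) ≤ z + (1 - z) * Real.exp (-u) := by
    intro u
    have := convexOn_exp.2 (mem_univ (0 : ℝ)) (mem_univ (-u)) hz (sub_nonneg.2 hz1) (by ring)
    simp only [smul_eq_mul, mul_zero, zero_add, Real.exp_zero, mul_one] at this
    have e : (z - 1) * u = (1 - z) * -u := by ring
    rw [e]; exact this
  have hup : ∀ u : ℝ, 0 ≤ u → z + (1 - z) * Real.exp (-u) ≤ Real.exp ((z - 1) * u + u ^ 2) := by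
    intro u hu
    have h1 : Real.exp (-u) ≤ 1 - u + u ^ 2 := by
      have h2 : 1 + u ≤ Real.exp u := by linarith [Real.add_one_le_exp u]
      have h3 : Real.exp (-u) ≤ (1 + u)⁻¹ := by
        rw [Real.exp_neg]; exact inv_anti₀ (by linarith) h2
      refine h3.trans ?_
      rw [inv_le_iff_one_le_mul₀ (by linarith)]
      nlinarith [mul_nonneg (mul_nonneg hu hu) hu]
    calc z + (1 - z) * Real.exp (-u) ≤ z + (1 - z) * (1 - u + u ^ 2) := by
          gcongr
      _ ≤ ((z - 1) * u + u ^ 2) + 1 := by nlinarith [mul_nonneg hz (sq_nonneg u)]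
      _ ≤ _ := Real.add_one_le_exp _
  refine tendsto_of_tendsto_of_tendsto_of_le_of_le (g := fun _ => Real.exp ((z - 1) * m.real A))
    (h := fun n => Real.exp ((z - 1) * m.real A + ∑ e : Fin n → Bool, m.real (A ∩ cell n e) ^ 2))
    tendsto_const_nhds ?_ ?_ ?_
  · have := (tendsto_sum_sq_cell (m := m) hAm).const_add ((z - 1) * m.real A)
    rw [add_zero] at this
    exact (Real.continuous_exp.tendsto _).comp this
  · intro n
    dsimp only
    rw [← hsum n, Finset.mul_sum, Real.exp_sum]
    exact Finset.prod_le_prod (fun e _ => (Real.exp_pos _).le) fun e _ => hlow _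
  · intro n
    dsimp only
    rw [← hsum n, Finset.mul_sum, ← Finset.sum_add_distrib, Real.exp_sum]
    exact Finset.prod_le_prod (fun e _ => (Real.exp_pos _).le.trans (hlow _))
      fun e _ => hup _ measureReal_nonneg

/-- The joint generating function of the counts of disjoint sets. -/
theorem integral_prod_gen (hP : HasVoidProbabilities m P) {ι : Type*} [Fintype ι]
    (A : ι → Set X) (z : ι → ℝ) (hA : ∀ i, MeasurableSet (A i)) (hAm : ∀ i, m (A i) < ∞)
    (hd : Pairwise (Function.onFun Disjoint A)) (hz : ∀ i, 0 ≤ z i) (hz1 : ∀ i, z i < 1) :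
    ∫ x, ∏ i, gen (z i) (x.count (A i)) ∂P = ∏ i, Real.exp ((z i - 1) * m.real (A i)) := by
  classical
  have := hP.1
  have h1 : ∀ n, ∫ x, ∏ i, z i ^ hits (A i) n x ∂P =
      ∏ i, ∏ e : Fin n → Bool, (z i + (1 - z i) * Real.exp (-m.real (A i ∩ cell n e))) := by
    intro n
    have := integral_prod_void hP (Finset.univ : Finset (ι × (Fin n → Bool)))
      (fun p => A p.1 ∩ cell n p.2) (fun p => z p.1)
      (fun p => (hA p.1).inter (measurableSet_cell n p.2))
      (fun p => (measure_mono inter_subset_left).trans_lt (hAm p.1)) (by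
        rintro ⟨i, e⟩ ⟨i', e'⟩ hne
        by_cases hii : i = i'
        · have hee : e ≠ e' := fun h => hne (by rw [hii, h])
          exact (disjoint_cell hee).mono inter_subset_right inter_subset_right
        · exact (hd hii).mono inter_subset_left inter_subset_left)
    rw [Fintype.prod_prod_type] at this
    rw [← this]
    refine integral_congr_ae (Eventually.of_forall fun x => ?_)
    simp only [pow_hits, Fintype.prod_prod_type]
  have hmeas : ∀ n, AEStronglyMeasurable (fun x => ∏ i, z i ^ hits (A i) n x) P := by
    intro n
    refine Measurable.aestronglyMeasurable (Finset.measurable_prod _ fun i _ => ?_)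
    have : (fun x => z i ^ hits (A i) n x) = fun x => ∏ e : Fin n → Bool,
      (z i + (1 - z i) * (void (A i ∩ cell n e)).indicator (1 : Configuration X → ℝ) x) :=
      funext fun x => pow_hits _ _ _ _
    rw [this]
    exact Finset.measurable_prod _ fun e _ => ((measurable_one.indicator
      (measurableSet_void ((hA i).inter (measurableSet_cell n e)))).const_mul _).const_add _
  have h2 : Tendsto (fun n => ∫ x, ∏ i, z i ^ hits (A i) n x ∂P) atTop
      (𝓝 (∫ x, ∏ i, gen (z i) (x.count (A i)) ∂P)) := by
    refine tendsto_integral_of_dominated_convergence (fun _ => 1) hmeas (integrable_const _)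
      (fun n => Eventually.of_forall fun x => ?_) (Eventually.of_forall fun x => ?_)
    · rw [Real.norm_of_nonneg (Finset.prod_nonneg fun i _ => pow_nonneg (hz i) _)]
      exact Finset.prod_le_one (fun i _ => pow_nonneg (hz i) _)
        fun i _ => pow_le_one₀ (hz i) (hz1 i).le
    · exact tendsto_finsetProd _ fun i _ => tendsto_pow_hits (A i) x (hz i) (hz1 i)
  refine tendsto_nhds_unique h2 ?_
  simp only [h1]
  exact tendsto_finsetProd _ fun i _ => tendsto_prod_cell (hA i) (hAm i) (hz i) (hz1 i).le

end GeneratingFunction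

/-! ### Recovering the Poisson law from generating functions. -/

section Extraction

theorem frequently_ofReal {p : ℂ → Prop} {x₀ : ℝ} (h : ∃ᶠ x : ℝ in 𝓝[≠] x₀, p x) :
    ∃ᶠ z in 𝓝[≠] (x₀ : ℂ), p z := by
  have ht : Tendsto (fun x : ℝ => (x : ℂ)) (𝓝[≠] x₀) (𝓝[≠] (x₀ : ℂ)) :=
    tendsto_nhdsWithin_of_tendsto_nhds_of_eventually_within _
      (Complex.continuous_ofReal.continuousAt.tendsto.mono_left nhdsWithin_le_nhds)
      (eventually_nhdsWithin_of_forall fun x hx => by simpa using hx)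
  exact ht.frequently h

variable {X : Type*} [MeasurableSpace X] {P : Measure (Configuration X)}

theorem pairwise_disjoint_cylinder (A : Set X) :
    Pairwise (Function.onFun Disjoint fun k : ℕ => cylinder A k) := by
  intro k l hkl
  rw [Function.onFun, disjoint_left]
  intro x hx hx'
  have h1 : x.count A = (k : ℕ∞) := hx
  have h2 : x.count A = (l : ℕ∞) := hx'
  rw [h1] at h2
  exact hkl (by exact_mod_cast h2)

theorem summable_norm_integral_cylinder {g : Configuration X → ℂ} (hg : Integrable g P)
    {A : Set X} (hA : MeasurableSet A) :
    Summable fun k : ℕ => ‖∫ x in cylinder A k, g x ∂P‖ := by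
  have h := (hasSum_integral_iUnion (f := fun x => ‖g x‖) (fun k => measurableSet_cylinder hA k)
    (pairwise_disjoint_cylinder A) hg.norm.integrableOn).summable
  exact Summable.of_nonneg_of_le (fun k => norm_nonneg _)
    (fun k => norm_integral_le_integral_norm _) h

theorem integral_gen_eq_tsum {g : Configuration X → ℂ} (hg : Integrable g P)
    {A : Set X} (hA : MeasurableSet A) {z : ℝ} (hz : 0 ≤ z) (hz1 : z ≤ 1) :
    ∫ x, g x * (gen z (x.count A) : ℂ) ∂P = ∑' k : ℕ, (∫ x in cylinder A k, g x ∂P) * (z : ℂ) ^ k := by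
  have hint : Integrable (fun x => g x * (gen z (x.count A) : ℂ)) P := by
    refine Integrable.mul_bdd (c := 1) hg
      (Complex.measurable_ofReal.comp (measurable_gen_count hA z)).aestronglyMeasurable
      (Eventually.of_forall fun x => ?_)
    change ‖((gen z (x.count A) : ℝ) : ℂ)‖ ≤ 1
    rw [Complex.norm_real]; exact norm_gen_le_one hz hz1 _
  have h1 : ∫ x, g x * (gen z (x.count A) : ℂ) ∂P =
      ∫ x in ⋃ k : ℕ, cylinder A k, g x * (gen z (x.count A) : ℂ) ∂P := by
    refine (setIntegral_eq_integral_of_forall_compl_eq_zero fun x hx => ?_).symm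
    have : x.count A = ⊤ := by
      by_contra h
      obtain ⟨k, hk⟩ := ENat.ne_top_iff_exists.1 h
      exact hx (mem_iUnion.2 ⟨k, hk.symm⟩)
    rw [this, gen_top, Complex.ofReal_zero, mul_zero]
  rw [h1, integral_iUnion (fun k => measurableSet_cylinder hA k) (pairwise_disjoint_cylinder A)
    hint.integrableOn]
  refine tsum_congr fun k => ?_
  rw [← integral_mul_const]
  refine setIntegral_congr_fun (measurableSet_cylinder hA k) fun x hx => ?_
  have h : x.count A = (k : ℕ∞) := hx
  simp only [h, gen_coe, Complex.ofReal_pow]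

/-- A weight whose generating function is Poissonian has Poissonian integrals over the
cylinders. -/
theorem integral_cylinder_of_gen {g : Configuration X → ℂ} (hg : Integrable g P)
    {A : Set X} (hA : MeasurableSet A) {c : ℂ} {u : ℝ}
    (h : ∀ z : ℝ, 0 ≤ z → z < 1 → ∫ x, g x * (gen z (x.count A) : ℂ) ∂P =
      c * Real.exp ((z - 1) * u)) (k : ℕ) :
    ∫ x in cylinder A k, g x ∂P = c * ((u ^ k / (Nat.factorial k : ℝ) * Real.exp (-u) : ℝ) : ℂ) := by
  set b : ℕ → ℂ := fun k => c * ((u ^ k / (Nat.factorial k : ℝ) * Real.exp (-u) : ℝ) : ℂ) with hb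
  have hs0 : ∀ z : ℝ, HasSum (fun k : ℕ => (u ^ k / (Nat.factorial k : ℝ) * Real.exp (-u)) * z ^ k)
      (Real.exp ((z - 1) * u)) := by
    intro z
    have h1 := (NormedSpace.expSeries_div_hasSum_exp (u * z)).mul_right (Real.exp (-u))
    rw [← Real.exp_eq_exp_ℝ, ← Real.exp_add] at h1
    convert! h1 using 1
    · funext k; rw [mul_pow]; ring
    · congr 1; ring
  have hsb : Summable fun k => ‖b k‖ := by
    have h1 : Summable fun k : ℕ => |u| ^ k / (Nat.factorial k : ℝ) :=
      Real.summable_pow_div_factorial |u|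
    refine (h1.mul_left (‖c‖ * Real.exp (-u))).congr fun k => ?_
    rw [hb]
    simp only [norm_mul, Complex.norm_real, norm_div, norm_pow, Real.norm_eq_abs, Nat.abs_cast,
      Real.abs_exp]
    ring
  have hsa := summable_norm_integral_cylinder (P := P) hg hA
  have hsum : Summable fun k => ‖(∫ x in cylinder A k, g x ∂P) - b k‖ :=
    Summable.of_nonneg_of_le (fun _ => norm_nonneg _) (fun _ => norm_sub_le _ _) (hsa.add hsb)
  have hzero : ∀ z : ℝ, 0 ≤ z → z < 1 →
      ∑' k, ((∫ x in cylinder A k, g x ∂P) - b k) * (z : ℂ) ^ k = 0 := by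
    intro z hz hz1
    have hle : ∀ (a : ℕ → ℂ), Summable (fun k => ‖a k‖) → Summable fun k => a k * (z : ℂ) ^ k := by
      intro a ha
      refine Summable.of_norm_bounded ha fun k => ?_
      rw [norm_mul, norm_pow, Complex.norm_real, Real.norm_of_nonneg hz]
      exact mul_le_of_le_one_right (norm_nonneg _) (pow_le_one₀ hz hz1.le)
    simp only [sub_mul]
    rw [(hle _ hsa).tsum_sub (hle _ hsb), ← integral_gen_eq_tsum hg hA hz hz1.le, h z hz hz1,
      sub_eq_zero]
    have h2 := (Complex.hasSum_ofReal.2 (hs0 z)).mul_left c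
    rw [← h2.tsum_eq]
    refine tsum_congr fun k => ?_
    rw [hb]; push_cast; ring
  -- The two power series agree on `[0, 1)`, so the zeros of the difference accumulate at `1 / 2`.
  have hfin := coeff_eq_zero_of_frequently hsum (z₀ := ((1 / 2 : ℝ) : ℂ)) (by norm_num)
    (frequently_ofReal (p := fun z => ∑' k, ((∫ x in cylinder A k, g x ∂P) - b k) * z ^ k = 0)
      (Eventually.frequently (by
        have : Ioo (0 : ℝ) 1 ∈ 𝓝 (1 / 2 : ℝ) := Ioo_mem_nhds (by norm_num) (by norm_num)
        filter_upwards [nhdsWithin_le_nhds this] with z hz using hzero z hz.1.le hz.2))) k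
  exact sub_eq_zero.1 hfin

variable {m : Measure X} [MeasurableSpace.CountablyGenerated X] [MeasurableSpace.SeparatesPoints X]
  [SigmaFinite m] [NullSingletonClass m]

/-- A random configuration with Poisson void probabilities is Poisson. -/
theorem HasVoidProbabilities.isPoissonMeasure (hP : HasVoidProbabilities m P) :
    IsPoissonMeasure m P := by
  have := hP.1
  refine ⟨hP.1, fun N A k hA hAm hd => ?_⟩
  -- Indices in `s` carry the indicator of a cylinder, the others still a generating function. The
  -- induction converts one index at a time, the product of the other factors serving as a weight.
  set F : Finset (Fin N) → (Fin N → ℝ) → Fin N → Configuration X → ℝ := fun s z i x =>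
    if i ∈ s then (cylinder (A i) (k i)).indicator 1 x else gen (z i) (x.count (A i)) with hF
  set c : Finset (Fin N) → (Fin N → ℝ) → Fin N → ℝ := fun s z i =>
    if i ∈ s then m.real (A i) ^ k i / (Nat.factorial (k i) : ℝ) * Real.exp (-m.real (A i))
    else Real.exp ((z i - 1) * m.real (A i)) with hc
  have hFm : ∀ s z i, Measurable (F s z i) := by
    intro s z i
    rw [hF]; dsimp only
    split_ifs
    · exact measurable_one.indicator (measurableSet_cylinder (hA i) (k i))
    · exact measurable_gen_count (hA i) (z i)
  have hF0 : ∀ s z i x, 0 ≤ z i → 0 ≤ F s z i x := by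
    intro s z i x hz
    rw [hF]; dsimp only
    split_ifs
    · exact indicator_nonneg (fun _ _ => zero_le_one) x
    · exact gen_nonneg hz _
  have hF1 : ∀ s z i x, 0 ≤ z i → z i ≤ 1 → F s z i x ≤ 1 := by
    intro s z i x hz hz1
    rw [hF]; dsimp only
    split_ifs
    · exact indicator_le' (fun _ _ => le_rfl) (fun _ _ => zero_le_one) x
    · exact gen_le_one hz hz1 _
  have key : ∀ s : Finset (Fin N), ∀ z : Fin N → ℝ, (∀ i, 0 ≤ z i) → (∀ i, z i < 1) →
      ∫ x, ∏ i, F s z i x ∂P = ∏ i, c s z i := by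
    intro s
    induction s using Finset.induction_on with
    | empty =>
      intro z hz hz1
      simpa [hF, hc] using integral_prod_gen hP A z hA hAm hd hz hz1
    | insert j s hj ih =>
      intro z hz hz1
      set g : Configuration X → ℝ := fun x => ∏ i ∈ Finset.univ.erase j, F s z i x with hg
      have hgi : Integrable (fun x => (g x : ℂ)) P := by
        refine Integrable.of_bound (C := 1)
          (Complex.measurable_ofReal.comp (Finset.measurable_prod _ fun i _ =>
            hFm s z i)).aestronglyMeasurable (Eventually.of_forall fun x => ?_)
        change ‖((∏ i ∈ Finset.univ.erase j, F s z i x : ℝ) : ℂ)‖ ≤ 1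
        rw [Complex.norm_real, Real.norm_of_nonneg (Finset.prod_nonneg fun i _ =>
          hF0 s z i x (hz i))]
        exact Finset.prod_le_one (fun i _ => hF0 s z i x (hz i))
          fun i _ => hF1 s z i x (hz i) (hz1 i).le
      have hz' : ∀ w : ℝ, 0 ≤ w → w < 1 → ∫ x, (g x : ℂ) * (gen w (x.count (A j)) : ℂ) ∂P =
          ((∏ i ∈ Finset.univ.erase j, c s z i : ℝ) : ℂ) *
            Real.exp ((w - 1) * m.real (A j)) := by
        intro w hw hw1
        have h1 := ih (Function.update z j w)
          (fun i => by by_cases h : i = j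
                       · subst h; simpa using hw
                       · simpa [h] using hz i)
          (fun i => by by_cases h : i = j
                       · subst h; simpa using hw1
                       · simpa [h] using hz1 i)
        have h2 : ∏ i, c s (Function.update z j w) i =
            Real.exp ((w - 1) * m.real (A j)) * ∏ i ∈ Finset.univ.erase j, c s z i := by
          rw [← Finset.mul_prod_erase Finset.univ _ (Finset.mem_univ j)]
          congr 1
          · simp [hc, hj]
          · refine Finset.prod_congr rfl fun i hi => ?_
            simp [hc, Finset.ne_of_mem_erase hi]
        have h3 : ∀ x, ∏ i, F s (Function.update z j w) i x = g x * gen w (x.count (A j)) := by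
          intro x
          rw [← Finset.mul_prod_erase Finset.univ _ (Finset.mem_univ j), mul_comm]
          congr 1
          · refine Finset.prod_congr rfl fun i hi => ?_
            simp [hF, Finset.ne_of_mem_erase hi]
          · simp [hF, hj]
        simp only [h3, h2] at h1
        have h4 := congrArg (fun r : ℝ => (r : ℂ)) h1
        simp only [← integral_complex_ofReal, Complex.ofReal_mul] at h4
        rw [h4, mul_comm]
      have h5 := integral_cylinder_of_gen hgi (hA j) hz' (k j)
      rw [← Complex.ofReal_mul, integral_complex_ofReal, Complex.ofReal_inj,
        ← integral_indicator (measurableSet_cylinder (hA j) (k j))] at h5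
      rw [← Finset.mul_prod_erase Finset.univ _ (Finset.mem_univ j)]
      have h6 : ∏ i ∈ Finset.univ.erase j, c (insert j s) z i =
          ∏ i ∈ Finset.univ.erase j, c s z i := Finset.prod_congr rfl fun i hi => by
        simp [hc, Finset.ne_of_mem_erase hi]
      have h7 : c (insert j s) z j = m.real (A j) ^ k j / (Nat.factorial (k j) : ℝ) *
          Real.exp (-m.real (A j)) := by simp [hc]
      rw [h6, h7, mul_comm, ← h5]
      refine integral_congr_ae (Eventually.of_forall fun x => ?_)
      dsimp only
      rw [← Finset.mul_prod_erase Finset.univ _ (Finset.mem_univ j)]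
      have h8 : ∏ i ∈ Finset.univ.erase j, F (insert j s) z i x = g x :=
        Finset.prod_congr rfl fun i hi => by simp [hF, Finset.ne_of_mem_erase hi]
      rw [h8]
      by_cases hx : x ∈ cylinder (A j) (k j)
      · simp [hF, hx]
      · simp [hF, hx]
  -- Once all indices are converted, the values of `z` are immaterial.
  have hfin := key Finset.univ 0 (fun _ => le_rfl) (fun _ => zero_lt_one)
  have hmeas : MeasurableSet (⋂ i, cylinder (A i) (k i)) :=
    MeasurableSet.iInter fun i => measurableSet_cylinder (hA i) (k i)
  have h1 : ∀ x, ∏ i, F Finset.univ 0 i x = (⋂ i, cylinder (A i) (k i)).indicator 1 x := by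
    intro x
    by_cases hx : x ∈ ⋂ i, cylinder (A i) (k i)
    · rw [indicator_of_mem hx]
      refine Finset.prod_eq_one fun i _ => ?_
      simp [hF, mem_iInter.1 hx i]
    · rw [indicator_of_notMem hx]
      obtain ⟨i, hi⟩ := not_forall.1 (fun h => hx (mem_iInter.2 h))
      refine Finset.prod_eq_zero (Finset.mem_univ i) ?_
      simp [hF, hi]
  simp only [h1, integral_indicator_one hmeas] at hfin
  rw [← ofReal_measureReal, hfin]
  simp [hc]

end Extraction

/-! ### Poisson suspensions preserve the Poisson measure; totality of void indicators. -/

section Suspension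

variable {X : Type*} [MeasurableSpace X] {m : Measure X} {P : Measure (Configuration X)}

theorem preimage_poissonSuspension_void (T : X ≃ᵐ X) (A : Set X) :
    poissonSuspension T ⁻¹' void A = void (T ⁻¹' A) := by
  ext x
  change (x.map T).count A = _ ↔ x.count (T ⁻¹' A) = _
  rw [Configuration.count_map]

variable [MeasurableSpace.CountablyGenerated X] [MeasurableSpace.SeparatesPoints X] [SigmaFinite m]

theorem isPiSystem_void (m : Measure X) : IsPiSystem
    {V : Set (Configuration X) | ∃ A, MeasurableSet A ∧ m A < ∞ ∧ V = void A} := by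
  rintro _ ⟨A, hA, hAm, rfl⟩ _ ⟨B, hB, hBm, rfl⟩ -
  exact ⟨A ∪ B, hA.union hB, (measure_union_le A B).trans_lt (ENNReal.add_lt_top.2 ⟨hAm, hBm⟩),
    (void_union A B).symm⟩

theorem measurePreserving_poissonSuspension (hP : HasVoidProbabilities m P) {T : X ≃ᵐ X}
    (hT : MeasurePreserving T m m) : MeasurePreserving (poissonSuspension T) P P := by
  have := hP.1
  refine ⟨(poissonSuspension T).measurable, ?_⟩
  have : IsProbabilityMeasure (P.map (poissonSuspension T)) :=
    Measure.isProbabilityMeasure_map (poissonSuspension T).measurable.aemeasurable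
  refine ext_of_generate_finite _ (configuration_measurableSpace_eq m) (isPiSystem_void m) ?_
    (by simp)
  rintro _ ⟨A, hA, hAm, rfl⟩
  rw [Measure.map_apply (poissonSuspension T).measurable (measurableSet_void hA),
    preimage_poissonSuspension_void]
  have h1 : m (T ⁻¹' A) = m A := hT.measure_preimage hA.nullMeasurableSet
  rw [← ENNReal.toReal_eq_toReal_iff' (measure_ne_top _ _) (measure_ne_top _ _)]
  change P.real _ = P.real _
  rw [hP.2 _ (T.measurable hA) (h1 ▸ hAm), hP.2 _ hA hAm, measureReal_def, h1]
  rfl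

/-- The indicator function of a void event. -/
def voidLp (P : Measure (Configuration X)) [IsFiniteMeasure P] {A : Set X} (hA : MeasurableSet A) :
    Lp ℂ 2 P := indicatorConstLp 2 (measurableSet_void hA) (measure_ne_top P _) (1 : ℂ)

theorem inner_voidLp_left [IsFiniteMeasure P] {A : Set X} (hA : MeasurableSet A) (g : Lp ℂ 2 P) :
    inner ℂ (voidLp P hA) g = ∫ x in void A, g x ∂P :=
  L2.inner_indicatorConstLp_one _ _ g

theorem norm_voidLp_le_one [IsProbabilityMeasure P] {A : Set X} (hA : MeasurableSet A) :
    ‖voidLp P hA‖ ≤ 1 := by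
  rw [voidLp, norm_indicatorConstLp (by simp) (by simp), norm_one, one_mul]
  exact Real.rpow_le_one measureReal_nonneg measureReal_le_one (by positivity)

theorem inner_voidLp_voidLp (hP : HasVoidProbabilities m P) [IsFiniteMeasure P] {A B : Set X}
    (hA : MeasurableSet A) (hB : MeasurableSet B) (hAm : m A < ∞) (hBm : m B < ∞) :
    inner ℂ (voidLp P hA) (voidLp P hB) = (Real.exp (-m.real (A ∪ B)) : ℂ) := by
  rw [inner_voidLp_left, voidLp, setIntegral_indicatorConstLp (measurableSet_void hA),
    inter_comm, ← void_union, union_comm, Complex.real_smul, mul_one]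
  rw [union_comm, hP.2 _ (hA.union hB) ((measure_union_le A B).trans_lt
    (ENNReal.add_lt_top.2 ⟨hAm, hBm⟩))]

/-- The squared distance is the sum of `exp (-m A) - exp (-m (A ∪ B))` and its analogue for `B`, and
`exp (-a)` is `1`-Lipschitz for `a ≥ 0`. This turns approximation of sets by unions of floors into
approximation of vectors. -/
theorem norm_voidLp_sub_sq_le (hP : HasVoidProbabilities m P) [IsFiniteMeasure P] {A B : Set X}
    (hA : MeasurableSet A) (hB : MeasurableSet B) (hAm : m A < ∞) (hBm : m B < ∞) :
    ‖voidLp P hA - voidLp P hB‖ ^ 2 ≤ m.real (symmDiff A B) := by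
  have h1 : ((‖voidLp P hA - voidLp P hB‖ ^ 2 : ℝ) : ℂ) =
      ((Real.exp (-m.real A) - Real.exp (-m.real (A ∪ B)) +
        (Real.exp (-m.real B) - Real.exp (-m.real (A ∪ B))) : ℝ) : ℂ) := by
    have := inner_self_eq_norm_sq_to_K (𝕜 := ℂ) (voidLp P hA - voidLp P hB)
    rw [inner_sub_left, inner_sub_right, inner_sub_right, inner_voidLp_voidLp hP hA hA hAm hAm,
      inner_voidLp_voidLp hP hA hB hAm hBm, inner_voidLp_voidLp hP hB hA hBm hAm,
      inner_voidLp_voidLp hP hB hB hBm hBm, union_self, union_self, union_comm B A] at this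
    rw [Complex.ofReal_pow]
    refine this.symm.trans ?_
    push_cast; ring
  rw [Complex.ofReal_inj.1 h1]
  have hle : ∀ a u : ℝ, 0 ≤ a → Real.exp (-a) - Real.exp (-u) ≤ |u - a| := by
    intro a u ha
    have h2 : Real.exp (-u) = Real.exp (-a) * Real.exp (-(u - a)) := by
      rw [← Real.exp_add]; congr 1; ring
    have h3 : 1 - (u - a) ≤ Real.exp (-(u - a)) := by
      linarith [Real.add_one_le_exp (-(u - a))]
    have h4 : Real.exp (-a) ≤ 1 := Real.exp_le_one_iff.2 (by linarith)
    have h5 := Real.exp_pos (-a)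
    rw [h2]
    calc Real.exp (-a) - Real.exp (-a) * Real.exp (-(u - a))
        = Real.exp (-a) * (1 - Real.exp (-(u - a))) := by ring
      _ ≤ Real.exp (-a) * |u - a| := by
        gcongr; linarith [le_abs_self (u - a)]
      _ ≤ |u - a| := mul_le_of_le_one_left (abs_nonneg _) h4
  have hBA : m.real (A ∪ B) = m.real A + m.real (B \ A) := by
    rw [← union_sdiff_self, measureReal_union disjoint_sdiff_right (hB.diff hA) hAm.ne
      ((measure_mono sdiff_subset).trans_lt hBm).ne]
  have hAB : m.real (A ∪ B) = m.real B + m.real (A \ B) := by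
    rw [union_comm, ← union_sdiff_self, measureReal_union disjoint_sdiff_right (hA.diff hB) hBm.ne
      ((measure_mono sdiff_subset).trans_lt hAm).ne]
  have hs : m.real (symmDiff A B) = m.real (A \ B) + m.real (B \ A) := by
    rw [Set.symmDiff_def, measureReal_union disjoint_sdiff_sdiff (hB.diff hA)
      ((measure_mono sdiff_subset).trans_lt hAm).ne ((measure_mono sdiff_subset).trans_lt hBm).ne]
  have e1 := hle (m.real A) (m.real (A ∪ B)) measureReal_nonneg
  have e2 := hle (m.real B) (m.real (A ∪ B)) measureReal_nonneg
  rw [abs_of_nonneg (by linarith [measureReal_nonneg (μ := m) (s := B \ A)])] at e1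
  rw [abs_of_nonneg (by linarith [measureReal_nonneg (μ := m) (s := A \ B)])] at e2
  linarith

/-- Void events form a `π`-system that generates the `σ`-algebra, with the whole space as the void
event of `∅`, so all integrals of `g` over measurable sets vanish. -/
theorem eq_zero_of_inner_voidLp [IsFiniteMeasure P] {g : Lp ℂ 2 P}
    (h : ∀ (A : Set X) (hA : MeasurableSet A), m A < ∞ → inner ℂ (voidLp P hA) g = 0) :
    g = 0 := by
  have hg : Integrable g P := (Lp.memLp g).integrable (by norm_num)
  have hall : ∀ S : Set (Configuration X), MeasurableSet S → ∫ x in S, g x ∂P = 0 := by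
    intro S hS
    induction S, hS using MeasurableSpace.induction_on_inter
      (configuration_measurableSpace_eq m) (isPiSystem_void m) with
    | empty => simp
    | basic V hV =>
      obtain ⟨A, hA, hAm, rfl⟩ := hV
      rw [← inner_voidLp_left hA, h A hA hAm]
    | compl S hS ih =>
      have h0 := h ∅ MeasurableSet.empty (by simp)
      rw [inner_voidLp_left, void_empty, setIntegral_univ] at h0
      rw [setIntegral_compl hS hg, ih, h0, sub_zero]
    | iUnion S hd hS ih =>
      rw [integral_iUnion hS hd hg.integrableOn]
      simp [ih]
  rw [Lp.eq_zero_iff_ae_eq_zero]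
  exact hg.ae_eq_zero_of_forall_setIntegral_eq_zero fun S hS _ => hall S hS

theorem eq_top_of_voidLp_mem [IsFiniteMeasure P] {K : Submodule ℂ (Lp ℂ 2 P)}
    (hK : IsClosed (K : Set (Lp ℂ 2 P)))
    (h : ∀ (A : Set X) (hA : MeasurableSet A), m A < ∞ → voidLp P hA ∈ K) : K = ⊤ := by
  have : CompleteSpace K := hK.completeSpace_coe
  rw [← Submodule.orthogonal_eq_bot_iff, Submodule.eq_bot_iff]
  intro g hg
  exact eq_zero_of_inner_voidLp (m := m) fun A hA hAm =>
    Submodule.inner_right_of_mem_orthogonal (h A hA hAm) hg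

end Suspension

/-! ### Construction of the Poisson process on the line. -/

section Existence

open ProbabilityTheory

/-- The uniform distribution on the unit interval `(n, n + 1]`. -/
def unifCell (n : ℤ) : Measure ℝ := volume.restrict (Ioc (n : ℝ) (n + 1))

instance (n : ℤ) : IsProbabilityMeasure (unifCell n) :=
  ⟨by rw [unifCell, Measure.restrict_apply_univ, Real.volume_Ioc]; simp⟩

/-- The law of a Poisson number together with an independent sequence of uniform points of
`(n, n + 1]`. -/
def cellLaw (n : ℤ) : Measure (ℕ × (ℕ → ℝ)) :=
  (poissonMeasure 1).prod (Measure.infinitePi fun _ : ℕ => unifCell n)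

instance (n : ℤ) : IsProbabilityMeasure (cellLaw n) := by unfold cellLaw; infer_instance

/-- The configuration given by the numbers and the positions of the points in the unit
intervals. -/
def assemble (ω : ℤ → ℕ × (ℕ → ℝ)) : Configuration ℝ :=
  ⟨⋃ n : ℤ, ⋃ i ∈ {i : ℕ | i < (ω n).1}, {(ω n).2 i},
    countable_iUnion fun _ => (to_countable _).biUnion fun _ _ => countable_singleton _⟩

/-- Finite sequences avoiding `A`. -/
def avoid (A : Set ℝ) : Set (ℕ × (ℕ → ℝ)) := {p | ∀ i < p.1, p.2 i ∉ A}

/-- Void events do not see multiplicities, so coincidences among the random points, which a set does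
not record, need not be excluded. -/
theorem assemble_preimage_void (A : Set ℝ) :
    assemble ⁻¹' void A = Set.univ.pi fun _ : ℤ => avoid A := by
  ext ω
  rw [mem_preimage, mem_void]
  change (⋃ n : ℤ, ⋃ i ∈ {i : ℕ | i < (ω n).1}, {(ω n).2 i}) ∩ A = ∅ ↔ _
  simp only [iUnion_inter, iUnion_eq_empty, avoid, mem_univ_pi, mem_ofPred_eq,
    singleton_inter_eq_empty]

theorem measurableSet_avoid_section {A : Set ℝ} (hA : MeasurableSet A) (k : ℕ) :
    MeasurableSet {u : ℕ → ℝ | ∀ i < k, u i ∉ A} := by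
  have : {u : ℕ → ℝ | ∀ i < k, u i ∉ A} = ⋂ i ∈ {i : ℕ | i < k}, (fun u : ℕ → ℝ => u i) ⁻¹' Aᶜ := by
    ext u; simp
  rw [this]
  exact MeasurableSet.biInter (to_countable _) fun i _ => measurable_pi_apply i hA.compl

theorem measurableSet_avoid {A : Set ℝ} (hA : MeasurableSet A) : MeasurableSet (avoid A) := by
  have : avoid A = ⋃ k : ℕ, ({k} : Set ℕ) ×ˢ {u : ℕ → ℝ | ∀ i < k, u i ∉ A} := by
    ext ⟨k, u⟩; simp [avoid]
  rw [this]
  exact MeasurableSet.iUnion fun k => (measurableSet_singleton k).prod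
    (measurableSet_avoid_section hA k)

/-- Given `k` independent points, all of them avoid `A` with probability `(1 - a) ^ k`; averaging
over a Poisson number of mean one gives `exp (-a)`. -/
theorem cellLaw_avoid {A : Set ℝ} (hA : MeasurableSet A) (n : ℤ) :
    cellLaw n (avoid A) = ENNReal.ofReal (Real.exp (-(unifCell n).real A)) := by
  set a := (unifCell n).real A with ha
  have ha0 : 0 ≤ a := measureReal_nonneg
  have ha1 : a ≤ 1 := measureReal_le_one
  have hsec : ∀ k : ℕ, (Measure.infinitePi fun _ : ℕ => unifCell n)
      (Prod.mk k ⁻¹' avoid A) = ENNReal.ofReal ((1 - a) ^ k) := by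
    intro k
    have h1 : Prod.mk k ⁻¹' avoid A = Set.pi (Finset.range k : Set ℕ) fun _ : ℕ => Aᶜ := by
      ext u; simp [avoid, Set.mem_pi]
    rw [h1, Measure.infinitePi_pi _ (fun _ _ => hA.compl), Finset.prod_const, Finset.card_range,
      ENNReal.ofReal_pow (by linarith), prob_compl_eq_one_sub hA,
      ENNReal.ofReal_sub _ ha0, ENNReal.ofReal_one, ha, ofReal_measureReal]
  rw [cellLaw, Measure.prod_apply (measurableSet_avoid hA)]
  simp only [hsec]
  rw [poissonMeasure, lintegral_sum_measure]
  simp only [lintegral_smul_measure, lintegral_dirac, smul_eq_mul]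
  have hs : HasSum (fun k : ℕ => Real.exp (-((1 : NNReal) : ℝ)) * ((1 : NNReal) : ℝ) ^ k /
      (Nat.factorial k : ℝ) * (1 - a) ^ k) (Real.exp (-a)) := by
    have h1 := (NormedSpace.expSeries_div_hasSum_exp (1 - a)).mul_left (Real.exp (-1))
    rw [← Real.exp_eq_exp_ℝ, ← Real.exp_add] at h1
    convert! h1 using 1
    · funext k; simp; ring
    · congr 1; ring
  rw [← hs.tsum_eq, ENNReal.ofReal_tsum_of_nonneg (fun k => by
    have : 0 ≤ 1 - a := by linarith
    positivity) hs.summable]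
  refine tsum_congr fun k => ?_
  rw [← ENNReal.ofReal_mul (by positivity)]

/-- The Poisson process on the line. -/
theorem exists_hasVoidProbabilities :
    ∃ P : Measure (Configuration ℝ), HasVoidProbabilities (volume : Measure ℝ) P := by
  set Q := Measure.infinitePi cellLaw
  have hm : Measurable assemble := by
    rw [configuration_measurableSpace_eq (volume : Measure ℝ)]
    refine measurable_generateFrom ?_
    rintro _ ⟨A, hA, -, rfl⟩
    rw [assemble_preimage_void]
    exact MeasurableSet.univ_pi fun _ => measurableSet_avoid hA
  refine ⟨Q.map assemble, Measure.isProbabilityMeasure_map hm.aemeasurable, fun A hA hAm => ?_⟩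
  have hsum : HasSum (fun n : ℤ => (unifCell n).real A) (volume.real A) := by
    have h1 : ∑' n : ℤ, unifCell n A = volume A := by
      have h2 : A = ⋃ n : ℤ, A ∩ Ioc (n : ℝ) (n + 1) := by
        rw [← inter_iUnion, iUnion_Ioc_intCast, inter_univ]
      conv_rhs => rw [h2]
      rw [measure_iUnion (fun i j hij => ((pairwise_disjoint_Ioc_intCast ℝ) hij).mono
        inter_subset_right inter_subset_right) (fun n => hA.inter measurableSet_Ioc)]
      exact tsum_congr fun n => Measure.restrict_apply hA
    have h3 := ENNReal.hasSum_toReal (f := fun n : ℤ => unifCell n A) (by rw [h1]; exact hAm.ne)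
    rw [← ENNReal.tsum_toReal_eq (fun n => measure_ne_top _ _), h1] at h3
    exact h3
  have hprod : HasProd (fun n : ℤ => cellLaw n (avoid A))
      (ENNReal.ofReal (Real.exp (-volume.real A))) := by
    have h1 : HasProd (fun n : ℤ => Real.exp (-(unifCell n).real A))
      (Real.exp (-volume.real A)) := hsum.neg.rexp
    have h2 := (ENNReal.continuous_ofReal.tendsto _).comp h1
    refine h2.congr fun s => ?_
    simp only [Function.comp_apply, cellLaw_avoid hA]
    exact ENNReal.ofReal_prod_of_nonneg fun n _ => (Real.exp_pos _).le
  rw [measureReal_def, Measure.map_apply hm (measurableSet_void hA), assemble_preimage_void,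
    Measure.infinitePi_pi_univ _ (fun _ => measurableSet_avoid hA), hprod.tprod_eq,
    ENNReal.toReal_ofReal (Real.exp_pos _).le]

end Existence

/-! ### Integer powers of automorphisms. -/

section Iter

variable {Ω : Type*} [MeasurableSpace Ω]

theorem iter_zero (T : Ω ≃ᵐ Ω) : iter T 0 = 1 := zpow_zero _

theorem iter_add (T : Ω ≃ᵐ Ω) (a b : ℤ) (x : Ω) : iter T (a + b) x = iter T a (iter T b x) := by
  rw [iter, zpow_add]; rfl

theorem iter_one_apply (T : Ω ≃ᵐ Ω) (x : Ω) : iter T 1 x = T x := by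
  rw [iter, zpow_one]; rfl

theorem iter_add_image (T : Ω ≃ᵐ Ω) (a b : ℤ) (A : Set Ω) :
    iter T (a + b) '' A = iter T a '' (iter T b '' A) := by
  rw [image_image]; simp only [iter_add]

theorem iter_zero_image (T : Ω ≃ᵐ Ω) (A : Set Ω) : iter T 0 '' A = A := by
  rw [iter_zero]; simp

theorem iter_image_eq_preimage (T : Ω ≃ᵐ Ω) (n : ℤ) (A : Set Ω) :
    iter T n '' A = iter T (-n) ⁻¹' A := by
  rw [Equiv.image_eq_preimage_symm]
  congr 1
  funext x
  rw [iter, iter, zpow_neg]; rfl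

theorem measurePreserving_iter {T : Ω ≃ᵐ Ω} {m : Measure Ω} (hT : MeasurePreserving T m m) (n : ℤ) :
    MeasurePreserving (iter T n) m m := by
  have hs : MeasurePreserving T.symm m m := hT.symm T
  induction n with
  | zero => rw [iter_zero]; exact MeasurePreserving.id m
  | succ n ih =>
    have : (iter T (n + 1) : Ω → Ω) = iter T n ∘ T := by
      funext x; rw [iter_add, iter_one_apply]; rfl
    rw [this]; exact ih.comp hT
  | pred n ih =>
    have : (iter T (-n - 1) : Ω → Ω) = iter T (-n) ∘ T.symm := by
      funext x
      have := iter_add T (-n - 1) 1 (T.symm x)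
      rw [sub_add_cancel, iter_one_apply, T.apply_symm_apply] at this
      exact this.symm
    rw [this]; exact ih.comp hs

theorem measurable_iter (T : Ω ≃ᵐ Ω) (n : ℤ) : Measurable (iter T n) := by
  -- The zero measure is preserved by every `T`, which reduces measurability to the preceding
  -- statement on measure preserving maps.
  have h0 : MeasurePreserving T (0 : Measure Ω) 0 := ⟨T.measurable, by simp⟩
  exact (measurePreserving_iter h0 n).measurable

theorem measurableSet_iter_image (T : Ω ≃ᵐ Ω) (n : ℤ) {A : Set Ω} (hA : MeasurableSet A) :
    MeasurableSet (iter T n '' A) := by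
  rw [iter_image_eq_preimage]; exact measurable_iter T _ hA

theorem measure_iter_image {T : Ω ≃ᵐ Ω} {m : Measure Ω} (hT : MeasurePreserving T m m) (n : ℤ)
    {A : Set Ω} (hA : MeasurableSet A) : m (iter T n '' A) = m A := by
  rw [iter_image_eq_preimage]
  exact (measurePreserving_iter hT (-n)).measure_preimage hA.nullMeasurableSet

theorem measureReal_iter_image {T : Ω ≃ᵐ Ω} {m : Measure Ω} (hT : MeasurePreserving T m m) (n : ℤ)
    {A : Set Ω} (hA : MeasurableSet A) : m.real (iter T n '' A) = m.real A := by
  rw [measureReal_def, measure_iter_image hT n hA]; rfl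

theorem iter_image_inter (T : Ω ≃ᵐ Ω) (n : ℤ) (A B : Set Ω) :
    iter T n '' (A ∩ B) = iter T n '' A ∩ iter T n '' B :=
  image_inter (iter T n).injective

theorem disjoint_iter_image (T : Ω ≃ᵐ Ω) (n : ℤ) {A B : Set Ω} :
    Disjoint (iter T n '' A) (iter T n '' B) ↔ Disjoint A B :=
  disjoint_image_iff (iter T n).injective

end Iter

/-! ### Positions of columns inside the next tower. -/

section Columns

variable {h₀ : ℕ} {r : ℕ → ℕ} {s : ℕ → ℕ → ℕ}

theorem columnStart_zero (j : ℕ) : columnStart h₀ r s j 0 = 0 := by simp [columnStart]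

theorem columnStart_succ (j i : ℕ) :
    columnStart h₀ r s j (i + 1) = columnStart h₀ r s j i + height h₀ r s j + s j i := by
  simp only [columnStart, Finset.sum_range_succ]; ring

theorem columnStart_columns (j : ℕ) :
    columnStart h₀ r s j (r j) = height h₀ r s (j + 1) := by
  simp only [columnStart, height]; ring

theorem monotone_columnStart (j : ℕ) : Monotone (columnStart h₀ r s j) :=
  monotone_nat_of_le_succ fun i => by rw [columnStart_succ]; omega

theorem columnStart_add_le {j i k : ℕ} (h : i < k) :
    columnStart h₀ r s j i + height h₀ r s j + s j i ≤ columnStart h₀ r s j k := by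
  rw [← columnStart_succ]; exact monotone_columnStart j h

theorem columnStart_add_lt {j i a : ℕ} (hi : i < r j) (ha : a < height h₀ r s j) :
    columnStart h₀ r s j i + a < height h₀ r s (j + 1) := by
  have := columnStart_add_le (h₀ := h₀) (r := r) (s := s) (j := j) hi
  rw [columnStart_columns] at this
  omega

theorem columnStart_add_inj {j i k a b : ℕ} (ha : a < height h₀ r s j) (hb : b < height h₀ r s j)
    (h : columnStart h₀ r s j i + a = columnStart h₀ r s j k + b) : i = k ∧ a = b := by
  rcases lt_trichotomy i k with hik | rfl | hik
  · have := columnStart_add_le (h₀ := h₀) (r := r) (s := s) (j := j) hik; omega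
  · exact ⟨rfl, by omega⟩
  · have := columnStart_add_le (h₀ := h₀) (r := r) (s := s) (j := j) hik; omega

end Columns

/-! ### Floors, columns and their measures. -/

section Towers

variable {X : Type*} [MeasurableSpace X] {m : Measure X} {T : X ≃ᵐ X} {h₀ : ℕ} {r : ℕ → ℕ}
  {s : ℕ → ℕ → ℕ} {E : ℕ → Set X}

/-- Unions of floors of the tower of stage `j`. -/
def IsFloorUnion (T : X ≃ᵐ X) (h₀ : ℕ) (r : ℕ → ℕ) (s : ℕ → ℕ → ℕ) (E : ℕ → Set X) (j : ℕ)
    (A : Set X) : Prop :=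
  ∃ F ⊆ Finset.range (height h₀ r s j), A = ⋃ a ∈ F, iter T a '' E j

/-- The spacers above the column are not included. -/
def column (T : X ≃ᵐ X) (h₀ : ℕ) (r : ℕ → ℕ) (s : ℕ → ℕ → ℕ) (E : ℕ → Set X) (j i : ℕ) : Set X :=
  ⋃ a ∈ Finset.range (height h₀ r s j), iter T ((columnStart h₀ r s j i + a : ℕ) : ℤ) '' E (j + 1)

namespace IsRankOneConstruction

theorem floor_eq_iUnion (hC : IsRankOneConstruction m T h₀ r s E)
    (j : ℕ) (a : ℤ) : iter T a '' E j =
    ⋃ i ∈ Finset.range (r j), iter T (columnStart h₀ r s j i + a) '' E (j + 1) := by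
  conv_lhs => rw [hC.cut j, image_iUnion₂]
  refine iUnion₂_congr fun i _ => ?_
  rw [← iter_add_image, add_comm]

theorem base_subset (hC : IsRankOneConstruction m T h₀ r s E) (j : ℕ) : E (j + 1) ⊆ E j := by
  intro x hx
  have h := hC.two_le_columns j
  rw [hC.cut j]
  refine mem_iUnion₂.2 ⟨0, Finset.mem_range.2 (by omega), ?_⟩
  rw [columnStart_zero, Nat.cast_zero, iter_zero_image]; exact hx

theorem base_subset_zero (hC : IsRankOneConstruction m T h₀ r s E) (j : ℕ) : E j ⊆ E 0 := by
  induction j with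
  | zero => exact subset_rfl
  | succ j ih => exact (hC.base_subset j).trans ih

theorem measure_base_lt_top (hC : IsRankOneConstruction m T h₀ r s E) (j : ℕ) : m (E j) < ∞ :=
  (measure_mono (hC.base_subset_zero j)).trans_lt hC.base_lt_top

theorem measurableSet_floorUnion (hC : IsRankOneConstruction m T h₀ r s E)
    {j : ℕ} {A : Set X} (hA : IsFloorUnion T h₀ r s E j A) :
    MeasurableSet A := by
  obtain ⟨F, -, rfl⟩ := hA
  exact Finset.measurableSet_biUnion _ fun a _ =>
    measurableSet_iter_image T _ (hC.measurableSet_base j)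

theorem measure_floorUnion_lt_top (hC : IsRankOneConstruction m T h₀ r s E)
    {j : ℕ} {A : Set X} (hA : IsFloorUnion T h₀ r s E j A) :
    m A < ∞ := by
  obtain ⟨F, -, rfl⟩ := hA
  refine measure_biUnion_lt_top F.finite_toSet fun a _ => ?_
  rw [measure_iter_image hC.measurePreserving _ (hC.measurableSet_base j)]
  exact hC.measure_base_lt_top j

theorem floorUnion_succ (hC : IsRankOneConstruction m T h₀ r s E)
    {j : ℕ} {A : Set X} (hA : IsFloorUnion T h₀ r s E j A) :
    IsFloorUnion T h₀ r s E (j + 1) A := by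
  classical
  obtain ⟨F, hF, rfl⟩ := hA
  refine ⟨F.biUnion fun a => (Finset.range (r j)).image fun i => columnStart h₀ r s j i + a, ?_, ?_⟩
  · intro b hb
    simp only [Finset.mem_biUnion, Finset.mem_image, Finset.mem_range] at hb ⊢
    obtain ⟨a, ha, i, hi, rfl⟩ := hb
    exact columnStart_add_lt hi (Finset.mem_range.1 (hF ha))
  · rw [Finset.set_biUnion_biUnion]
    refine iUnion₂_congr fun a _ => ?_
    rw [hC.floor_eq_iUnion j a, Finset.set_biUnion_finset_image]
    refine iUnion₂_congr fun i _ => ?_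
    rw [Nat.cast_add]

theorem floorUnion_mono (hC : IsRankOneConstruction m T h₀ r s E)
    {j k : ℕ} (hjk : j ≤ k) {A : Set X} (hA : IsFloorUnion T h₀ r s E j A) :
    IsFloorUnion T h₀ r s E k A := by
  induction k, hjk using Nat.le_induction with
  | base => exact hA
  | succ k _ ih => exact hC.floorUnion_succ ih

theorem floorUnion_inter (hC : IsRankOneConstruction m T h₀ r s E)
    {j : ℕ} {A B : Set X} (hA : IsFloorUnion T h₀ r s E j A)
    (hB : IsFloorUnion T h₀ r s E j B) : IsFloorUnion T h₀ r s E j (A ∩ B) := by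
  classical
  obtain ⟨F, hF, rfl⟩ := hA
  obtain ⟨G, hG, rfl⟩ := hB
  refine ⟨F ∩ G, fun a ha => hF (Finset.mem_inter.1 ha).1, ?_⟩
  ext x
  simp only [mem_inter_iff, mem_iUnion₂, Finset.mem_inter]
  constructor
  · rintro ⟨⟨a, ha, hxa⟩, ⟨b, hb, hxb⟩⟩
    have : a = b := by
      by_contra hne
      exact disjoint_left.1 (hC.disjoint_floors j a (Finset.mem_range.1 (hF ha)) b
        (Finset.mem_range.1 (hG hb)) hne) hxa hxb
    subst this
    exact ⟨a, ⟨ha, hb⟩, hxa⟩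
  · rintro ⟨a, ⟨ha, hb⟩, hxa⟩
    exact ⟨⟨a, ha, hxa⟩, ⟨a, hb, hxa⟩⟩

theorem inter_column (hC : IsRankOneConstruction m T h₀ r s E)
    {j i : ℕ} (hi : i < r j) {F : Finset ℕ}
    (hF : F ⊆ Finset.range (height h₀ r s j)) :
    (⋃ a ∈ F, iter T a '' E j) ∩ column T h₀ r s E j i =
      ⋃ a ∈ F, iter T ((columnStart h₀ r s j i + a : ℕ) : ℤ) '' E (j + 1) := by
  ext x
  simp only [column, mem_inter_iff, mem_iUnion₂]
  constructor
  · rintro ⟨⟨a, ha, hxa⟩, ⟨b, hb, hxb⟩⟩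
    rw [hC.floor_eq_iUnion j a] at hxa
    obtain ⟨k, hk, hxk⟩ := mem_iUnion₂.1 hxa
    rw [← Nat.cast_add] at hxk
    have ha' := Finset.mem_range.1 (hF ha)
    have hb' := Finset.mem_range.1 hb
    have hk' := Finset.mem_range.1 hk
    by_cases hne : columnStart h₀ r s j k + a = columnStart h₀ r s j i + b
    · obtain ⟨rfl, rfl⟩ := columnStart_add_inj ha' hb' hne
      exact ⟨a, ha, hxb⟩
    · exact absurd hxb (disjoint_left.1 (hC.disjoint_floors (j + 1) _
        (columnStart_add_lt hk' ha') _ (columnStart_add_lt hi hb') hne) hxk)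
  · rintro ⟨a, ha, hxa⟩
    refine ⟨⟨a, ha, ?_⟩, ⟨a, hF ha, hxa⟩⟩
    rw [hC.floor_eq_iUnion j a]
    refine mem_iUnion₂.2 ⟨i, Finset.mem_range.2 hi, ?_⟩
    rwa [← Nat.cast_add]

/-- Columns are translates of each other: the power that carries the base of one column to the base
of the other matches the floors, and `D` consists of whole floors. -/
theorem iter_inter_column (hC : IsRankOneConstruction m T h₀ r s E)
    {j i k : ℕ} (hi : i < r j) (hk : k < r j) {D : Set X}
    (hD : IsFloorUnion T h₀ r s E j D) :
    iter T ((columnStart h₀ r s j k : ℤ) - columnStart h₀ r s j i) ''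
      (D ∩ column T h₀ r s E j i) = D ∩ column T h₀ r s E j k := by
  obtain ⟨F, hF, rfl⟩ := hD
  rw [hC.inter_column hi hF, hC.inter_column hk hF, image_iUnion₂]
  refine iUnion₂_congr fun a _ => ?_
  rw [← iter_add_image]
  congr 3
  push_cast; ring

theorem floorUnion_eq_iUnion_column (hC : IsRankOneConstruction m T h₀ r s E)
    {j : ℕ} {D : Set X} (hD : IsFloorUnion T h₀ r s E j D) :
    D = ⋃ i ∈ Finset.range (r j), D ∩ column T h₀ r s E j i := by
  refine subset_antisymm (fun x hx => ?_) (iUnion₂_subset fun i _ => inter_subset_left)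
  obtain ⟨F, hF, rfl⟩ := hD
  obtain ⟨a, ha, hxa⟩ := mem_iUnion₂.1 hx
  rw [hC.floor_eq_iUnion j a] at hxa
  obtain ⟨k, hk, hxk⟩ := mem_iUnion₂.1 hxa
  refine mem_iUnion₂.2 ⟨k, hk, ?_⟩
  rw [hC.inter_column (Finset.mem_range.1 hk) hF]
  refine mem_iUnion₂.2 ⟨a, ha, ?_⟩
  rwa [Nat.cast_add]

theorem measurableSet_column (hC : IsRankOneConstruction m T h₀ r s E)
    (j i : ℕ) : MeasurableSet (column T h₀ r s E j i) :=
  Finset.measurableSet_biUnion _ fun _ _ =>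
    measurableSet_iter_image T _ (hC.measurableSet_base (j + 1))

theorem disjoint_column (hC : IsRankOneConstruction m T h₀ r s E)
    {j i k : ℕ} (hi : i < r j) (hk : k < r j) (hik : i ≠ k) :
    Disjoint (column T h₀ r s E j i) (column T h₀ r s E j k) := by
  rw [disjoint_left]
  intro x hx hx'
  obtain ⟨a, ha, hxa⟩ := mem_iUnion₂.1 hx
  obtain ⟨b, hb, hxb⟩ := mem_iUnion₂.1 hx'
  have ha' := Finset.mem_range.1 ha
  have hb' := Finset.mem_range.1 hb
  exact disjoint_left.1 (hC.disjoint_floors (j + 1) _ (columnStart_add_lt hi ha') _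
    (columnStart_add_lt hk hb') fun h => hik (columnStart_add_inj ha' hb' h).1) hxa hxb

theorem measureReal_inter_column (hC : IsRankOneConstruction m T h₀ r s E)
    {j i : ℕ} (hi : i < r j) {D : Set X}
    (hD : IsFloorUnion T h₀ r s E j D) :
    m.real (D ∩ column T h₀ r s E j i) = m.real D / r j := by
  have hDm := hC.measurableSet_floorUnion hD
  have hDf := hC.measure_floorUnion_lt_top hD
  have hcol : ∀ k < r j, m.real (D ∩ column T h₀ r s E j k) =
      m.real (D ∩ column T h₀ r s E j i) := fun k hk => by
    rw [← hC.iter_inter_column hi hk hD, measureReal_iter_image hC.measurePreserving _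
      (hDm.inter (hC.measurableSet_column j i))]
  have hsum : m.real D = ∑ k ∈ Finset.range (r j), m.real (D ∩ column T h₀ r s E j k) := by
    conv_lhs => rw [hC.floorUnion_eq_iUnion_column hD]
    rw [measureReal_biUnion_finset]
    · intro k hk l hl hkl
      exact (hC.disjoint_column (Finset.mem_range.1 hk) (Finset.mem_range.1 hl) hkl).mono
        inter_subset_right inter_subset_right
    · exact fun k _ => hDm.inter (hC.measurableSet_column j k)
  rw [Finset.sum_congr rfl fun k hk => hcol k (Finset.mem_range.1 hk), Finset.sum_const,
    Finset.card_range, nsmul_eq_mul] at hsum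
  have hr : (r j : ℝ) ≠ 0 := by have := hC.two_le_columns j; positivity
  field_simp
  linarith

/-- The image occupies as many floors directly above the column as the tower is high, and these are
all spacers. -/
theorem disjoint_iter_column (hC : IsRankOneConstruction m T h₀ r s E)
    {j i : ℕ} (hi : i < r j) (hs : height h₀ r s j ≤ s j i) {A : Set X}
    (hA : IsFloorUnion T h₀ r s E j A) :
    Disjoint A (iter T (height h₀ r s j) '' column T h₀ r s E j i) := by
  rw [disjoint_left]
  intro x hx hx'
  obtain ⟨F, hF, rfl⟩ := hA
  obtain ⟨a, ha, hxa⟩ := mem_iUnion₂.1 hx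
  rw [hC.floor_eq_iUnion j a] at hxa
  obtain ⟨k, hk, hxk⟩ := mem_iUnion₂.1 hxa
  rw [column, image_iUnion₂] at hx'
  obtain ⟨b, hb, hxb⟩ := mem_iUnion₂.1 hx'
  rw [← iter_add_image, ← Nat.cast_add] at hxb
  rw [← Nat.cast_add] at hxk
  have ha' := Finset.mem_range.1 (hF ha)
  have hb' := Finset.mem_range.1 hb
  have hk' := Finset.mem_range.1 hk
  have h1 := columnStart_add_le (h₀ := h₀) (r := r) (s := s) (j := j) hi
  rw [columnStart_columns] at h1
  have hne : columnStart h₀ r s j k + a ≠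
      height h₀ r s j + (columnStart h₀ r s j i + b) := by
    intro h
    rcases lt_or_ge i k with hik | hik
    · have := columnStart_add_le (h₀ := h₀) (r := r) (s := s) (j := j) hik; omega
    · have := monotone_columnStart (h₀ := h₀) (r := r) (s := s) j hik; omega
  exact disjoint_left.1 (hC.disjoint_floors (j + 1) _ (columnStart_add_lt hk' ha') _ (by omega)
    hne) hxk hxb

end IsRankOneConstruction

end Towers

/-! ### Correlations at the heights of the towers. -/

section Correlations

/-- Stage `j` follows the pattern `L`: the spacers of its columns but the last one are, periodically,
the entries of `L`, where `none` stands for a spacer at least as high as the tower; the last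
spacer is at least as high as the tower, too. -/
structure FollowsPattern (h₀ : ℕ) (r : ℕ → ℕ) (s : ℕ → ℕ → ℕ) (j : ℕ) (L : List (Option ℕ)) :
    Prop where
  columns : r j = L.length * (j + 1) + 1
  some_spacer : ∀ i < L.length * (j + 1), ∀ o : ℕ, L[i % L.length]? = some (some o) → s j i = o
  none_spacer : ∀ i < L.length * (j + 1), L[i % L.length]? = some none → height h₀ r s j ≤ s j i
  last_spacer : height h₀ r s j ≤ s j (L.length * (j + 1))

theorem sum_range_mul_mod (f : ℕ → ℝ) (M n : ℕ) :
    ∑ i ∈ Finset.range (M * n), f (i % M) = n * ∑ i ∈ Finset.range M, f i := by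
  induction n with
  | zero => simp
  | succ n ih =>
    rw [Nat.mul_succ, Finset.sum_range_add, ih]
    have : ∑ x ∈ Finset.range M, f ((M * n + x) % M) = ∑ x ∈ Finset.range M, f x :=
      Finset.sum_congr rfl fun x hx => by
        rw [Nat.mul_add_mod, Nat.mod_eq_of_lt (Finset.mem_range.1 hx)]
    rw [this]; push_cast; ring

variable {X : Type*} [MeasurableSpace X] {m : Measure X} {T : X ≃ᵐ X} {h₀ : ℕ} {r : ℕ → ℕ}
  {s : ℕ → ℕ → ℕ} {E : ℕ → Set X}

/-- The contribution of an entry of a pattern to the correlations of `A` and `B`. -/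
def entryWeight (m : Measure X) (T : X ≃ᵐ X) (A B : Set X) : Option ℕ → ℝ
  | some o => m.real (iter T o '' A ∩ B)
  | none => 0

/-- A point of a column, moved up by the height, stands `o` floors below its copy in the next column
if the spacer is `o`, and among the spacers if the spacer is high. Each column but the last thus
contributes its entry weight divided by `r j`, and each entry of `L` governs `j + 1` columns. -/
theorem IsRankOneConstruction.measureReal_inter_iter_height
    (hC : IsRankOneConstruction m T h₀ r s E) {j : ℕ} {L : List (Option ℕ)} (hL : L ≠ [])
    (hj : FollowsPattern h₀ r s j L) {A B : Set X} (hA : IsFloorUnion T h₀ r s E j A)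
    (hB : IsFloorUnion T h₀ r s E j B)
    (hLA : ∀ o : ℕ, some o ∈ L → IsFloorUnion T h₀ r s E j (iter T o '' A)) :
    m.real (A ∩ iter T (height h₀ r s j) '' B) =
      (j + 1) / (L.length * (j + 1) + 1) * (L.map (entryWeight m T A B)).sum := by
  set H := height h₀ r s j with hH
  set M := L.length with hM
  have hM0 : 0 < M := List.length_pos_iff.2 hL
  have hcols : r j = M * (j + 1) + 1 := hj.columns
  have hAm := hC.measurableSet_floorUnion hA
  have hBm := hC.measurableSet_floorUnion hB
  have hBf := hC.measure_floorUnion_lt_top hB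
  have hAf := hC.measure_floorUnion_lt_top hA
  have hBcm : ∀ i, MeasurableSet (B ∩ column T h₀ r s E j i) := fun i =>
    hBm.inter (hC.measurableSet_column j i)
  have hsplit : A ∩ iter T H '' B = ⋃ i ∈ Finset.range (r j),
      A ∩ iter T H '' (B ∩ column T h₀ r s E j i) := by
    conv_lhs => rw [hC.floorUnion_eq_iUnion_column hB, image_iUnion₂, inter_iUnion₂]
  rw [hsplit, measureReal_biUnion_finset
    (fun i hi k hk hik => Disjoint.mono inter_subset_right inter_subset_right
      ((disjoint_iter_image T _).2 (Disjoint.mono inter_subset_right inter_subset_right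
        (hC.disjoint_column (Finset.mem_range.1 hi) (Finset.mem_range.1 hk) hik))))
    (fun i _ => hAm.inter (measurableSet_iter_image T _ (hBcm i)))
    (fun i _ => ((measure_mono inter_subset_left).trans_lt hAf).ne)]
  have hzero : ∀ i < r j, H ≤ s j i →
      m.real (A ∩ iter T H '' (B ∩ column T h₀ r s E j i)) = 0 := by
    intro i hi hs
    have hd := hC.disjoint_iter_column hi hs hA
    have : A ∩ iter T H '' (B ∩ column T h₀ r s E j i) = ∅ :=
      (hd.mono_right (image_mono inter_subset_right)).inter_eq
    rw [this, measureReal_empty]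
  have hterm : ∀ i < M * (j + 1), m.real (A ∩ iter T H '' (B ∩ column T h₀ r s E j i)) =
      (L.map (entryWeight m T A B)).getD (i % M) 0 / r j := by
    intro i hi
    have hir : i < r j := by rw [hcols]; omega
    have hir1 : i + 1 < r j := by rw [hcols]; omega
    have hlt : i % M < L.length := Nat.mod_lt _ hM0
    have hget : (L.map (entryWeight m T A B)).getD (i % M) 0 =
        entryWeight m T A B L[i % M] := by
      rw [List.getD_eq_getElem _ _ (by simpa using hlt), List.getElem_map]
    have hq : L[i % M]? = some L[i % M] := List.getElem?_eq_getElem hlt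
    rw [hget]
    rcases ho : L[i % M] with _ | o
    · rw [ho] at hq
      rw [hzero i hir (hj.none_spacer i hi hq)]
      simp [entryWeight]
    · rw [ho] at hq
      have hso := hj.some_spacer i hi o hq
      have hmem : some o ∈ L := ho ▸ List.getElem_mem hlt
      have hD := hC.floorUnion_inter (hLA o hmem) hB
      -- Moving up by the spacer `o` as well carries the column exactly onto the next one.
      have h1 : iter T (o : ℤ) '' (A ∩ iter T H '' (B ∩ column T h₀ r s E j i)) =
          (iter T o '' A ∩ B) ∩ column T h₀ r s E j (i + 1) := by
        rw [iter_image_inter, ← iter_add_image, inter_assoc,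
          ← hC.iter_inter_column hir hir1 hB]
        congr 4
        rw [columnStart_succ, hso]
        push_cast; ring
      rw [← measureReal_iter_image hC.measurePreserving o
        (hAm.inter (measurableSet_iter_image T _ (hBcm i))), h1,
        hC.measureReal_inter_column hir1 hD]
      rfl
  rw [hj.columns, Finset.sum_range_succ, hzero _ (by rw [hj.columns]; omega) hj.last_spacer,
    add_zero, Finset.sum_congr rfl fun i hi => hterm i (Finset.mem_range.1 hi), hj.columns,
    sum_range_mul_mod (fun i => (L.map (entryWeight m T A B)).getD i 0 /
      ((M * (j + 1) + 1 : ℕ) : ℝ)) M, ← Finset.sum_div]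
  have hlist : ∀ l : List ℝ, ∑ i ∈ Finset.range l.length, l.getD i 0 = l.sum := by
    intro l
    rw [← Fin.sum_univ_eq_sum_range (fun i => l.getD i 0), ← Fin.sum_univ_getElem]
    exact Finset.sum_congr rfl fun i _ => List.getD_eq_getElem _ _ i.2
  have := hlist (L.map (entryWeight m T A B))
  rw [List.length_map] at this
  rw [this]
  push_cast
  ring

/-- Correlations along the stages that follow a given pattern. -/
theorem IsRankOneConstruction.tendsto_measureReal_inter_iter_height
    (hC : IsRankOneConstruction m T h₀ r s E) {L : List (Option ℕ)} (hL : L ≠ [])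
    {J : ℕ} {A B : Set X} (hA : IsFloorUnion T h₀ r s E J A)
    (hB : IsFloorUnion T h₀ r s E J B)
    (hLA : ∀ o : ℕ, some o ∈ L → IsFloorUnion T h₀ r s E J (iter T o '' A)) :
    Tendsto (fun j => m.real (A ∩ iter T (height h₀ r s j) '' B))
      (atTop ⊓ 𝓟 {j | FollowsPattern h₀ r s j L})
      (𝓝 ((L.map (entryWeight m T A B)).sum / L.length)) := by
  have hM0 : (0 : ℝ) < L.length := by exact_mod_cast List.length_pos_iff.2 hL
  -- Only the last column lies outside the periods of the pattern; its share vanishes.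
  have hlim : Tendsto (fun j : ℕ => ((j : ℝ) + 1) / (L.length * ((j : ℝ) + 1) + 1) *
      (L.map (entryWeight m T A B)).sum) atTop
      (𝓝 ((1 / L.length) * (L.map (entryWeight m T A B)).sum)) := by
    refine Tendsto.mul_const _ ?_
    have h1 : Tendsto (fun j : ℕ => 1 / ((L.length : ℝ) + 1 / ((j : ℝ) + 1))) atTop
        (𝓝 (1 / ((L.length : ℝ) + 0))) :=
      tendsto_const_nhds.div (tendsto_const_nhds.add tendsto_one_div_add_atTop_nhds_zero_nat)
        (by rw [add_zero]; exact hM0.ne')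
    rw [add_zero] at h1
    refine h1.congr fun j => ?_
    have : (0 : ℝ) < (j : ℝ) + 1 := by positivity
    field_simp
  rw [one_div_mul_eq_div] at hlim
  refine (hlim.mono_left inf_le_left).congr' ?_
  rw [EventuallyEq, eventually_inf_principal]
  filter_upwards [eventually_ge_atTop J] with j hj hfol
  exact (hC.measureReal_inter_iter_height hL hfol (hC.floorUnion_mono hj hA)
    (hC.floorUnion_mono hj hB) fun o ho => hC.floorUnion_mono hj (hLA o ho)).symm

end Correlations

/-! ### The Koopman operator on void indicators and on generating functions. -/

section Koopman

variable {X : Type*} [MeasurableSpace X] {m : Measure X} {P : Measure (Configuration X)} {T : X ≃ᵐ X}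

theorem voidLp_congr [IsFiniteMeasure P] {A B : Set X} (hA : MeasurableSet A)
    (hB : MeasurableSet B) (h : A = B) : voidLp P hA = voidLp P hB := by subst h; rfl

theorem koopman_voidLp [IsFiniteMeasure P] (hS : MeasurePreserving (poissonSuspension T) P P)
    {A : Set X} (hA : MeasurableSet A) :
    koopman hS (voidLp P hA) = voidLp P (measurableSet_iter_image T (-1) hA) := by
  change Lp.compMeasurePreserving (poissonSuspension T) hS (voidLp P hA) = _
  rw [voidLp, Lp.indicatorConstLp_compMeasurePreserving]
  unfold voidLp
  congr 1
  rw [preimage_poissonSuspension_void, iter_image_eq_preimage, neg_neg]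
  rfl

theorem koopman_zpow_voidLp [IsFiniteMeasure P]
    (hS : MeasurePreserving (poissonSuspension T) P P) {A : Set X} (hA : MeasurableSet A) (n : ℤ) :
    (koopman hS ^ n) (voidLp P hA) = voidLp P (measurableSet_iter_image T (-n) hA) := by
  induction n generalizing A with
  | zero =>
    rw [zpow_zero]
    exact voidLp_congr hA _ (by rw [neg_zero, iter_zero_image])
  | succ n ih =>
    rw [zpow_add_one]
    change (koopman hS ^ (n : ℤ)) (koopman hS (voidLp P hA)) = _
    rw [koopman_voidLp, ih]
    exact voidLp_congr _ _ (by rw [← iter_add_image, neg_add])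
  | pred n ih =>
    have h1 : voidLp P hA = koopman hS (voidLp P (measurableSet_iter_image T 1 hA)) := by
      rw [koopman_voidLp]
      exact voidLp_congr _ _ (by rw [← iter_add_image]; simp [iter_zero_image])
    have h2 := ih (measurableSet_iter_image T 1 hA)
    have h3 : (koopman hS ^ (-(n : ℤ) - 1)) (koopman hS (voidLp P
        (measurableSet_iter_image T 1 hA))) = (koopman hS ^ (-(n : ℤ) - 1 + 1)) (voidLp P
        (measurableSet_iter_image T 1 hA)) := by rw [zpow_add_one]; rfl
    rw [h1, h3, sub_add_cancel, h2]
    exact voidLp_congr _ _ (by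
      rw [← iter_add_image, show -(-(n : ℤ) - 1) = - -(n : ℤ) + 1 by ring])

/-- The function `x ↦ z ^ |x ∩ A|`. -/
def genLp (P : Measure (Configuration X)) [IsFiniteMeasure P] {A : Set X} (hA : MeasurableSet A)
    {z : ℝ} (hz : z ∈ Ico (0 : ℝ) 1) : Lp ℂ 2 P :=
  MemLp.toLp (fun x => (gen z (x.count A) : ℂ)) (MemLp.of_bound
    (Complex.measurable_ofReal.comp (measurable_gen_count hA z)).aestronglyMeasurable 1
    (Eventually.of_forall fun x => by
      rw [Complex.norm_real]; exact norm_gen_le_one hz.1 hz.2.le _))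

theorem coeFn_genLp [IsFiniteMeasure P] {A : Set X} (hA : MeasurableSet A)
    {z : ℝ} (hz : z ∈ Ico (0 : ℝ) 1) :
    genLp P hA hz =ᵐ[P] fun x => (gen z (x.count A) : ℂ) := MemLp.coeFn_toLp _

/-- As a function of `z` this is a power series whose constant coefficient is the inner product with
`voidLp P hA`; so orthogonality for many `z` yields orthogonality to the void indicator. -/
theorem inner_genLp_left [IsFiniteMeasure P] {A : Set X} (hA : MeasurableSet A)
    {z : ℝ} (hz : z ∈ Ico (0 : ℝ) 1) (g : Lp ℂ 2 P) :
    inner ℂ (genLp P hA hz) g = ∑' k : ℕ, (∫ x in cylinder A k, g x ∂P) * (z : ℂ) ^ k := by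
  rw [← integral_gen_eq_tsum ((Lp.memLp g).integrable (by norm_num)) hA hz.1 hz.2.le, L2.inner_def]
  refine integral_congr_ae ?_
  filter_upwards [coeFn_genLp (P := P) hA hz] with x hx
  rw [hx]
  simp [RCLike.inner_apply]

variable [MeasurableSpace.CountablyGenerated X] [MeasurableSpace.SeparatesPoints X]
  [SigmaFinite m] [NullSingletonClass m]

/-- If the functions `z ^ |x ∩ A|` are orthogonal to `g` for values of `z` that accumulate inside
`[0, 1)`, then `g` is orthogonal to the void event of `A`. -/
theorem inner_voidLp_eq_zero_of_frequently [IsFiniteMeasure P] {A : Set X} (hA : MeasurableSet A)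
    {g : Lp ℂ 2 P} {z₀ : ℝ} (hz₀ : |z₀| < 1)
    (h : ∃ᶠ z in 𝓝[≠] z₀, ∃ hz : z ∈ Ico (0 : ℝ) 1, inner ℂ (genLp P hA hz) g = 0) :
    inner ℂ (voidLp P hA) g = 0 := by
  have hg : Integrable g P := (Lp.memLp g).integrable (by norm_num)
  have := coeff_eq_zero_of_frequently (summable_norm_integral_cylinder hg hA) (z₀ := (z₀ : ℂ))
    (by simpa using hz₀) (frequently_ofReal (h.mono fun z ⟨hz, hzg⟩ => by
      rw [inner_genLp_left] at hzg; exact hzg)) 0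
  rw [inner_voidLp_left]
  exact this

/-- If `B` is void, the points in `A` are those in `A \ B`, and the indicator of the void event is
`gen 0`. So this is a joint generating function of the disjoint sets `B` and `A \ B`. -/
theorem inner_voidLp_genLp (hP : HasVoidProbabilities m P) [IsFiniteMeasure P] {A B : Set X}
    (hA : MeasurableSet A) (hB : MeasurableSet B) (hAm : m A < ∞) (hBm : m B < ∞)
    {z : ℝ} (hz : z ∈ Ico (0 : ℝ) 1) :
    inner ℂ (voidLp P hB) (genLp P hA hz) =
      (Real.exp (-m.real B + (z - 1) * m.real (A \ B)) : ℂ) := by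
  have h := integral_prod_gen hP (ι := Bool) (fun b => if b then B else A \ B)
    (fun b => if b then 0 else z) (by rintro (_ | _) <;> simp [hB, hA.diff hB])
    (by
      rintro (_ | _)
      · simpa using (measure_mono sdiff_subset).trans_lt hAm
      · simpa using hBm)
    (by
      rintro (_ | _) (_ | _) hne
      · exact absurd rfl hne
      · exact disjoint_sdiff_left
      · exact disjoint_sdiff_right
      · exact absurd rfl hne)
    (by rintro (_ | _) <;> simp [hz.1]) (by rintro (_ | _) <;> simp [hz.2])
  simp only [Fintype.univ_bool, Finset.prod_insert, Finset.mem_singleton, Bool.true_eq_false,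
    not_false_eq_true, Finset.prod_singleton, if_true, Bool.false_eq_true, if_false, zero_sub,
    neg_mul, one_mul, ← Real.exp_add] at h
  rw [← h, inner_voidLp_left, setIntegral_congr_ae (measurableSet_void hB)
    ((coeFn_genLp (P := P) hA hz).mono fun x hx _ => hx), ← integral_indicator
    (measurableSet_void hB), ← integral_complex_ofReal]
  refine integral_congr_ae (Eventually.of_forall fun x => ?_)
  dsimp only
  rw [gen_zero_count]
  by_cases hx : x ∈ void B
  · have hc : x.count A = x.count (A \ B) := by
      change (x.1 ∩ A).encard = (x.1 ∩ (A \ B)).encard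
      congr 1
      ext y
      constructor
      · rintro ⟨h1, h2⟩
        exact ⟨h1, h2, fun h3 => (mem_void.1 hx).subset ⟨h1, h3⟩⟩
      · rintro ⟨h1, h2, -⟩; exact ⟨h1, h2⟩
    rw [indicator_of_mem hx, indicator_of_mem hx, hc, Pi.one_apply, one_mul]
  · rw [indicator_of_notMem hx, indicator_of_notMem hx, zero_mul, Complex.ofReal_zero]

end Koopman

/-! ### Weak limits of powers of the suspension. -/

section WeakLimits

variable {X : Type*} [MeasurableSpace X] {m : Measure X} {P : Measure (Configuration X)}
  {T : X ≃ᵐ X} {h₀ : ℕ} {r : ℕ → ℕ} {s : ℕ → ℕ → ℕ} {E : ℕ → Set X}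
  [MeasurableSpace.CountablyGenerated X] [MeasurableSpace.SeparatesPoints X]
  [SigmaFinite m] [NullSingletonClass m]

/-- The indicators of the void events of unions of floors. -/
def floorVoids (P : Measure (Configuration X)) [IsFiniteMeasure P] (T : X ≃ᵐ X) (h₀ : ℕ)
    (r : ℕ → ℕ) (s : ℕ → ℕ → ℕ) (E : ℕ → Set X) : Set (Lp ℂ 2 P) :=
  {v | ∃ (j : ℕ) (B : Set X) (hB : MeasurableSet B),
    IsFloorUnion T h₀ r s E j B ∧ v = voidLp P hB}

theorem span_floorVoids (hC : IsRankOneConstruction m T h₀ r s E) (hP : HasVoidProbabilities m P)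
    [IsFiniteMeasure P] :
    (Submodule.span ℂ (floorVoids P T h₀ r s E)).topologicalClosure = ⊤ := by
  refine eq_top_of_voidLp_mem (m := m) (Submodule.isClosed_topologicalClosure _)
    fun A hA hAm => ?_
  change voidLp P hA ∈ closure (Submodule.span ℂ (floorVoids P T h₀ r s E) : Set (Lp ℂ 2 P))
  refine Metric.mem_closure_iff.2 fun ε hε => ?_
  obtain ⟨j, F, hF, hlt⟩ := hC.approx A hA hAm (ENNReal.ofReal (ε ^ 2)) (by positivity)
  have hB : IsFloorUnion T h₀ r s E j (⋃ a ∈ F, iter T a '' E j) := ⟨F, hF, rfl⟩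
  have hBm := hC.measurableSet_floorUnion hB
  refine ⟨voidLp P hBm, Submodule.subset_span ⟨j, _, hBm, hB, rfl⟩, ?_⟩
  rw [dist_eq_norm]
  have h1 := norm_voidLp_sub_sq_le hP hA hBm hAm (hC.measure_floorUnion_lt_top hB)
  have h2 : m.real (symmDiff A (⋃ a ∈ F, iter T a '' E j)) < ε ^ 2 :=
    (ENNReal.lt_ofReal_iff_toReal_lt hlt.ne_top).1 hlt
  exact lt_of_pow_lt_pow_left₀ 2 hε.le (h1.trans_lt h2)

/-- Weak limits of the powers of the suspension on void events. -/
theorem tendsto_inner_koopman_height (hC : IsRankOneConstruction m T h₀ r s E)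
    (hP : HasVoidProbabilities m P) [IsProbabilityMeasure P]
    (hS : MeasurePreserving (poissonSuspension T) P P)
    {L : List (Option ℕ)} (hL : L ≠ []) {J : ℕ} {A A' : Set X} (hA : MeasurableSet A)
    (hAJ : IsFloorUnion T h₀ r s E J A)
    (hLA : ∀ o : ℕ, some o ∈ L → IsFloorUnion T h₀ r s E J (iter T o '' A))
    (hA' : MeasurableSet A') (hA'm : m A' < ∞) {z : ℝ} (hz : z ∈ Ico (0 : ℝ) 1)
    (hw : ∀ B : Set X, MeasurableSet B → m B < ∞ →
      (L.map (entryWeight m T A B)).sum / L.length = (1 - z) * m.real (A' ∩ B)) (w : Lp ℂ 2 P) :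
    Tendsto (fun j => inner ℂ w ((koopman hS ^ (height h₀ r s j : ℤ)) (voidLp P hA)))
      (atTop ⊓ 𝓟 {j | FollowsPattern h₀ r s j L})
      (𝓝 (inner ℂ w ((Real.exp ((1 - z) * m.real A' - m.real A) : ℂ) • genLp P hA' hz))) := by
  have hAm := hC.measure_floorUnion_lt_top hAJ
  refine tendsto_inner_of_total (C := 1) (fun j => ?_) (S := floorVoids P T h₀ r s E) ?_
    (by rw [span_floorVoids hC hP]; trivial)
  · rw [LinearIsometryEquiv.norm_map]; exact norm_voidLp_le_one hA
  rintro _ ⟨K, B, hB, hBK, rfl⟩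
  have hBm := hC.measure_floorUnion_lt_top hBK
  -- The inner product is `exp` of minus the measure of a union; inclusion-exclusion leaves only the
  -- correlation of `A` and `B` to depend on `j`.
  have h1 : ∀ j, inner ℂ (voidLp P hB) ((koopman hS ^ (height h₀ r s j : ℤ)) (voidLp P hA)) =
      (Real.exp (-m.real A - m.real B + m.real (A ∩ iter T (height h₀ r s j) '' B)) : ℂ) := by
    intro j
    set n : ℤ := (height h₀ r s j : ℤ)
    have hAn := measurableSet_iter_image T (-n) hA
    have hAnm : m (iter T (-n) '' A) < ∞ := by
      rwa [measure_iter_image hC.measurePreserving _ hA]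
    rw [koopman_zpow_voidLp, inner_voidLp_voidLp hP hB hAn hBm hAnm]
    congr 2
    have h2 := measureReal_union_add_inter (μ := m) (s := B) hAn hBm.ne hAnm.ne
    have h3 : m.real (B ∩ iter T (-n) '' A) = m.real (A ∩ iter T n '' B) := by
      rw [← measureReal_iter_image hC.measurePreserving n (hB.inter hAn), iter_image_inter,
        ← iter_add_image, add_neg_cancel, iter_zero_image, inter_comm]
    rw [h3, measureReal_iter_image hC.measurePreserving _ hA] at h2
    linarith
  -- The scalar in front of `genLp` is the one for which the exponents agree, since `A' \ B` has the
  -- measure of `A'` minus that of `A' ∩ B`.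
  have h4 : inner ℂ (voidLp P hB) ((Real.exp ((1 - z) * m.real A' - m.real A) : ℂ) •
      genLp P hA' hz) = (Real.exp (-m.real A - m.real B + (1 - z) * m.real (A' ∩ B)) : ℂ) := by
    rw [inner_smul_right, inner_voidLp_genLp hP hA' hB hA'm hBm hz, ← Complex.ofReal_mul, ← Real.exp_add]
    congr 2
    have h5 := measureReal_inter_add_sdiff (μ := m) (s := A') hB hA'm.ne
    linear_combination (1 - z) * (-h5)
  rw [h4, ← hw B hB hBm]
  simp only [h1]
  have h6 := hC.tendsto_measureReal_inter_iter_height (J := max J K) hL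
    (hC.floorUnion_mono (le_max_left _ _) hAJ) (hC.floorUnion_mono (le_max_right _ _) hBK)
    (fun o ho => hC.floorUnion_mono (le_max_left _ _) (hLA o ho))
  have h7 := (Complex.continuous_ofReal.comp Real.continuous_exp).tendsto
    (-m.real A - m.real B + (L.map (entryWeight m T A B)).sum / L.length)
  exact h7.comp (h6.const_add _)

end WeakLimits

/-! ### Growth of the heights. -/

section Heights

variable {X : Type*} [MeasurableSpace X] {m : Measure X} {T : X ≃ᵐ X} {h₀ : ℕ} {r : ℕ → ℕ}
  {s : ℕ → ℕ → ℕ} {E : ℕ → Set X}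

namespace IsRankOneConstruction

theorem strictMono_height (hC : IsRankOneConstruction m T h₀ r s E) :
    StrictMono (height h₀ r s) := by
  have hpos : ∀ j, 1 ≤ height h₀ r s j ∧ height h₀ r s j < height h₀ r s (j + 1) := by
    intro j
    have h : 1 ≤ height h₀ r s j := by
      induction j with
      | zero => exact hC.height_pos
      | succ j ih =>
        have := hC.two_le_columns j
        exact (Nat.mul_pos ih (by omega)).trans_le (Nat.le_add_right _ _)
    refine ⟨h, ?_⟩
    have := hC.two_le_columns j
    exact (lt_mul_of_one_lt_right h (by omega)).trans_le (Nat.le_add_right _ _)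
  exact strictMono_nat_of_lt_succ fun j => (hpos j).2

theorem height_pos_all (hC : IsRankOneConstruction m T h₀ r s E) (j : ℕ) :
    0 < height h₀ r s j :=
  lt_of_lt_of_le hC.height_pos (hC.strictMono_height.monotone (Nat.zero_le j))

theorem floorUnion_base (hC : IsRankOneConstruction m T h₀ r s E) (j : ℕ) :
    IsFloorUnion T h₀ r s E j (E j) :=
  ⟨{0}, by simpa using hC.height_pos_all j, by simp [iter_zero_image]⟩

end IsRankOneConstruction

end Heights

/-! ### Simple and singular spectrum of the suspension. -/

section SpectrumOfSuspension

/-- The pattern with `N` spacers of each size in `F` and `N + 1` high spacers. -/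
def uniformPattern (F : Finset ℕ) (N : ℕ) : List (Option ℕ) :=
  F.toList.flatMap (fun o => List.replicate N (some o)) ++ List.replicate (N + 1) none

theorem uniformPattern_ne_nil (F : Finset ℕ) (N : ℕ) : uniformPattern F N ≠ [] := by
  simp [uniformPattern, List.replicate_succ]

theorem length_uniformPattern (F : Finset ℕ) (N : ℕ) :
    (uniformPattern F N).length = F.card * N + (N + 1) := by
  simp [uniformPattern, List.length_flatMap]

theorem mem_of_some_mem_uniformPattern {F : Finset ℕ} {N o : ℕ}
    (h : some o ∈ uniformPattern F N) : o ∈ F := by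
  simp only [uniformPattern, List.mem_append, List.mem_flatMap, Finset.mem_toList,
    List.mem_replicate, Option.some.injEq, reduceCtorEq, and_false, or_false] at h
  obtain ⟨a, ha, -, rfl⟩ := h
  exact ha

theorem sum_map_uniformPattern (F : Finset ℕ) (N : ℕ) {w : Option ℕ → ℝ} (hw : w none = 0) :
    ((uniformPattern F N).map w).sum = N * ∑ o ∈ F, w (some o) := by
  have h : ∀ l : List ℕ, ((l.flatMap fun o => List.replicate N (some o)).map w).sum =
      N * (l.map fun o => w (some o)).sum := by
    intro l
    induction l with
    | nil => simp
    | cons a l ih => simp [List.flatMap_cons, ih, mul_add]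
  rw [uniformPattern, List.map_append, List.sum_append, h, Finset.sum_map_toList]
  simp [hw]

variable {X : Type*} [MeasurableSpace X] {m : Measure X} {P : Measure (Configuration X)}
  {T : X ≃ᵐ X} {h₀ : ℕ} {r : ℕ → ℕ} {s : ℕ → ℕ → ℕ} {E : ℕ → Set X}
  [MeasurableSpace.CountablyGenerated X] [MeasurableSpace.SeparatesPoints X]
  [SigmaFinite m] [NullSingletonClass m]

/-- If every pattern occurs infinitely often and `g` is asymptotically orthogonal to the
images of `void A` at the heights of the towers, then `g` is orthogonal to the void events of
unions of disjoint images of `A`. -/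
theorem inner_voidLp_eq_zero_of_tendsto (hC : IsRankOneConstruction m T h₀ r s E)
    (hP : HasVoidProbabilities m P) [IsProbabilityMeasure P]
    (hS : MeasurePreserving (poissonSuspension T) P P)
    (hpat : ∀ L : List (Option ℕ), L ≠ [] → ∃ᶠ j in atTop, FollowsPattern h₀ r s j L)
    {J : ℕ} {A : Set X} (hA : MeasurableSet A) (hAJ : IsFloorUnion T h₀ r s E J A) {F : Finset ℕ}
    (hFA : ∀ o ∈ F, IsFloorUnion T h₀ r s E J (iter T o '' A))
    (hF : (F : Set ℕ).PairwiseDisjoint fun o => iter T o '' A)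
    (hA' : MeasurableSet (⋃ o ∈ F, iter T o '' A)) {g : Lp ℂ 2 P}
    (hg : Tendsto (fun j => inner ℂ g ((koopman hS ^ (height h₀ r s j : ℤ)) (voidLp P hA)))
      atTop (𝓝 0)) :
    inner ℂ (voidLp P hA') g = 0 := by
  have hAm := hC.measure_floorUnion_lt_top hAJ
  have him : ∀ o : ℕ, MeasurableSet (iter T o '' A) := fun o => measurableSet_iter_image T _ hA
  have himf : ∀ o : ℕ, m (iter T o '' A) < ∞ := fun o => by
    rwa [measure_iter_image hC.measurePreserving _ hA]
  have hA'm : m (⋃ o ∈ F, iter T o '' A) < ∞ :=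
    measure_biUnion_lt_top F.finite_toSet fun o _ => himf o
  set c : ℝ := (F.card : ℝ) with hc
  have hc0 : 0 ≤ c := Nat.cast_nonneg _
  -- With `n + 1` copies of each shift, a shift has frequency `1 - z n` in the pattern. The one
  -- extra high spacer makes `z n` depend on `n`, so these values accumulate at `c / (c + 1) < 1`
  -- without attaining it.
  set z : ℕ → ℝ := fun n => (c * (n + 1) + 1) / (c * (n + 1) + (n + 1) + 1) with hzdef
  have hz : ∀ n, z n ∈ Ico (0 : ℝ) 1 := fun n => by
    have : (0 : ℝ) ≤ n := Nat.cast_nonneg _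
    refine ⟨by simp only [hzdef]; positivity, ?_⟩
    simp only [hzdef]
    rw [div_lt_one (by positivity)]
    linarith
  have hzero : ∀ n, inner ℂ (genLp P hA' (hz n)) g = 0 := by
    intro n
    have hn : (0 : ℝ) ≤ n := Nat.cast_nonneg _
    have h1 := tendsto_inner_koopman_height hC hP hS (uniformPattern_ne_nil F (n + 1)) hA hAJ
      (fun o ho => hFA o (mem_of_some_mem_uniformPattern ho)) hA' hA'm (hz n) (fun B hB hBm => by
        rw [sum_map_uniformPattern _ _ rfl, length_uniformPattern]
        have h2 : m.real ((⋃ o ∈ F, iter T o '' A) ∩ B) =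
            ∑ o ∈ F, entryWeight m T A B (some o) := by
          rw [iUnion₂_inter]
          exact measureReal_biUnion_finset
            (hF.mono_on fun o _ => inter_subset_left) (fun o _ => (him o).inter hB)
            (fun o _ => ((measure_mono inter_subset_left).trans_lt (himf o)).ne)
        rw [h2]
        have h3 : (1 - z n) = (n + 1) / (c * (n + 1) + (n + 1) + 1) := by
          simp only [hzdef]
          field_simp
          ring
        rw [h3]
        push_cast
        rw [← hc]
        field_simp
        ring) g
    have : NeBot (atTop ⊓ 𝓟 {j | FollowsPattern h₀ r s j (uniformPattern F (n + 1))}) :=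
      frequently_iff_neBot.1 (hpat _ (uniformPattern_ne_nil F (n + 1)))
    have h4 := tendsto_nhds_unique (hg.mono_left inf_le_left) h1
    rw [inner_smul_right] at h4
    rcases mul_eq_zero.1 h4.symm with h5 | h5
    · exact absurd h5 (by exact_mod_cast (Real.exp_pos _).ne')
    · exact inner_eq_zero_symm.1 h5
  have hdiff : ∀ n : ℕ, z n = c / (c + 1) + (1 / ((n : ℝ) + 1)) *
      (1 / ((c + 1) * (c + 1 + 1 / (n + 1)))) := fun n => by
    have hn : (0 : ℝ) ≤ n := Nat.cast_nonneg _
    simp only [hzdef]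
    field_simp
    ring
  have hlim : Tendsto z atTop (𝓝 (c / (c + 1))) := by
    have h1 : Tendsto (fun n : ℕ => 1 / ((n : ℝ) + 1)) atTop (𝓝 0) :=
      tendsto_one_div_add_atTop_nhds_zero_nat
    have h2 : Tendsto (fun n : ℕ => c / (c + 1) + (1 / ((n : ℝ) + 1)) *
        (1 / ((c + 1) * (c + 1 + 1 / (n + 1))))) atTop
        (𝓝 (c / (c + 1) + 0 * (1 / ((c + 1) * (c + 1 + 0))))) := by
      refine Tendsto.add tendsto_const_nhds (h1.mul ?_)
      refine Tendsto.div tendsto_const_nhds (Tendsto.mul tendsto_const_nhds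
        (tendsto_const_nhds.add h1)) (by positivity)
    simp only [zero_mul, add_zero] at h2
    exact h2.congr fun n => (hdiff n).symm
  refine inner_voidLp_eq_zero_of_frequently hA' (z₀ := c / (c + 1)) ?_ ?_
  · rw [abs_of_nonneg (by positivity), div_lt_one (by positivity)]; linarith
  · refine Tendsto.frequently (f := z) (l₁ := atTop) ?_
      (Eventually.frequently (Eventually.of_forall fun n => ⟨hz n, hzero n⟩))
    refine tendsto_nhdsWithin_iff.2 ⟨hlim, Eventually.of_forall fun n => ?_⟩
    have hn : (0 : ℝ) ≤ n := Nat.cast_nonneg _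
    have : 0 < (1 / ((n : ℝ) + 1)) * (1 / ((c + 1) * (c + 1 + 1 / (n + 1)))) := by positivity
    change z n ≠ c / (c + 1)
    rw [hdiff n]
    linarith

namespace IsRankOneConstruction

/-- The floors are disjoint translates of the base. A vector orthogonal to the orbit of the void
indicator of the base is orthogonal to every void indicator of a union of floors, so the latter lies
in the double orthogonal complement of the cyclic space. -/
theorem voidLp_mem_cyclic (hC : IsRankOneConstruction m T h₀ r s E)
    (hP : HasVoidProbabilities m P) [IsProbabilityMeasure P]
    (hS : MeasurePreserving (poissonSuspension T) P P)
    (hpat : ∀ L : List (Option ℕ), L ≠ [] → ∃ᶠ j in atTop, FollowsPattern h₀ r s j L)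
    {J : ℕ} {B : Set X} (hB : MeasurableSet B) (hBJ : IsFloorUnion T h₀ r s E J B) :
    voidLp P hB ∈ cyclic (koopman hS) (voidLp P (hC.measurableSet_base J)) := by
  obtain ⟨F, hF, rfl⟩ := hBJ
  have h1 : cyclic (koopman hS) (voidLp P (hC.measurableSet_base J)) =
      (cyclic (koopman hS) (voidLp P (hC.measurableSet_base J)))ᗮᗮ := by
    rw [Submodule.orthogonal_orthogonal_eq_closure]
    exact ((isClosed_cyclic _ _).submodule_topologicalClosure_eq).symm
  rw [h1, Submodule.mem_orthogonal]
  intro g hg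
  rw [inner_eq_zero_symm]
  refine inner_voidLp_eq_zero_of_tendsto hC hP hS hpat (hC.measurableSet_base J)
    (hC.floorUnion_base J) (fun o ho => ⟨{o}, by simpa using hF ho, by simp⟩)
    (fun a ha b hb hab => hC.disjoint_floors J a (Finset.mem_range.1 (hF ha)) b
      (Finset.mem_range.1 (hF hb)) hab) hB ?_
  refine tendsto_const_nhds.congr fun j => ?_
  exact (inner_eq_zero_symm.1 (hg _ (zpow_mem_cyclic _ _ _))).symm

/-- A union of floors of one stage is a union of floors of all later stages. So each void indicator
of a countable total family is eventually in the cyclic space of the base. -/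
theorem hasSimpleSpectrum (hC : IsRankOneConstruction m T h₀ r s E)
    (hP : HasVoidProbabilities m P) [IsProbabilityMeasure P]
    (hS : MeasurePreserving (poissonSuspension T) P P)
    (hpat : ∀ L : List (Option ℕ), L ≠ [] → ∃ᶠ j in atTop, FollowsPattern h₀ r s j L) :
    HasSimpleSpectrum (koopman hS) := by
  have hcount : (floorVoids P T h₀ r s E).Countable := by
    refine (countable_range fun q : ℕ × Finset ℕ => voidLp P
      (Finset.measurableSet_biUnion q.2 fun a _ => measurableSet_iter_image T (a : ℤ)
        (hC.measurableSet_base q.1))).mono ?_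
    rintro _ ⟨j, _, hB, ⟨F, hF, rfl⟩, rfl⟩
    exact ⟨(j, F), rfl⟩
  have hne : (floorVoids P T h₀ r s E).Nonempty :=
    ⟨_, 0, E 0, hC.measurableSet_base 0, hC.floorUnion_base 0, rfl⟩
  obtain ⟨f, hf⟩ := hcount.exists_eq_range hne
  refine hasSimpleSpectrum_of_eventually_mem_cyclic (koopman hS) f
    (fun j => voidLp P (hC.measurableSet_base j)) (by rw [← hf]; exact span_floorVoids hC hP)
    fun i => ?_
  have hi : f i ∈ floorVoids P T h₀ r s E := hf ▸ mem_range_self i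
  obtain ⟨J, B, hB, hBJ, hfi⟩ := hi
  filter_upwards [eventually_ge_atTop J] with j hj
  rw [hfi]
  exact hC.voidLp_mem_cyclic hP hS hpat hB (hC.floorUnion_mono hj hBJ)

/-- Here the only shift is `0`: vanishing correlations make `g` orthogonal to the void indicator of
every union of floors, and these are total. -/
theorem hasSingularSpectrum (hC : IsRankOneConstruction m T h₀ r s E)
    (hP : HasVoidProbabilities m P) [IsProbabilityMeasure P]
    (hS : MeasurePreserving (poissonSuspension T) P P)
    (hpat : ∀ L : List (Option ℕ), L ≠ [] → ∃ᶠ j in atTop, FollowsPattern h₀ r s j L) :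
    HasSingularSpectrum (koopman hS) := by
  refine hasSingularSpectrum_of_forall_eq_zero _ fun g hg => ?_
  have hinj : Tendsto (fun j => -(height h₀ r s j : ℤ)) atTop cofinite := by
    rw [← Nat.cofinite_eq_atTop]
    refine Function.Injective.tendsto_cofinite fun a b hab => ?_
    exact hC.strictMono_height.injective (by simpa using hab)
  have hort : ∀ v ∈ floorVoids P T h₀ r s E, inner ℂ v g = 0 := by
    rintro _ ⟨J, B, hB, hBJ, rfl⟩
    have hset : (⋃ o ∈ ({0} : Finset ℕ), iter T o '' B) = B := by simp [iter_zero_image]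
    have h1 := inner_voidLp_eq_zero_of_tendsto hC hP hS hpat hB hBJ (F := {0})
      (fun o ho => by
        rw [Finset.mem_singleton.1 ho, Nat.cast_zero, iter_zero_image]; exact hBJ)
      (by simp) (by rw [hset]; exact hB) (g := g) ?_
    · rwa [voidLp_congr _ hB hset] at h1
    · have h2 := ((hg (voidLp P hB)).comp hinj)
      have h3 := (Complex.continuous_conj.tendsto _).comp h2
      rw [map_zero] at h3
      refine h3.congr fun j => ?_
      simp only [Function.comp_apply]
      rw [inner_conj_symm, ← LinearIsometryEquiv.inner_map_map
        (koopman hS ^ (height h₀ r s j : ℤ))]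
      congr 1
      change (koopman hS ^ (height h₀ r s j : ℤ) * koopman hS ^ (-(height h₀ r s j : ℤ))) g = g
      rw [← zpow_add, add_neg_cancel, zpow_zero]; rfl
  have hmem : g ∈ (Submodule.span ℂ (floorVoids P T h₀ r s E))ᗮ := by
    rw [Submodule.mem_orthogonal]
    intro u hu
    induction hu using Submodule.span_induction with
    | mem x hx => exact hort x hx
    | zero => exact inner_zero_left _
    | add x y _ _ hx hy => rw [inner_add_left, hx, hy, add_zero]
    | smul a x _ hx => rw [inner_smul_left, hx, mul_zero]
  rw [← Submodule.orthogonal_closure, span_floorVoids hC hP, Submodule.top_orthogonal_eq_bot] at hmem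
  exact hmem

end IsRankOneConstruction

end SpectrumOfSuspension

/-! ### Extending partial matchings of finite sets. -/

section Extension

/-- The assignment `a i ↦ b i` is a well-defined injection on part of `t`, and sets of equal size
leave room to complete it. -/
theorem exists_equiv_of_injOn {ι α β : Type*} [DecidableEq α] [DecidableEq β] {t : Finset α}
    {t' : Finset β} (hcard : t.card = t'.card) {S : Set ι} {a : ι → α} {b : ι → β} (ha : InjOn a S)
    (hb : InjOn b S) (hat : MapsTo a S t) (hbt : MapsTo b S t') :
    ∃ g : {x // x ∈ t} ≃ {y // y ∈ t'}, ∀ i (hi : i ∈ S), (g ⟨a i, hat hi⟩ : β) = b i := by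
  classical
  rcases S.eq_empty_or_nonempty with rfl | ⟨i₀, hi₀⟩
  · exact ⟨Finset.equivOfCardEq hcard, fun i hi => hi.elim⟩
  have : Nonempty ι := ⟨i₀⟩
  have hinv : ∀ i ∈ S, Function.invFunOn a S (a i) = i := fun i hi =>
    ha.leftInvOn_invFunOn hi
  obtain ⟨g, hg⟩ := Finset.exists_equiv_extend_of_card_eq (α := {x // x ∈ t}) (t := t')
    (by simpa using hcard) (s := Finset.univ.filter fun x => x.1 ∈ a '' S)
    (f := fun x => b (Function.invFunOn a S x.1))
    (by
      intro y hy
      obtain ⟨x, hx, rfl⟩ := Finset.mem_image.1 hy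
      obtain ⟨i, hi, hix⟩ := (Finset.mem_filter.1 hx).2
      rw [← hix, hinv i hi]
      exact hbt hi)
    (by
      intro x hx y hy hxy
      obtain ⟨i, hi, hix⟩ := (Finset.mem_filter.1 hx).2
      obtain ⟨k, hk, hky⟩ := (Finset.mem_filter.1 hy).2
      have hxy' : b (Function.invFunOn a S x.1) = b (Function.invFunOn a S y.1) := hxy
      rw [← hix, ← hky, hinv i hi, hinv k hk] at hxy'
      exact Subtype.ext (by rw [← hix, ← hky, hb hi hk hxy']))
  refine ⟨g, fun i hi => ?_⟩
  rw [hg _ (Finset.mem_filter.2 ⟨Finset.mem_univ _, i, hi, rfl⟩), hinv i hi]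

theorem exists_bijOn_of_injOn {ι α β : Type*} [Nonempty β] {t : Finset α}
    {t' : Finset β} (hcard : t.card = t'.card) {S : Set ι} {a : ι → α} {b : ι → β} (ha : InjOn a S)
    (hb : InjOn b S) (hat : MapsTo a S t) (hbt : MapsTo b S t') :
    ∃ f : α → β, BijOn f t t' ∧ ∀ i ∈ S, f (a i) = b i := by
  classical
  obtain ⟨g, hg⟩ := exists_equiv_of_injOn hcard ha hb hat hbt
  have hf : ∀ x (hx : x ∈ t),
      (fun x => if h : x ∈ t then (g ⟨x, h⟩ : β) else Classical.arbitrary β) x = g ⟨x, hx⟩ :=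
    fun x hx => dif_pos hx
  refine ⟨fun x => if h : x ∈ t then (g ⟨x, h⟩ : β) else Classical.arbitrary β, ⟨?_, ?_, ?_⟩, ?_⟩
  · intro x hx
    rw [hf x hx]; exact (g _).2
  · intro x hx y hy hxy
    rw [hf x hx, hf y hy] at hxy
    exact congrArg Subtype.val (g.injective (Subtype.ext hxy))
  · intro y hy
    refine ⟨g.symm ⟨y, hy⟩, (g.symm ⟨y, hy⟩).2, ?_⟩
    rw [hf _ (g.symm ⟨y, hy⟩).2]; simp
  · intro i hi
    rw [hf _ (hat hi), hg i hi]

theorem exists_perm_of_injOn {ι α : Type*} {t : Finset α} {S : Set ι} {a b : ι → α}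
    (ha : InjOn a S) (hb : InjOn b S) (hat : MapsTo a S t) (hbt : MapsTo b S t) :
    ∃ σ : Equiv.Perm α, (∀ x ∉ t, σ x = x) ∧ ∀ i ∈ S, σ (a i) = b i := by
  classical
  obtain ⟨g, hg⟩ := exists_equiv_of_injOn rfl ha hb hat hbt
  refine ⟨Equiv.Perm.ofSubtype (p := fun x => x ∈ t) g,
    fun x hx => Equiv.Perm.ofSubtype_apply_of_not_mem _ hx, fun i hi => ?_⟩
  rw [← hg i hi]
  exact Equiv.Perm.ofSubtype_apply_of_mem _ (hat hi)

end Extension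

/-! ### Laying the towers out on the line. -/

section Layout

/-- The number of pieces into which a floor of the initial tower is cut at stage `j`. -/
def pieces (r : ℕ → ℕ) (j : ℕ) : ℕ := ∏ i ∈ Finset.range j, r i

theorem pieces_succ (r : ℕ → ℕ) (j : ℕ) : pieces r (j + 1) = pieces r j * r j :=
  Finset.prod_range_succ _ _

/-- The towers can be laid out on the line: the floors of stage `j` are the cells
`(k / R, (k + 1) / R]`, `R = pieces r j`, in `(-M j, M j]`, in the order given by `π j`. -/
structure IsLayout (h₀ : ℕ) (r : ℕ → ℕ) (s : ℕ → ℕ → ℕ) (M : ℕ → ℕ) (π : ℕ → ℕ → ℤ) : Prop where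
  height_pos : 1 ≤ h₀
  two_le_columns : ∀ j, 2 ≤ r j
  last_spacer : ∀ j, height h₀ r s j ≤ s j (r j - 1)
  le_extent : ∀ j, j ≤ M j
  bijOn : ∀ j, BijOn (π j) (Finset.range (height h₀ r s j))
    (Finset.Ico (-(M j * pieces r j : ℤ)) (M j * pieces r j))
  column : ∀ j, ∀ i < r j, ∀ u < height h₀ r s j,
    π (j + 1) (columnStart h₀ r s j i + u) = r j * π j u + i

theorem exists_isLayout {h₀ : ℕ} {r : ℕ → ℕ} {s : ℕ → ℕ → ℕ} {M : ℕ → ℕ} (hh : 1 ≤ h₀)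
    (hr : ∀ j, 2 ≤ r j) (hs : ∀ j, height h₀ r s j ≤ s j (r j - 1)) (hM : ∀ j, j ≤ M j)
    (hmono : Monotone M) (hheight : ∀ j, height h₀ r s j = 2 * M j * pieces r j) :
    ∃ π, IsLayout h₀ r s M π := by
  let B : ℕ → (ℕ → ℤ) → Prop := fun j π => BijOn π (Finset.range (height h₀ r s j))
    (Finset.Ico (-(M j * pieces r j : ℤ)) (M j * pieces r j))
  have hcard : ∀ j, (Finset.range (height h₀ r s j)).card =
      (Finset.Ico (-(M j * pieces r j : ℤ)) (M j * pieces r j)).card := fun j => by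
    rw [Finset.card_range, Int.card_Ico, hheight j]
    have : ((M j * pieces r j : ℕ) : ℤ) = (M j * pieces r j : ℤ) := by push_cast; ring
    rw [← this]
    have h2 : 2 * M j * pieces r j = 2 * (M j * pieces r j) := by ring
    omega
  have h0 : ∃ π, B 0 π := by
    obtain ⟨f, hf, -⟩ := exists_bijOn_of_injOn (ι := ℕ) (hcard 0) (S := ∅) (a := id)
      (b := fun n => (n : ℤ)) (injOn_empty _) (injOn_empty _) (mapsTo_empty _ _) (mapsTo_empty _ _)
    exact ⟨f, hf⟩
  -- The column condition prescribes `π'` outside the spacers: the columns of a floor are its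
  -- consecutive subcells. The spacers take the remaining cells in any order; the numbers agree
  -- because the height equals the number of cells.
  have hstep : ∀ j π, B j π → ∃ π', B (j + 1) π' ∧ ∀ i < r j, ∀ u < height h₀ r s j,
      π' (columnStart h₀ r s j i + u) = r j * π u + i := by
    intro j π hπ
    have hrj : (0 : ℤ) < r j := by have := hr j; omega
    obtain ⟨f, hf, hf'⟩ := exists_bijOn_of_injOn (hcard (j + 1))
      (S := {q : ℕ × ℕ | q.1 < r j ∧ q.2 < height h₀ r s j})
      (a := fun q => columnStart h₀ r s j q.1 + q.2) (b := fun q => r j * π q.2 + q.1)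
      (by
        rintro ⟨i, u⟩ ⟨hi, hu⟩ ⟨k, v⟩ ⟨hk, hv⟩ h
        obtain ⟨rfl, rfl⟩ := columnStart_add_inj hu hv h
        rfl)
      (by
        rintro ⟨i, u⟩ ⟨hi, hu⟩ ⟨k, v⟩ ⟨hk, hv⟩ h
        simp only at hi hu hk hv h
        have h1 : (r j * π u + i) / (r j : ℤ) = π u := by
          rw [add_comm, Int.add_mul_ediv_left _ _ hrj.ne',
            Int.ediv_eq_zero_of_lt (by omega) (by omega), zero_add]
        have h2 : (r j * π v + k) / (r j : ℤ) = π v := by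
          rw [add_comm, Int.add_mul_ediv_left _ _ hrj.ne',
            Int.ediv_eq_zero_of_lt (by omega) (by omega), zero_add]
        rw [h, h2] at h1
        have huv := hπ.injOn (Finset.mem_coe.2 (Finset.mem_range.2 hu))
          (Finset.mem_coe.2 (Finset.mem_range.2 hv)) h1.symm
        subst huv
        have : i = k := by omega
        rw [this])
      (by
        rintro ⟨i, u⟩ ⟨hi, hu⟩
        exact Finset.mem_coe.2 (Finset.mem_range.2 (columnStart_add_lt hi hu)))
      (by
        rintro ⟨i, u⟩ ⟨hi, hu⟩
        simp only at hi hu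
        have h1 := Finset.mem_Ico.1 (Finset.mem_coe.1
          (hπ.mapsTo (Finset.mem_coe.2 (Finset.mem_range.2 hu))))
        refine Finset.mem_coe.2 (Finset.mem_Ico.2 ?_)
        rw [pieces_succ]
        have h2 : (M j : ℤ) ≤ M (j + 1) := by exact_mod_cast hmono (Nat.le_succ j)
        have h3 : (0 : ℤ) ≤ pieces r j := by positivity
        have h4 : (M j : ℤ) * pieces r j * r j ≤ M (j + 1) * (pieces r j * r j) := by
          rw [← mul_assoc]; gcongr
        push_cast
        constructor
        · nlinarith
        · have h5 : (r j : ℤ) * (π u + 1) ≤ r j * (M j * pieces r j) := by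
            apply mul_le_mul_of_nonneg_left _ hrj.le; linarith
          have h6 : (i : ℤ) < r j := by exact_mod_cast hi
          nlinarith)
    exact ⟨f, hf, fun i hi u hu => hf' (i, u) ⟨hi, hu⟩⟩
  choose! next hnext using hstep
  let π : ∀ j, {f : ℕ → ℤ // B j f} := fun j => Nat.rec ⟨h0.choose, h0.choose_spec⟩
    (fun j f => ⟨next j f.1, (hnext j f.1 f.2).1⟩) j
  exact ⟨fun j => (π j).1, hh, hr, hs, hM, fun j => (π j).2,
    fun j => (hnext j (π j).1 (π j).2).2⟩

/-- The index of the cell of length `1 / R` that contains `x`. -/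
def cellIndex (R : ℕ) (x : ℝ) : ℤ := ⌈x * R⌉ - 1

theorem cellIndex_eq_iff {R : ℕ} {x : ℝ} {k : ℤ} :
    cellIndex R x = k ↔ (k : ℝ) < x * R ∧ x * R ≤ k + 1 := by
  rw [cellIndex, sub_eq_iff_eq_add, Int.ceil_eq_iff]
  push_cast
  rw [add_sub_cancel_right]

/-- Each cell is cut into `r` consecutive subcells, so division with remainder by `r` gives the old
cell and the column. -/
theorem cellIndex_ediv {R r : ℕ} (hr : 0 < r) (x : ℝ) :
    cellIndex (R * r) x / r = cellIndex R x := by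
  set k := cellIndex (R * r) x with hk
  obtain ⟨h1, h2⟩ := cellIndex_eq_iff.1 hk.symm
  symm
  rw [cellIndex_eq_iff]
  have hr' : (0 : ℝ) < r := by exact_mod_cast hr
  have h3 : ((k / r : ℤ) : ℝ) * r ≤ k := by
    exact_mod_cast Int.ediv_mul_le k (by omega : (r : ℤ) ≠ 0)
  have h4 : (k : ℝ) + 1 ≤ (((k / r : ℤ) : ℝ) + 1) * r := by
    have := Int.lt_ediv_add_one_mul_self k (by omega : (0 : ℤ) < r)
    exact_mod_cast this
  push_cast at h1 h2
  constructor
  · by_contra! h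
    nlinarith
  · by_contra! h
    nlinarith

variable {h₀ : ℕ} {r : ℕ → ℕ} {s : ℕ → ℕ → ℕ} {M : ℕ → ℕ} {π : ℕ → ℕ → ℤ}

/-- The point `x` lies on the floor `u` of stage `j`. -/
def IsAt (h₀ : ℕ) (r : ℕ → ℕ) (s : ℕ → ℕ → ℕ) (π : ℕ → ℕ → ℤ) (j : ℕ) (x : ℝ) (u : ℕ) : Prop :=
  u < height h₀ r s j ∧ cellIndex (pieces r j) x = π j u

/-- The points `x` and `y` lie on the same vertical line of the tower of stage `j`, with `y`
being `n` floors above `x`. -/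
def IsAbove (h₀ : ℕ) (r : ℕ → ℕ) (s : ℕ → ℕ → ℕ) (π : ℕ → ℕ → ℤ) (n : ℤ) (j : ℕ) (x y : ℝ) :
    Prop :=
  ∃ u v : ℕ, IsAt h₀ r s π j x u ∧ v < height h₀ r s j ∧ (v : ℤ) = u + n ∧
    y = x + (π j v - π j u) / pieces r j

namespace IsLayout

theorem columns_pos (hL : IsLayout h₀ r s M π)
    (j : ℕ) : 0 < r j := by have := hL.two_le_columns j; omega

theorem pieces_pos (hL : IsLayout h₀ r s M π)
    (j : ℕ) : 0 < pieces r j := Finset.prod_pos fun i _ => hL.columns_pos i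

theorem lt_pieces (hL : IsLayout h₀ r s M π) (j : ℕ) : j < pieces r j := by
  induction j with
  | zero => exact hL.pieces_pos 0
  | succ j ih =>
    have := hL.two_le_columns j
    rw [pieces_succ]
    nlinarith

theorem lt_height (hL : IsLayout h₀ r s M π) (j : ℕ) : j < height h₀ r s j := by
  induction j with
  | zero => exact hL.height_pos
  | succ j ih =>
    have h1 := hL.two_le_columns j
    have h2 : height h₀ r s j * 2 ≤ height h₀ r s j * r j := Nat.mul_le_mul_left _ h1
    have h3 : height h₀ r s j * r j ≤ height h₀ r s (j + 1) := Nat.le_add_right _ _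
    omega

theorem isAt_unique (hL : IsLayout h₀ r s M π) {j : ℕ} {x : ℝ} {u v : ℕ} (hu : IsAt h₀ r s π j x u)
    (hv : IsAt h₀ r s π j x v) : u = v :=
  (hL.bijOn j).injOn (Finset.mem_coe.2 (Finset.mem_range.2 hu.1))
    (Finset.mem_coe.2 (Finset.mem_range.2 hv.1)) (hu.2.symm.trans hv.2)

theorem exists_isAt_succ (hL : IsLayout h₀ r s M π)
    {j : ℕ} {x : ℝ} {u : ℕ} (hu : IsAt h₀ r s π j x u) :
    ∃ i < r j, IsAt h₀ r s π (j + 1) x (columnStart h₀ r s j i + u) := by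
  have hr := hL.columns_pos j
  have h1 := cellIndex_ediv (R := pieces r j) hr x
  have h2 := Int.emod_nonneg (cellIndex (pieces r j * r j) x) (by omega : (r j : ℤ) ≠ 0)
  have h3 := Int.emod_lt_of_pos (cellIndex (pieces r j * r j) x) (by omega : (0 : ℤ) < r j)
  have h4 := Int.mul_ediv_add_emod (cellIndex (pieces r j * r j) x) (r j)
  refine ⟨(cellIndex (pieces r j * r j) x % r j).toNat, by omega, columnStart_add_lt (by omega) hu.1, ?_⟩
  rw [hL.column j _ (by omega) u hu.1, pieces_succ, Int.toNat_of_nonneg h2, ← hu.2, ← h1, h4]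

theorem isAt_of_succ (hL : IsLayout h₀ r s M π)
    {j i : ℕ} {x : ℝ} {u : ℕ} (hi : i < r j) (hu : u < height h₀ r s j)
    (h : IsAt h₀ r s π (j + 1) x (columnStart h₀ r s j i + u)) : IsAt h₀ r s π j x u := by
  refine ⟨hu, ?_⟩
  have hr := hL.columns_pos j
  rw [← cellIndex_ediv (R := pieces r j) hr x, ← pieces_succ, h.2, hL.column j i hi u hu, add_comm,
    Int.add_mul_ediv_left _ _ (by omega), Int.ediv_eq_zero_of_lt (by omega) (by omega), zero_add]

theorem isAt_translate (hL : IsLayout h₀ r s M π)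
    {j : ℕ} {x : ℝ} {u v : ℕ} (hu : IsAt h₀ r s π j x u)
    (hv : v < height h₀ r s j) :
    IsAt h₀ r s π j (x + (π j v - π j u) / pieces r j) v := by
  refine ⟨hv, ?_⟩
  have hR : (pieces r j : ℝ) ≠ 0 := by exact_mod_cast (hL.pieces_pos j).ne'
  have h : (x + (π j v - π j u) / pieces r j) * pieces r j =
      x * pieces r j + ((π j v - π j u : ℤ) : ℝ) := by
    push_cast; field_simp
  have h2 := hu.2
  rw [cellIndex] at h2 ⊢
  rw [h, Int.ceil_add_intCast]
  omega

theorem isAbove_succ (hL : IsLayout h₀ r s M π)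
    {n : ℤ} {j : ℕ} {x y : ℝ} (h : IsAbove h₀ r s π n j x y) :
    IsAbove h₀ r s π n (j + 1) x y := by
  obtain ⟨u, v, hu, hv, hn, rfl⟩ := h
  obtain ⟨i, hi, hui⟩ := hL.exists_isAt_succ hu
  refine ⟨_, columnStart h₀ r s j i + v, hui, columnStart_add_lt hi hv, by push_cast; omega, ?_⟩
  have hR : (pieces r j : ℝ) ≠ 0 := by exact_mod_cast (hL.pieces_pos j).ne'
  have hr : (r j : ℝ) ≠ 0 := by exact_mod_cast (hL.columns_pos j).ne'
  rw [hL.column j i hi v hv, hL.column j i hi u hu.1, pieces_succ]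
  push_cast
  field_simp
  ring

theorem isAbove_mono (hL : IsLayout h₀ r s M π)
    {n : ℤ} {j k : ℕ} (hjk : j ≤ k) {x y : ℝ} (h : IsAbove h₀ r s π n j x y) :
    IsAbove h₀ r s π n k x y := by
  induction k, hjk using Nat.le_induction with
  | base => exact h
  | succ k _ ih => exact hL.isAbove_succ ih

theorem isAbove_unique (hL : IsLayout h₀ r s M π)
    {n : ℤ} {j k : ℕ} {x y z : ℝ} (hy : IsAbove h₀ r s π n j x y)
    (hz : IsAbove h₀ r s π n k x z) : y = z := by
  obtain ⟨u, v, hu, hv, hn, rfl⟩ := hL.isAbove_mono (le_max_left j k) hy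
  obtain ⟨u', v', hu', hv', hn', rfl⟩ := hL.isAbove_mono (le_max_right j k) hz
  obtain rfl := hL.isAt_unique hu hu'
  obtain rfl : v = v' := by omega
  rfl

theorem exists_isAt_of_abs_lt (hL : IsLayout h₀ r s M π)
    {j : ℕ} {x : ℝ} (hx : |x| < M j) : ∃ u, IsAt h₀ r s π j x u := by
  obtain ⟨hx1, hx2⟩ := abs_lt.1 hx
  have hR : (0 : ℝ) < pieces r j := by exact_mod_cast hL.pieces_pos j
  obtain ⟨u, hu, hux⟩ := (hL.bijOn j).surjOn (a := cellIndex (pieces r j) x) (by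
    refine Finset.mem_coe.2 (Finset.mem_Ico.2 ⟨?_, ?_⟩)
    · rw [cellIndex, le_sub_iff_add_le, ← Int.lt_iff_add_one_le, Int.lt_ceil]
      push_cast
      nlinarith
    · rw [cellIndex, Int.sub_one_lt_iff, Int.ceil_le]
      push_cast
      nlinarith)
  exact ⟨u, Finset.mem_range.1 (Finset.mem_coe.1 hu), hux.symm⟩

theorem exists_isAt (hL : IsLayout h₀ r s M π)
    (x : ℝ) : ∀ᶠ j in atTop, ∃ u, IsAt h₀ r s π j x u := by
  filter_upwards [eventually_gt_atTop ⌈|x|⌉₊] with j hj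
  exact hL.exists_isAt_of_abs_lt
    ((Nat.le_ceil _).trans_lt (by exact_mod_cast hj.trans_le (hL.le_extent j)))

/-- Otherwise the point always lies in the first column from some stage on, since any other column
raises its floor by at least the height. It is then the left endpoint of its shrinking cells, which
half-open cells exclude. -/
theorem exists_isAt_le (hL : IsLayout h₀ r s M π) (x : ℝ) (n : ℕ) :
    ∃ j u, n ≤ j ∧ IsAt h₀ r s π j x u ∧ n ≤ u := by
  by_contra! hcon
  obtain ⟨J, hJ⟩ := eventually_atTop.1 (hL.exists_isAt x)
  set K := max J n
  obtain ⟨u, hu⟩ := hJ K (le_max_left _ _)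
  have hconst : ∀ j, K ≤ j → IsAt h₀ r s π j x u ∧
      (π j u : ℝ) / pieces r j = π K u / pieces r K := by
    intro j hj
    induction j, hj using Nat.le_induction with
    | base => exact ⟨hu, rfl⟩
    | succ j hj ih =>
      obtain ⟨i, hi, hui⟩ := hL.exists_isAt_succ ih.1
      have hlt := hcon (j + 1) _ ((le_max_right J n).trans (hj.trans j.le_succ)) hui
      have hi0 : i = 0 := by
        by_contra hi0
        have h1 := columnStart_add_le (h₀ := h₀) (r := r) (s := s) (j := j) (Nat.pos_of_ne_zero hi0)
        have h2 := hL.lt_height j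
        have h3 : n ≤ K := le_max_right _ _
        omega
      subst hi0
      have hcol := hL.column j 0 hi u ih.1.1
      rw [columnStart_zero, zero_add] at hui hcol
      refine ⟨hui, ?_⟩
      have hR : (pieces r j : ℝ) ≠ 0 := by exact_mod_cast (hL.pieces_pos j).ne'
      have hr : (r j : ℝ) ≠ 0 := by exact_mod_cast (hL.columns_pos j).ne'
      rw [← ih.2, hcol, pieces_succ]
      push_cast
      field_simp
      ring
  have hle : ∀ j, K ≤ j → x - π K u / pieces r K ≤ 1 / (j + 1) := fun j hj => by
    obtain ⟨⟨-, h1⟩, h2⟩ := hconst j hj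
    have hR : (0 : ℝ) < pieces r j := by exact_mod_cast hL.pieces_pos j
    have h3 := (cellIndex_eq_iff.1 h1).2
    have h4 : ((j : ℝ) + 1) ≤ pieces r j := by exact_mod_cast hL.lt_pieces j
    calc x - π K u / pieces r K = (x * pieces r j - π j u) / pieces r j := by
          rw [← h2]; field_simp
      _ ≤ 1 / pieces r j := by gcongr; linarith
      _ ≤ 1 / (j + 1) := by gcongr
  have hpos : 0 < x - π K u / pieces r K := by
    have hR : (0 : ℝ) < pieces r K := by exact_mod_cast hL.pieces_pos K
    have h3 := (cellIndex_eq_iff.1 hu.2).1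
    rw [sub_pos, div_lt_iff₀ hR]; exact h3
  have h5 := ge_of_tendsto (tendsto_one_div_add_atTop_nhds_zero_nat (𝕜 := ℝ))
    (eventually_atTop.2 ⟨K, hle⟩)
  linarith

/-- Room below comes from `exists_isAt_le`, room above from the last spacers of the next stage.
Hence all powers, positive and negative, are defined at every point. -/
theorem exists_isAt_interior (hL : IsLayout h₀ r s M π) (x : ℝ) (n : ℕ) :
    ∃ j u, IsAt h₀ r s π j x u ∧ n ≤ u ∧ u + n < height h₀ r s j := by
  obtain ⟨j, u, hj, hu, hn⟩ := hL.exists_isAt_le x n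
  obtain ⟨i, hi, hui⟩ := hL.exists_isAt_succ hu
  refine ⟨j + 1, _, hui, by omega, ?_⟩
  have h1 := columnStart_add_le (h₀ := h₀) (r := r) (s := s) (j := j) (i := r j - 1) (k := r j)
    (by have := hL.columns_pos j; omega)
  rw [columnStart_columns] at h1
  have h2 := hL.last_spacer j
  have h3 := hL.lt_height j
  have h4 := monotone_columnStart (h₀ := h₀) (r := r) (s := s) j (show i ≤ r j - 1 by omega)
  have h5 := hu.1
  omega

theorem exists_isAbove (hL : IsLayout h₀ r s M π)
    (n : ℤ) (x : ℝ) : ∃ y j, IsAbove h₀ r s π n j x y := by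
  obtain ⟨j, u, hu, h1, h2⟩ := hL.exists_isAt_interior x n.natAbs
  exact ⟨_, j, u, (u + n).toNat, hu, by omega, by omega, rfl⟩

end IsLayout

end Layout

/-! ### Maps defined piecewise on a countable cover. -/

theorem measurable_of_iUnion_eq_univ {X Y ι : Type*} [MeasurableSpace X] [MeasurableSpace Y]
    [Countable ι] {e : X → Y} (C : ι → Set X) (hCu : ⋃ i, C i = univ)
    (hC : ∀ i, MeasurableSet (C i)) (f : ι → X → Y) (hf : ∀ i, Measurable (f i))
    (h : ∀ i, EqOn e (f i) (C i)) : Measurable e := by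
  intro A hA
  have hpre : e ⁻¹' A = ⋃ i, C i ∩ f i ⁻¹' A := by
    ext x
    simp only [mem_iUnion, mem_inter_iff, mem_preimage]
    constructor
    · intro hx
      obtain ⟨i, hi⟩ := mem_iUnion.1 (hCu.symm ▸ mem_univ x)
      exact ⟨i, hi, by rwa [← h i hi]⟩
    · rintro ⟨i, hi, hx⟩
      rwa [h i hi]
  rw [hpre]
  exact MeasurableSet.iUnion fun i => (hC i).inter (hf i hA)

/-- A bimeasurable map that agrees with measure preserving maps on the sets of a countable cover
is measure preserving. -/
theorem measurePreserving_of_iUnion_eq_univ {X ι : Type*} [MeasurableSpace X] [Countable ι]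
    {m : Measure X} (e : X ≃ᵐ X) (C : ι → Set X) (hCu : ⋃ i, C i = univ)
    (hC : ∀ i, MeasurableSet (C i)) (f : ι → X ≃ᵐ X) (hf : ∀ i, MeasurePreserving (f i) m m)
    (h : ∀ i, EqOn e (f i) (C i)) : MeasurePreserving e m m := by
  refine ⟨e.measurable, ?_⟩
  have hcov : ⋃ i, e '' C i = univ := by
    rw [← image_iUnion, hCu, image_univ, e.surjective.range_eq]
  refine (Measure.ext_iff_of_iUnion_eq_univ hcov).2 fun i => ?_
  have him : MeasurableSet (e '' C i) := e.measurableSet_image.2 (hC i)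
  ext A hA
  rw [Measure.restrict_apply hA, Measure.restrict_apply hA, Measure.map_apply e.measurable
    (hA.inter him)]
  have h1 : e ⁻¹' (A ∩ e '' C i) = f i ⁻¹' (A ∩ e '' C i) ∩ C i := by
    ext x
    constructor
    · rintro ⟨hxA, y, hy, hyx⟩
      obtain rfl := e.injective hyx
      exact ⟨by rw [mem_preimage, ← h i hy]; exact ⟨hxA, mem_image_of_mem _ hy⟩, hy⟩
    · rintro ⟨hx, hxC⟩
      rw [mem_preimage, ← h i hxC] at hx
      exact hx
  have h2 : f i ⁻¹' (A ∩ e '' C i) ∩ C i = f i ⁻¹' (A ∩ e '' C i) := by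
    refine inter_eq_left.2 ?_
    rintro x ⟨-, y, hy, hyx⟩
    rw [h i hy] at hyx
    obtain rfl := (f i).injective hyx
    exact hy
  rw [h1, h2, (hf i).measure_preimage (hA.inter him).nullMeasurableSet]

/-! ### The rank-one automorphism of a layout. -/

section Shift

variable {h₀ : ℕ} {r : ℕ → ℕ} {s : ℕ → ℕ → ℕ} {M : ℕ → ℕ} {π : ℕ → ℕ → ℤ}

theorem measurable_cellIndex (R : ℕ) : Measurable (cellIndex R) :=
  (Int.measurable_ceil.comp (measurable_id.mul_const _)).sub_const _

theorem measurableSet_isAt (j u : ℕ) : MeasurableSet {x | IsAt h₀ r s π j x u} :=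
  (MeasurableSet.const _).inter (measurable_cellIndex _ (measurableSet_singleton _))

/-- The cover of the line by the floors on which `shift n` is a translation. -/
def shiftDomain (h₀ : ℕ) (r : ℕ → ℕ) (s : ℕ → ℕ → ℕ) (π : ℕ → ℕ → ℤ) (n : ℤ) (q : ℕ × ℕ × ℕ) :
    Set ℝ :=
  {x | IsAt h₀ r s π q.1 x q.2.1 ∧ q.2.2 < height h₀ r s q.1 ∧ (q.2.2 : ℤ) = q.2.1 + n}

theorem measurableSet_shiftDomain (n : ℤ) (q : ℕ × ℕ × ℕ) :
    MeasurableSet (shiftDomain h₀ r s π n q) :=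
  (measurableSet_isAt _ _).inter (MeasurableSet.const _)

namespace IsLayout

/-- The point `n` floors above `x`. -/
def shift (hL : IsLayout h₀ r s M π) (n : ℤ) (x : ℝ) : ℝ := (hL.exists_isAbove n x).choose

theorem shift_eq (hL : IsLayout h₀ r s M π) {n : ℤ} {j : ℕ} {x y : ℝ}
    (h : IsAbove h₀ r s π n j x y) : hL.shift n x = y := by
  obtain ⟨k, hk⟩ := (hL.exists_isAbove n x).choose_spec
  exact hL.isAbove_unique hk h

theorem shift_zero (hL : IsLayout h₀ r s M π) (x : ℝ) : hL.shift 0 x = x := by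
  obtain ⟨j, u, hu, -, -⟩ := hL.exists_isAt_interior x 0
  exact hL.shift_eq ⟨u, u, hu, hu.1, by omega, by ring⟩

theorem shift_add (hL : IsLayout h₀ r s M π) (a b : ℤ) (x : ℝ) :
    hL.shift (a + b) x = hL.shift a (hL.shift b x) := by
  obtain ⟨j, u, hu, h1, h2⟩ := hL.exists_isAt_interior x (a.natAbs + b.natAbs)
  have hb : (u + b).toNat < height h₀ r s j := by omega
  rw [hL.shift_eq (j := j) (n := b) ⟨u, (u + b).toNat, hu, hb, by omega, rfl⟩,
    hL.shift_eq (j := j) (n := a) ⟨(u + b).toNat, (u + b + a).toNat, hL.isAt_translate hu hb,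
      by omega, by omega, rfl⟩]
  exact hL.shift_eq ⟨u, (u + b + a).toNat, hu, by omega, by omega, by ring⟩

theorem iUnion_domain (hL : IsLayout h₀ r s M π) (n : ℤ) : ⋃ q, shiftDomain h₀ r s π n q = univ := by
  refine eq_univ_of_forall fun x => ?_
  obtain ⟨y, j, u, v, hu, hv, hn, -⟩ := hL.exists_isAbove n x
  exact mem_iUnion.2 ⟨(j, u, v), hu, hv, hn⟩

theorem shift_eq_of_mem_domain (hL : IsLayout h₀ r s M π) {n : ℤ} {q : ℕ × ℕ × ℕ} {x : ℝ}
    (hx : x ∈ shiftDomain h₀ r s π n q) :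
    hL.shift n x = x + (π q.1 q.2.2 - π q.1 q.2.1) / pieces r q.1 :=
  hL.shift_eq ⟨q.2.1, q.2.2, hx.1, hx.2.1, hx.2.2, rfl⟩

theorem measurable_shift (hL : IsLayout h₀ r s M π) (n : ℤ) : Measurable (hL.shift n) :=
  measurable_of_iUnion_eq_univ _ (hL.iUnion_domain n) (measurableSet_shiftDomain n)
    (fun q x => x + (π q.1 q.2.2 - π q.1 q.2.1) / pieces r q.1) (fun _ => measurable_id.add_const _)
    fun _ _ hx => hL.shift_eq_of_mem_domain hx

/-- The rank-one automorphism of the line: go up by one floor. -/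
def lift (hL : IsLayout h₀ r s M π) : ℝ ≃ᵐ ℝ where
  toFun := hL.shift 1
  invFun := hL.shift (-1)
  left_inv x := by rw [← hL.shift_add, neg_add_cancel, shift_zero]
  right_inv x := by rw [← hL.shift_add, add_neg_cancel, shift_zero]
  measurable_toFun := hL.measurable_shift 1
  measurable_invFun := hL.measurable_shift (-1)

theorem measurePreserving_lift (hL : IsLayout h₀ r s M π) :
    MeasurePreserving hL.lift volume volume :=
  measurePreserving_of_iUnion_eq_univ hL.lift (shiftDomain h₀ r s π 1) (hL.iUnion_domain 1)
    (measurableSet_shiftDomain 1)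
    (fun q => MeasurableEquiv.addRight ((π q.1 q.2.2 - π q.1 q.2.1) / pieces r q.1 : ℝ))
    (fun _ => measurePreserving_add_right volume _) fun _ _ hx => hL.shift_eq_of_mem_domain hx

theorem iter_lift (hL : IsLayout h₀ r s M π) (n : ℤ) (x : ℝ) : iter hL.lift n x = hL.shift n x := by
  induction n generalizing x with
  | zero => rw [iter_zero, hL.shift_zero]; rfl
  | succ n ih => rw [iter_add, hL.shift_add, ih, iter_one_apply]; rfl
  | pred n ih =>
    rw [sub_eq_add_neg, iter_add, hL.shift_add, ih]
    rfl

theorem iter_lift_image (hL : IsLayout h₀ r s M π) {j u : ℕ} (hu : u < height h₀ r s j) :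
    iter hL.lift u '' {x | IsAt h₀ r s π j x 0} = {x | IsAt h₀ r s π j x u} := by
  have h0 : 0 < height h₀ r s j := by omega
  ext y
  constructor
  · rintro ⟨x, hx, rfl⟩
    rw [iter_lift, hL.shift_eq (j := j) ⟨0, u, hx, hu, by omega, rfl⟩]
    exact hL.isAt_translate hx hu
  · intro hy
    have hy' : IsAt h₀ r s π j y u := hy
    refine ⟨_, hL.isAt_translate hy' h0, ?_⟩
    rw [iter_lift]
    exact hL.shift_eq (j := j) ⟨0, u, hL.isAt_translate hy' h0, hu, by omega, by ring⟩

theorem setOf_isAt_zero (hL : IsLayout h₀ r s M π) (j : ℕ) :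
    {x | IsAt h₀ r s π j x 0} = {x | (π j 0 : ℝ) < x * pieces r j ∧ x * pieces r j ≤ π j 0 + 1} := by
  ext x
  have := hL.lt_height j
  simp only [IsAt, mem_ofPred_eq, cellIndex_eq_iff]
  exact and_iff_right (by omega)

theorem volume_base (hL : IsLayout h₀ r s M π) : volume {x | IsAt h₀ r s π 0 x 0} = 1 := by
  rw [hL.setOf_isAt_zero]
  have : {x : ℝ | (π 0 0 : ℝ) < x * pieces r 0 ∧ x * pieces r 0 ≤ π 0 0 + 1} =
      Ioc (π 0 0 : ℝ) (π 0 0 + 1) := by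
    ext x; simp [pieces]
  rw [this, Real.volume_Ioc]; simp

theorem dist_lt_of_isAt (hL : IsLayout h₀ r s M π) {j u : ℕ} {x y : ℝ} (hx : IsAt h₀ r s π j x u)
    (hy : IsAt h₀ r s π j y u) : dist x y < 1 / (j + 1) := by
  have hR : (0 : ℝ) < pieces r j := by exact_mod_cast hL.pieces_pos j
  have h4 : ((j : ℝ) + 1) ≤ pieces r j := by exact_mod_cast hL.lt_pieces j
  obtain ⟨h1, h2⟩ := cellIndex_eq_iff.1 hx.2
  obtain ⟨h5, h6⟩ := cellIndex_eq_iff.1 hy.2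
  have h7 : dist x y < 1 / pieces r j := by
    rw [Real.dist_eq, lt_div_iff₀ hR]
    have h8 : |(x - y) * pieces r j| < 1 := by rw [abs_lt]; constructor <;> nlinarith
    rwa [abs_mul, abs_of_pos hR] at h8
  exact h7.trans_le (by gcongr)

/-- Let `K ⊆ A` be compact and `U ⊇ K` open with measures close to that of `A` and `K`. Cells
shorter than the distance from `K` to the complement of `U` that meet `K` cover `K` and stay in `U`.
-/
theorem approx (hL : IsLayout h₀ r s M π) {A : Set ℝ} (hA : MeasurableSet A) (hAm : volume A < ∞)
    {ε : ℝ≥0∞} (hε : 0 < ε) : ∃ j, ∃ F ⊆ Finset.range (height h₀ r s j),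
      volume (symmDiff A (⋃ a ∈ F, {x | IsAt h₀ r s π j x a})) < ε := by
  classical
  have hε2 : ε / 2 ≠ 0 := (ENNReal.half_pos hε.ne').ne'
  obtain ⟨K, hKA, hK, hAK⟩ := hA.exists_isCompact_sdiff_lt hAm.ne hε2
  obtain ⟨U, hKU, hU, hUK⟩ := hK.exists_isOpen_lt_add (μ := volume) hε2
  obtain ⟨δ, hδ, hthick⟩ := hK.exists_thickening_subset_open hU hKU
  obtain ⟨b, hb⟩ := hK.isBounded.exists_norm_le
  obtain ⟨j, hjδ, hjb⟩ : ∃ j : ℕ, 1 / ((j : ℝ) + 1) < δ ∧ b < j := by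
    have h1 := (tendsto_one_div_add_atTop_nhds_zero_nat (𝕜 := ℝ)).eventually_lt_const hδ
    obtain ⟨j, hj⟩ := (h1.and (tendsto_natCast_atTop_atTop.eventually_gt_atTop b)).exists
    exact ⟨j, hj⟩
  refine ⟨j, (Finset.range (height h₀ r s j)).filter fun u => ∃ x ∈ K, IsAt h₀ r s π j x u,
    Finset.filter_subset _ _, ?_⟩
  set B := ⋃ a ∈ (Finset.range (height h₀ r s j)).filter fun u => ∃ x ∈ K, IsAt h₀ r s π j x u,
    {x | IsAt h₀ r s π j x a} with hB
  have hKB : K ⊆ B := by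
    intro x hx
    have hxM : |x| < M j := (hb x hx).trans_lt (hjb.trans_le (by exact_mod_cast hL.le_extent j))
    obtain ⟨u, hu⟩ := hL.exists_isAt_of_abs_lt hxM
    exact mem_iUnion₂.2 ⟨u, Finset.mem_filter.2 ⟨Finset.mem_range.2 hu.1, x, hx, hu⟩, hu⟩
  have hBU : B ⊆ U := by
    intro y hy
    obtain ⟨u, hu, hyu⟩ := mem_iUnion₂.1 hy
    obtain ⟨x, hx, hxu⟩ := (Finset.mem_filter.1 hu).2
    exact hthick (Metric.mem_thickening_iff.2
      ⟨x, hx, (hL.dist_lt_of_isAt hyu hxu).trans hjδ⟩)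
  have hsub : symmDiff A B ⊆ A \ K ∪ U \ K := by
    rintro x (⟨hxA, hxB⟩ | ⟨hxB, hxA⟩)
    · exact Or.inl ⟨hxA, fun h => hxB (hKB h)⟩
    · exact Or.inr ⟨hBU hxB, fun h => hxA (hKA h)⟩
  have hUK' : volume (U \ K) < ε / 2 := by
    rw [measure_sdiff hKU hK.measurableSet.nullMeasurableSet hK.measure_lt_top.ne]
    exact ENNReal.sub_lt_of_lt_add (measure_mono hKU) (by rwa [add_comm])
  calc volume (symmDiff A B) ≤ volume (A \ K) + volume (U \ K) :=
        (measure_mono hsub).trans (measure_union_le _ _)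
    _ < ε / 2 + ε / 2 := ENNReal.add_lt_add hAK hUK'
    _ = ε := ENNReal.add_halves ε

theorem isRankOneConstruction (hL : IsLayout h₀ r s M π) :
    IsRankOneConstruction volume hL.lift h₀ r s fun j => {x | IsAt h₀ r s π j x 0} where
  measurePreserving := hL.measurePreserving_lift
  height_pos := hL.height_pos
  two_le_columns := hL.two_le_columns
  measurableSet_base j := measurableSet_isAt j 0
  base_pos := by rw [hL.volume_base]; exact one_pos
  base_lt_top := by rw [hL.volume_base]; exact ENNReal.one_lt_top
  disjoint_floors j a ha b hb hab := by
    rw [hL.iter_lift_image ha, hL.iter_lift_image hb, disjoint_left]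
    exact fun x hx hx' => hab (hL.isAt_unique hx hx')
  cut j := by
    have h0 : 0 < height h₀ r s j := (Nat.zero_le j).trans_lt (hL.lt_height j)
    have hlt : ∀ i < r j, columnStart h₀ r s j i < height h₀ r s (j + 1) :=
      fun i hi => columnStart_add_lt hi h0
    ext x
    simp only [mem_iUnion, Finset.mem_range, exists_prop]
    constructor
    · intro hx
      obtain ⟨i, hi, hxi⟩ := hL.exists_isAt_succ hx
      exact ⟨i, hi, by rw [hL.iter_lift_image (hlt i hi)]; exact hxi⟩
    · rintro ⟨i, hi, hxi⟩
      rw [hL.iter_lift_image (hlt i hi)] at hxi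
      exact hL.isAt_of_succ hi h0 hxi
  fill := by
    refine eq_univ_of_forall fun x => ?_
    obtain ⟨j, u, hu, -, -⟩ := hL.exists_isAt_interior x 0
    refine mem_iUnion.2 ⟨j, mem_iUnion₂.2 ⟨u, Finset.mem_range.2 hu.1, ?_⟩⟩
    rw [hL.iter_lift_image hu.1]; exact hu
  approx A hA hAm ε hε := by
    obtain ⟨j, F, hF, h⟩ := hL.approx hA hAm hε
    refine ⟨j, F, hF, ?_⟩
    have hU : (⋃ a ∈ F, iter hL.lift a '' {x | IsAt h₀ r s π j x 0}) =
        ⋃ a ∈ F, {x | IsAt h₀ r s π j x a} :=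
      iUnion₂_congr fun a ha => hL.iter_lift_image (Finset.mem_range.1 (hF ha))
    rwa [hU]

end IsLayout

end Shift

/-! ### Choice of the spacers. -/

section Parameters

/-- The `i`-th spacer of a stage of height `H` that follows the pattern `L`. -/
def patternSpacer (L : List (Option ℕ)) (H i : ℕ) : ℕ := ((L[i % L.length]?).getD none).getD H

/-- The position of the top of the last column of a stage of height `H` with the pattern `L`. -/
def patternTop (L : List (Option ℕ)) (j H : ℕ) : ℕ :=
  (L.length * (j + 1)) * H + ∑ i ∈ Finset.range (L.length * (j + 1)), patternSpacer L H i + H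

/-- Half the extents of the towers: stage `j + 1` gets `G` more floors than necessary. -/
def extent (pat : ℕ → List (Option ℕ)) (G : ℕ → ℕ → ℕ) : ℕ → ℕ
  | 0 => 1
  | j + 1 =>
    let H := 2 * extent pat G j * pieces (fun j => (pat j).length * (j + 1) + 1) j
    patternTop (pat j) j H + H + G j (patternTop (pat j) j H)

/-- There are rank-one automorphisms of the line with arbitrary patterns and with last spacers
as large as desired. -/
theorem exists_isRankOneConstruction (pat : ℕ → List (Option ℕ)) (hpat : ∀ j, pat j ≠ [])
    (G : ℕ → ℕ → ℕ) : ∃ (T : ℝ ≃ᵐ ℝ) (h₀ : ℕ) (r : ℕ → ℕ) (s : ℕ → ℕ → ℕ) (E : ℕ → Set ℝ),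
      IsRankOneConstruction volume T h₀ r s E ∧ (∀ j, FollowsPattern h₀ r s j (pat j)) ∧
      ∀ j, columnStart h₀ r s j (r j - 1) + height h₀ r s j +
        G j (columnStart h₀ r s j (r j - 1) + height h₀ r s j) ≤ height h₀ r s (j + 1) := by
  set r : ℕ → ℕ := fun j => (pat j).length * (j + 1) + 1 with hr
  set M := extent pat G with hM
  -- The number of cells of stage `j`. The heights are prescribed by the extents, and `hheight`
  -- verifies that the spacers produce them.
  set H : ℕ → ℕ := fun j => 2 * M j * pieces r j with hH
  -- The last spacer fills the tower up to the prescribed height; an entry `none` becomes a spacer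
  -- of size exactly `H j`.
  set s : ℕ → ℕ → ℕ := fun j i => if i < r j - 1 then patternSpacer (pat j) (H j) i else
    H (j + 1) - patternTop (pat j) j (H j) with hs
  have hlen : ∀ j, 0 < (pat j).length := fun j => List.length_pos_iff.2 (hpat j)
  have hr2 : ∀ j, 2 ≤ r j := fun j => by
    exact Nat.succ_le_succ (Nat.mul_pos (hlen j) (Nat.succ_pos j))
  have hp : ∀ j, 0 < pieces r j := fun j => Finset.prod_pos fun i _ => by have := hr2 i; omega
  have hMsucc : ∀ j, M (j + 1) = patternTop (pat j) j (H j) + H j +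
      G j (patternTop (pat j) j (H j)) := fun j => rfl
  have hHsucc : ∀ j, patternTop (pat j) j (H j) + H j + G j (patternTop (pat j) j (H j)) ≤
      H (j + 1) := fun j => by
    rw [← hMsucc]
    simp only [hH]
    nlinarith [hp (j + 1), Nat.zero_le (M (j + 1))]
  have hheight : ∀ j, height 2 r s j = H j := by
    intro j
    induction j with
    | zero => simp [height, hH, hM, extent, pieces]
    | succ j ih =>
      change height 2 r s j * r j + ∑ i ∈ Finset.range (r j), s j i = _
      have h1 : r j = (pat j).length * (j + 1) + 1 := rfl
      have h2 : s j ((pat j).length * (j + 1)) = H (j + 1) - patternTop (pat j) j (H j) := by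
        simp [hs, hr]
      have h3 : ∑ i ∈ Finset.range ((pat j).length * (j + 1)), s j i =
          ∑ i ∈ Finset.range ((pat j).length * (j + 1)), patternSpacer (pat j) (H j) i :=
        Finset.sum_congr rfl fun i hi => by
          have := Finset.mem_range.1 hi
          simp only [hs, hr, add_tsub_cancel_right, if_pos this]
      rw [ih, h1, Finset.sum_range_succ, h2, h3]
      have h4 := hHsucc j
      have h5 : patternTop (pat j) j (H j) = ((pat j).length * (j + 1)) * H j +
        ∑ i ∈ Finset.range ((pat j).length * (j + 1)), patternSpacer (pat j) (H j) i + H j := rfl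
      have h6 : H j * ((pat j).length * (j + 1) + 1) = (pat j).length * (j + 1) * H j + H j := by
        ring
      omega
  have htop : ∀ j, columnStart 2 r s j (r j - 1) + height 2 r s j =
      patternTop (pat j) j (H j) := fun j => by
    rw [hheight, columnStart, hheight, patternTop]
    congr 2
    refine Finset.sum_congr rfl fun i hi => ?_
    exact if_pos (Finset.mem_range.1 hi)
  have hlast : ∀ j, height 2 r s j ≤ s j (r j - 1) := fun j => by
    have := hHsucc j
    simp only [hs, lt_irrefl, if_false]
    rw [hheight]
    omega
  have hpos : ∀ j, 0 < height 2 r s j := fun j => by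
    induction j with
    | zero => exact two_pos
    | succ j ih => exact (Nat.mul_pos ih (by have := hr2 j; omega)).trans_le (Nat.le_add_right _ _)
  have hMH : ∀ j, M j < M (j + 1) := fun j => by
    have h1 := hMsucc j
    have h2 : M j ≤ H j := by simp only [hH]; nlinarith [hp j, Nat.zero_le (M j)]
    have h3 : 0 < M j := by
      cases j with
      | zero => exact one_pos
      | succ j =>
        have h3 := hMsucc j
        have h4 : 0 < H j := by
          rw [← hheight]
          exact hpos j
        omega
    have h5 : H j ≤ patternTop (pat j) j (H j) := Nat.le_add_left _ _
    have h6 : 0 < H j := lt_of_lt_of_le h3 h2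
    omega
  have hstrict : StrictMono M := strictMono_nat_of_lt_succ hMH
  -- The initial floors are the two unit cells of `(-1, 1]`.
  obtain ⟨π, hL⟩ := exists_isLayout (M := M) (h₀ := 2) one_le_two hr2 hlast (fun j => hstrict.le_apply) hstrict.monotone
    hheight
  refine ⟨hL.lift, 2, r, s, _, hL.isRankOneConstruction,
    fun j => ⟨rfl, ?_, ?_, hlast j⟩, fun j => ?_⟩
  · intro i hi o ho
    have : i < r j - 1 := by simpa [hr] using hi
    simp only [hs, if_pos this, patternSpacer, ho, Option.getD_some]
  · intro i hi ho
    have : i < r j - 1 := by simpa [hr] using hi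
    rw [hheight]
    simp only [hs, if_pos this, patternSpacer, ho, Option.getD_some, Option.getD_none, le_refl]
  · rw [htop, hheight]
    have := hHsucc j
    omega

end Parameters

/-! ### Conjugates of rank-one automorphisms. -/

section Conjugation

variable {X : Type*} [MeasurableSpace X]

/-- The conjugate `φ⁻¹ T φ`. -/
def conjugate (φ T : X ≃ᵐ X) : X ≃ᵐ X := (φ.trans T).trans φ.symm

theorem iter_conjugate_apply (φ T : X ≃ᵐ X) (n : ℤ) (x : X) :
    iter (conjugate φ T) n x = φ.symm (iter T n (φ x)) := by
  have h : ((conjugate φ T).toEquiv : Equiv.Perm X) =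
      (φ.symm.toEquiv : Equiv.Perm X) * (T.toEquiv : Equiv.Perm X) *
        (φ.symm.toEquiv : Equiv.Perm X)⁻¹ := rfl
  rw [iter, h, conj_zpow]
  rfl

theorem iter_conjugate_image (φ T : X ≃ᵐ X) (n : ℤ) (A : Set X) :
    iter (conjugate φ T) n '' (φ.symm '' A) = φ.symm '' (iter T n '' A) := by
  rw [image_image, image_image]
  simp only [iter_conjugate_apply, MeasurableEquiv.apply_symm_apply]

/-- The parameters `h₀`, `r` and `s` do not change, so the conjugate follows the same patterns and
the spectral conclusions apply to it, too. -/
theorem IsRankOneConstruction.conjugate {m : Measure X} {T : X ≃ᵐ X} {h₀ : ℕ} {r : ℕ → ℕ}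
    {s : ℕ → ℕ → ℕ} {E : ℕ → Set X} (hC : IsRankOneConstruction m T h₀ r s E) {φ : X ≃ᵐ X}
    (hφ : MeasurePreserving φ m m) :
    IsRankOneConstruction m (conjugate φ T) h₀ r s fun j => φ.symm '' E j where
  measurePreserving := (hφ.symm φ).comp (hC.measurePreserving.comp hφ)
  height_pos := hC.height_pos
  two_le_columns := hC.two_le_columns
  measurableSet_base j := φ.symm.measurableSet_image.2 (hC.measurableSet_base j)
  base_pos := by
    rw [φ.image_symm, hφ.measure_preimage (hC.measurableSet_base 0).nullMeasurableSet]
    exact hC.base_pos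
  base_lt_top := by
    rw [φ.image_symm, hφ.measure_preimage (hC.measurableSet_base 0).nullMeasurableSet]
    exact hC.base_lt_top
  disjoint_floors j a ha b hb hab := by
    rw [iter_conjugate_image, iter_conjugate_image, disjoint_image_iff φ.symm.injective]
    exact hC.disjoint_floors j a ha b hb hab
  cut j := by
    simp only [iter_conjugate_image, ← image_iUnion₂]
    rw [← hC.cut j]
  fill := by
    simp only [iter_conjugate_image, ← image_iUnion₂]
    rw [← image_iUnion, hC.fill, image_univ, φ.symm.surjective.range_eq]
  approx A hA hAm ε hε := by
    have hA' : MeasurableSet (φ '' A) := φ.measurableSet_image.2 hA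
    have hAm' : m (φ '' A) = m A := by
      rw [← hφ.measure_preimage hA'.nullMeasurableSet, preimage_image_eq _ φ.injective]
    obtain ⟨j, F, hF, h⟩ := hC.approx (φ '' A) hA' (by rwa [hAm']) ε hε
    refine ⟨j, F, hF, ?_⟩
    simp only [iter_conjugate_image, ← image_iUnion₂]
    have hU : MeasurableSet (⋃ a ∈ F, iter T a '' E j) :=
      Finset.measurableSet_biUnion _ fun a _ =>
        measurableSet_iter_image T _ (hC.measurableSet_base j)
    rw [← hφ.measure_preimage (hA'.symmDiff hU).nullMeasurableSet, preimage_symmDiff,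
      preimage_image_eq _ φ.injective] at h
    rwa [φ.image_symm]

end Conjugation

/-! ### Permuting the floors in the last spacers. -/

section Rearrangement

variable {X : Type*} [MeasurableSpace X] {m : Measure X} {T : X ≃ᵐ X} {h₀ : ℕ} {r : ℕ → ℕ}
  {s : ℕ → ℕ → ℕ} {E : ℕ → Set X}

/-- The powers of an automorphism as bimeasurable maps. -/
def iterEquiv (T : X ≃ᵐ X) (n : ℤ) : X ≃ᵐ X where
  toEquiv := iter T n
  measurable_toFun := measurable_iter T n
  measurable_invFun := by
    have h : (iter T n).symm = iter T (-n) := by rw [iter, iter, zpow_neg]; rfl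
    change Measurable (iter T n).symm
    rw [h]
    exact measurable_iter T (-n)

/-- The number of floors of the tower of stage `j + 1` below the last spacers. -/
def top (h₀ : ℕ) (r : ℕ → ℕ) (s : ℕ → ℕ → ℕ) (j : ℕ) : ℕ :=
  columnStart h₀ r s j (r j - 1) + height h₀ r s j

/-- The point `x` lies on the floor `u` of stage `j + 1`, among the last spacers. -/
structure IsOnTop (T : X ≃ᵐ X) (h₀ : ℕ) (r : ℕ → ℕ) (s : ℕ → ℕ → ℕ) (E : ℕ → Set X) (j u : ℕ)
    (x : X) : Prop where
  top_le : top h₀ r s j ≤ u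
  lt_height : u < height h₀ r s (j + 1)
  mem : x ∈ iter T u '' E (j + 1)

theorem columnStart_add_lt_top {j i a : ℕ} (hi : i < r j) (ha : a < height h₀ r s j) :
    columnStart h₀ r s j i + a < top h₀ r s j := by
  have := monotone_columnStart (h₀ := h₀) (r := r) (s := s) j (show i ≤ r j - 1 by omega)
  rw [top]
  omega

/-- The floors in the last spacers of stage `j` are permuted by `σ j`. -/
def rearrange (T : X ≃ᵐ X) (h₀ : ℕ) (r : ℕ → ℕ) (s : ℕ → ℕ → ℕ) (E : ℕ → Set X)
    (σ : ℕ → Equiv.Perm ℕ) (x : X) : X :=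
  open scoped Classical in
  if h : ∃ q : ℕ × ℕ, IsOnTop T h₀ r s E q.1 q.2 x then
    iter T (σ h.choose.1 h.choose.2 - h.choose.2) x
  else x

namespace IsRankOneConstruction

theorem mem_iter_unique (hC : IsRankOneConstruction m T h₀ r s E) {j a b : ℕ}
    (ha : a < height h₀ r s j) (hb : b < height h₀ r s j) {x : X} (hxa : x ∈ iter T a '' E j)
    (hxb : x ∈ iter T b '' E j) : a = b := by
  by_contra hab
  exact disjoint_left.1 (hC.disjoint_floors j a ha b hb hab) hxa hxb

/-- A floor of stage `j` is cut, at stage `k + 1`, into floors that belong to columns and so lie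
below the last spacers. Hence the last spacers of different stages are disjoint, and the points of
`E 0` are never moved. -/
theorem not_isOnTop (hC : IsRankOneConstruction m T h₀ r s E) {j k u a : ℕ} (hjk : j ≤ k)
    (ha : a < height h₀ r s j) {x : X} (hx : x ∈ iter T a '' E j) :
    ¬ IsOnTop T h₀ r s E k u x := by
  intro h
  obtain ⟨F, hF, hFe⟩ := hC.floorUnion_mono hjk
    (show IsFloorUnion T h₀ r s E j (iter T a '' E j) from ⟨{a}, by simpa using ha, by simp⟩)
  rw [hFe] at hx
  obtain ⟨b, hb, hxb⟩ := mem_iUnion₂.1 hx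
  rw [hC.floor_eq_iUnion k b] at hxb
  obtain ⟨i, hi, hxi⟩ := mem_iUnion₂.1 hxb
  have hi' := Finset.mem_range.1 hi
  have hb' := Finset.mem_range.1 (hF hb)
  rw [← Nat.cast_add] at hxi
  have := hC.mem_iter_unique (columnStart_add_lt hi' hb') h.lt_height hxi h.mem
  have := columnStart_add_lt_top (s := s) hi' hb'
  have := h.top_le
  omega

theorem isOnTop_unique (hC : IsRankOneConstruction m T h₀ r s E) {j k u v : ℕ} {x : X}
    (hu : IsOnTop T h₀ r s E j u x) (hv : IsOnTop T h₀ r s E k v x) : j = k ∧ u = v := by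
  rcases lt_trichotomy j k with hjk | rfl | hjk
  · exact absurd hv (hC.not_isOnTop hjk hu.lt_height hu.mem)
  · exact ⟨rfl, hC.mem_iter_unique hu.lt_height hv.lt_height hu.mem hv.mem⟩
  · exact absurd hu (hC.not_isOnTop hjk hv.lt_height hv.mem)

theorem rearrange_of_isOnTop (hC : IsRankOneConstruction m T h₀ r s E) (σ : ℕ → Equiv.Perm ℕ)
    {j u : ℕ} {x : X} (hu : IsOnTop T h₀ r s E j u x) :
    rearrange T h₀ r s E σ x = iter T (σ j u - u) x := by
  have h : ∃ q : ℕ × ℕ, IsOnTop T h₀ r s E q.1 q.2 x := ⟨(j, u), hu⟩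
  obtain ⟨h1, h2⟩ := hC.isOnTop_unique h.choose_spec hu
  rw [rearrange, dif_pos h, h1, h2]

theorem isOnTop_rearrange (hC : IsRankOneConstruction m T h₀ r s E) {σ : ℕ → Equiv.Perm ℕ}
    (hσ : ∀ j, ∀ u ∉ Finset.Ico (top h₀ r s j) (height h₀ r s (j + 1)), σ j u = u)
    {j u : ℕ} {x : X} (hu : IsOnTop T h₀ r s E j u x) :
    IsOnTop T h₀ r s E j (σ j u) (rearrange T h₀ r s E σ x) := by
  have hmem : σ j u ∈ Finset.Ico (top h₀ r s j) (height h₀ r s (j + 1)) := by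
    by_contra hcon
    have := (σ j).injective (hσ j _ hcon)
    rw [this] at hcon
    exact hcon (Finset.mem_Ico.2 ⟨hu.top_le, hu.lt_height⟩)
  refine ⟨(Finset.mem_Ico.1 hmem).1, (Finset.mem_Ico.1 hmem).2, ?_⟩
  rw [hC.rearrange_of_isOnTop σ hu]
  obtain ⟨y, hy, rfl⟩ := hu.mem
  exact ⟨y, hy, by rw [← iter_add, sub_add_cancel]⟩

theorem rearrange_rearrange (hC : IsRankOneConstruction m T h₀ r s E) {σ ρ : ℕ → Equiv.Perm ℕ}
    (hσ : ∀ j, ∀ u ∉ Finset.Ico (top h₀ r s j) (height h₀ r s (j + 1)), σ j u = u)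
    (hρ : ∀ j u, ρ j (σ j u) = u) (x : X) :
    rearrange T h₀ r s E ρ (rearrange T h₀ r s E σ x) = x := by
  by_cases h : ∃ q : ℕ × ℕ, IsOnTop T h₀ r s E q.1 q.2 x
  · obtain ⟨⟨j, u⟩, hu⟩ := h
    rw [hC.rearrange_of_isOnTop ρ (hC.isOnTop_rearrange hσ hu), hC.rearrange_of_isOnTop σ hu, hρ,
      ← iter_add, sub_add_sub_cancel, sub_self, iter_zero]
    rfl
  · rw [rearrange.eq_def _ _ _ _ _ σ, dif_neg h, rearrange, dif_neg h]

theorem measurableSet_isOnTop (hC : IsRankOneConstruction m T h₀ r s E) (j u : ℕ) :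
    MeasurableSet {x | IsOnTop T h₀ r s E j u x} := by
  have : {x | IsOnTop T h₀ r s E j u x} =
      {x | top h₀ r s j ≤ u ∧ u < height h₀ r s (j + 1)} ∩ iter T u '' E (j + 1) := by
    ext x
    exact ⟨fun h => ⟨⟨h.1, h.2⟩, h.3⟩, fun h => ⟨h.1.1, h.1.2, h.2⟩⟩
  rw [this]
  exact (MeasurableSet.const _).inter (measurableSet_iter_image T _ (hC.measurableSet_base _))

/-- The cover of the space by the floors among the last spacers and the rest. -/
def rearrangeCover (_hC : IsRankOneConstruction m T h₀ r s E) : Option (ℕ × ℕ) → Set X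
  | some q => {x | IsOnTop T h₀ r s E q.1 q.2 x}
  | none => (⋃ q : ℕ × ℕ, {x | IsOnTop T h₀ r s E q.1 q.2 x})ᶜ

theorem iUnion_rearrangeCover (hC : IsRankOneConstruction m T h₀ r s E) :
    ⋃ i, hC.rearrangeCover i = univ := by
  refine eq_univ_of_forall fun x => mem_iUnion.2 ?_
  by_cases h : x ∈ ⋃ q : ℕ × ℕ, {x | IsOnTop T h₀ r s E q.1 q.2 x}
  · obtain ⟨q, hq⟩ := mem_iUnion.1 h
    exact ⟨some q, hq⟩
  · exact ⟨none, h⟩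

theorem measurableSet_rearrangeCover (hC : IsRankOneConstruction m T h₀ r s E) :
    ∀ i, MeasurableSet (hC.rearrangeCover i)
  | some q => hC.measurableSet_isOnTop q.1 q.2
  | none => (MeasurableSet.iUnion fun q : ℕ × ℕ => hC.measurableSet_isOnTop q.1 q.2).compl

/-- The power of `T` by which a floor is moved. -/
def rearrangePower (σ : ℕ → Equiv.Perm ℕ) : Option (ℕ × ℕ) → ℤ
  | some q => σ q.1 q.2 - q.2
  | none => 0

theorem rearrange_eqOn (hC : IsRankOneConstruction m T h₀ r s E) (σ : ℕ → Equiv.Perm ℕ) :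
    ∀ i, EqOn (rearrange T h₀ r s E σ) (iterEquiv T (rearrangePower σ i)) (hC.rearrangeCover i)
  | some _ => fun _ hx => hC.rearrange_of_isOnTop σ hx
  | none => fun x hx => by
    have h : ¬ ∃ q : ℕ × ℕ, IsOnTop T h₀ r s E q.1 q.2 x := fun ⟨q, hq⟩ =>
      hx (mem_iUnion.2 ⟨q, hq⟩)
    rw [rearrange, dif_neg h]
    change x = iter T 0 x
    rw [iter_zero]; rfl

theorem measurable_rearrange (hC : IsRankOneConstruction m T h₀ r s E) (σ : ℕ → Equiv.Perm ℕ) :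
    Measurable (rearrange T h₀ r s E σ) :=
  measurable_of_iUnion_eq_univ _ hC.iUnion_rearrangeCover hC.measurableSet_rearrangeCover _
    (fun i => (iterEquiv T (rearrangePower σ i)).measurable) (hC.rearrange_eqOn σ)

/-- The rearrangement as an automorphism. -/
def rearrangeEquiv (hC : IsRankOneConstruction m T h₀ r s E) {σ : ℕ → Equiv.Perm ℕ}
    (hσ : ∀ j, ∀ u ∉ Finset.Ico (top h₀ r s j) (height h₀ r s (j + 1)), σ j u = u) : X ≃ᵐ X where
  toFun := rearrange T h₀ r s E σ
  invFun := rearrange T h₀ r s E fun j => (σ j)⁻¹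
  left_inv := hC.rearrange_rearrange hσ fun j u => (σ j).symm_apply_apply u
  right_inv := hC.rearrange_rearrange
    (fun j u hu => (Equiv.symm_apply_eq _).2 (hσ j u hu).symm) fun j u => (σ j).apply_symm_apply u
  measurable_toFun := hC.measurable_rearrange σ
  measurable_invFun := hC.measurable_rearrange fun j => (σ j)⁻¹

variable {σ : ℕ → Equiv.Perm ℕ}

theorem measurePreserving_rearrangeEquiv (hC : IsRankOneConstruction m T h₀ r s E)
    (hσ : ∀ j, ∀ u ∉ Finset.Ico (top h₀ r s j) (height h₀ r s (j + 1)), σ j u = u) :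
    MeasurePreserving (hC.rearrangeEquiv hσ) m m :=
  measurePreserving_of_iUnion_eq_univ _ _ hC.iUnion_rearrangeCover hC.measurableSet_rearrangeCover
    (fun i => iterEquiv T (rearrangePower σ i))
    (fun _ => measurePreserving_iter hC.measurePreserving _) (hC.rearrange_eqOn σ)

theorem rearrangeEquiv_symm_image_base (hC : IsRankOneConstruction m T h₀ r s E)
    (hσ : ∀ j, ∀ u ∉ Finset.Ico (top h₀ r s j) (height h₀ r s (j + 1)), σ j u = u) :
    (hC.rearrangeEquiv hσ).symm '' E 0 = E 0 := by
  have h : ∀ x ∈ E 0, (hC.rearrangeEquiv hσ).symm x = x := by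
    intro x hx
    have h : ¬ ∃ q : ℕ × ℕ, IsOnTop T h₀ r s E q.1 q.2 x := by
      rintro ⟨q, hq⟩
      exact hC.not_isOnTop (Nat.zero_le _) (hC.height_pos_all 0)
        (by rw [Nat.cast_zero, iter_zero_image]; exact hx) hq
    change rearrange T h₀ r s E (fun j => (σ j)⁻¹) x = x
    rw [rearrange, dif_neg h]
  rw [image_congr h, image_id']

theorem rearrangeEquiv_symm_image_iter (hC : IsRankOneConstruction m T h₀ r s E)
    (hσ : ∀ j, ∀ u ∉ Finset.Ico (top h₀ r s j) (height h₀ r s (j + 1)), σ j u = u) {j u v : ℕ}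
    (hu : top h₀ r s j ≤ u) (hu' : u < height h₀ r s (j + 1)) (huv : σ j u = v) :
    (hC.rearrangeEquiv hσ).symm '' (iter T v '' E (j + 1)) = iter T u '' E (j + 1) := by
  have h : iter T v '' E (j + 1) = hC.rearrangeEquiv hσ '' (iter T u '' E (j + 1)) := by
    have h1 : ∀ x ∈ iter T u '' E (j + 1), hC.rearrangeEquiv hσ x = iter T ((v : ℤ) - u) x :=
      fun x hx => huv ▸ hC.rearrange_of_isOnTop σ ⟨hu, hu', hx⟩
    rw [image_congr h1, ← iter_add_image, sub_add_cancel]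
  rw [h, image_image]
  simp

theorem exists_base_eq_iUnion (hC : IsRankOneConstruction m T h₀ r s E) (j : ℕ) :
    ∃ D ⊆ Finset.range (top h₀ r s j), E 0 = ⋃ d ∈ D, iter T (d : ℕ) '' E (j + 1) := by
  classical
  obtain ⟨F, hF, hE⟩ := hC.floorUnion_mono (Nat.zero_le j) (hC.floorUnion_base 0)
  refine ⟨F.biUnion fun a => (Finset.range (r j)).image fun i => columnStart h₀ r s j i + a, ?_, ?_⟩
  · intro b hb
    simp only [Finset.mem_biUnion, Finset.mem_image, Finset.mem_range] at hb ⊢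
    obtain ⟨a, ha, i, hi, rfl⟩ := hb
    exact columnStart_add_lt_top hi (Finset.mem_range.1 (hF ha))
  · rw [hE]
    ext x
    simp only [mem_iUnion, Finset.mem_biUnion, Finset.mem_image, exists_prop]
    constructor
    · rintro ⟨a, ha, hx⟩
      rw [hC.floor_eq_iUnion j a] at hx
      obtain ⟨i, hi, hxi⟩ := mem_iUnion₂.1 hx
      exact ⟨columnStart h₀ r s j i + a, ⟨a, ha, i, hi, rfl⟩, by rwa [Nat.cast_add]⟩
    · rintro ⟨_, ⟨a, ha, i, hi, rfl⟩, hx⟩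
      refine ⟨a, ha, ?_⟩
      rw [hC.floor_eq_iUnion j a]
      exact mem_iUnion₂.2 ⟨i, hi, by rwa [Nat.cast_add] at hx⟩

/-- The rearrangement fixes `E 0`, which consists of floors `d < top h₀ r s j` of stage `j + 1`. So
the left side is the inverse rearrangement of the floors `b + d`, that is, the floors `a + d`. -/
theorem iter_conjugate_base (hC : IsRankOneConstruction m T h₀ r s E)
    (hσ : ∀ j, ∀ u ∉ Finset.Ico (top h₀ r s j) (height h₀ r s (j + 1)), σ j u = u) {j a b : ℕ}
    (ha : top h₀ r s j ≤ a) (ha' : a + top h₀ r s j ≤ height h₀ r s (j + 1))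
    (hab : ∀ d < top h₀ r s j, σ j (a + d) = b + d) :
    iter (PoissonRankOne.conjugate (hC.rearrangeEquiv hσ) T) b '' E 0 = iter T a '' E 0 := by
  conv_lhs => rw [← hC.rearrangeEquiv_symm_image_base hσ, iter_conjugate_image]
  obtain ⟨D, hD, hE⟩ := hC.exists_base_eq_iUnion j
  rw [hE]
  simp only [image_iUnion₂]
  refine iUnion₂_congr fun d hd => ?_
  have hd' := Finset.mem_range.1 (hD hd)
  rw [← iter_add_image, ← iter_add_image, ← Nat.cast_add, ← Nat.cast_add]
  exact hC.rearrangeEquiv_symm_image_iter hσ (by omega) (by omega) (hab d hd')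

/-- The two translates occupy floors in blocks of length `top h₀ r s j` that do not overlap. -/
theorem disjoint_iter_base (hC : IsRankOneConstruction m T h₀ r s E) {j a b : ℕ}
    (hab : a + top h₀ r s j ≤ b) (hb : b + top h₀ r s j ≤ height h₀ r s (j + 1)) :
    Disjoint (iter T a '' E 0) (iter T b '' E 0) := by
  obtain ⟨D, hD, hE⟩ := hC.exists_base_eq_iUnion j
  rw [hE]
  simp only [image_iUnion₂]
  refine disjoint_iUnion₂_left.2 fun d hd => disjoint_iUnion₂_right.2 fun e he => ?_
  have hd' := Finset.mem_range.1 (hD hd)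
  have he' := Finset.mem_range.1 (hD he)
  rw [← iter_add_image, ← iter_add_image, ← Nat.cast_add, ← Nat.cast_add]
  exact hC.disjoint_floors _ _ (by omega) _ (by omega) (by omega)

end IsRankOneConstruction

theorem iter_poissonSuspension_preimage_void (T : X ≃ᵐ X) (n : ℤ) (A : Set X) :
    iter (poissonSuspension T) n ⁻¹' void A = void (iter T n ⁻¹' A) := by
  induction n generalizing A with
  | zero => rw [iter_zero, iter_zero]; rfl
  | succ n ih =>
    have h1 : ∀ {Ω : Type _} [MeasurableSpace Ω] (S : Ω ≃ᵐ Ω),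
        (iter S (n + 1) : Ω → Ω) = iter S n ∘ S := fun S => by
      funext x; rw [iter_add, iter_one_apply]; rfl
    rw [h1, h1, preimage_comp, preimage_comp, ih, preimage_poissonSuspension_void]
  | pred n ih =>
    have h1 : ∀ {Ω : Type _} [MeasurableSpace Ω] (S : Ω ≃ᵐ Ω),
        (iter S (-n - 1) : Ω → Ω) = iter S (-n) ∘ S.symm := fun S => by
      funext x; rw [sub_eq_add_neg, iter_add]; rfl
    rw [h1, h1, preimage_comp, preimage_comp, ih]
    exact preimage_poissonSuspension_void T.symm _

theorem iter_poissonSuspension_image_void (T : X ≃ᵐ X) (n : ℤ) (A : Set X) :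
    iter (poissonSuspension T) n '' void A = void (iter T n '' A) := by
  rw [iter_image_eq_preimage, iter_poissonSuspension_preimage_void, iter_image_eq_preimage]

end Rearrangement

/-! ### Gaps of the sequences and divergence of averages. -/

section Averages

theorem exists_gap {p : ℕ → ℤ} (hp : Tendsto (fun n => p (n + 1) - p n) atTop atTop) (h : ℕ) :
    ∃ N, ∀ n, N ≤ n → (h : ℤ) ≤ p n ∧ p n + h ≤ p (n + 1) := by
  obtain ⟨N, hN⟩ := eventually_atTop.1 (hp.eventually_ge_atTop ((h : ℤ) + 1))
  have hgrow : ∀ k : ℕ, p N + k ≤ p (N + k) := by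
    intro k
    induction k with
    | zero => simp
    | succ k ih =>
      have h1 := hN (N + k) (by omega)
      rw [← add_assoc]
      push_cast
      omega
  refine ⟨N + (h - p N).toNat, fun n hn => ?_⟩
  have h1 := hN n (by omega)
  have h2 := hgrow (n - N)
  rw [show N + (n - N) = n by omega] at h2
  omega

theorem add_le_of_gap {p : ℕ → ℤ} {N h : ℕ}
    (hN : ∀ n, N ≤ n → (h : ℤ) ≤ p n ∧ p n + h ≤ p (n + 1)) {a b : ℕ} (ha : N ≤ a) (hab : a < b) :
    p a + h ≤ p b := by
  induction b, hab using Nat.le_induction with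
  | base => exact (hN a ha).2
  | succ b hb ih =>
    have := (hN b (by omega)).2
    omega

/-- Only the terms before `N` contribute, each at most one. -/
theorem abs_average_sub_le {a : ℕ → ℝ} {v : ℝ} (ha : ∀ n, a n ∈ Icc (0 : ℝ) 1)
    (hv : v ∈ Icc (0 : ℝ) 1) {N N' : ℕ} (hN' : 0 < N')
    (h : ∀ n, N ≤ n → n ≤ N' → a n = v) :
    |1 / (N' : ℝ) * ∑ n ∈ Finset.Icc 1 N', a n - v| ≤ N / N' := by
  have hpos : (0 : ℝ) < N' := by exact_mod_cast hN'
  have h1 : 1 / (N' : ℝ) * ∑ n ∈ Finset.Icc 1 N', a n - v =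
      (∑ n ∈ Finset.Icc 1 N', (a n - v)) / N' := by
    rw [Finset.sum_sub_distrib, Finset.sum_const, Nat.card_Icc, nsmul_eq_mul]
    push_cast [Nat.add_sub_cancel]
    field_simp
  rw [h1, abs_div, abs_of_pos hpos]
  gcongr
  calc |∑ n ∈ Finset.Icc 1 N', (a n - v)| ≤ ∑ n ∈ Finset.Icc 1 N', |a n - v| :=
        Finset.abs_sum_le_sum_abs _ _
    _ ≤ ∑ n ∈ Finset.Icc 1 N', if n ∈ Finset.range N then (1 : ℝ) else 0 := by
        refine Finset.sum_le_sum fun n hn => ?_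
        split_ifs with hnN
        · have h2 := ha n
          rw [abs_le]
          constructor <;> linarith [h2.1, h2.2, hv.1, hv.2]
        · rw [h n (by simpa using hnN) (Finset.mem_Icc.1 hn).2]; simp
    _ ≤ N := by
        rw [Finset.sum_ite_mem, Finset.sum_const, nsmul_eq_mul, mul_one]
        exact_mod_cast (Finset.card_le_card Finset.inter_subset_right).trans
          (Finset.card_range N).le

/-- A sequence in `[0, 1]` that takes on the value `v` on long intervals far out has averages
accumulating at `v`; so the averages cannot converge if there are two such values. -/
theorem not_tendsto_average {a : ℕ → ℝ} (ha : ∀ n, a n ∈ Icc (0 : ℝ) 1) {v : ℕ → ℝ}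
    (hv : ∀ j, v j ∈ Icc (0 : ℝ) 1) {v₀ v₁ : ℝ} (hv₀ : ∃ᶠ j in atTop, v j = v₀)
    (hv₁ : ∃ᶠ j in atTop, v j = v₁) (hne : v₀ ≠ v₁) {N N' : ℕ → ℕ}
    (hN : ∀ j, 1 ≤ N j) (hN' : ∀ j, N j * (j + 1) ≤ N' j)
    (h : ∀ j n, N j ≤ n → n ≤ N' j → a n = v j) :
    ¬ ∃ L : ℝ, Tendsto (fun K : ℕ => 1 / (K : ℝ) * ∑ n ∈ Finset.Icc 1 K, a n) atTop (𝓝 L) := by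
  rintro ⟨L, hL⟩
  have hle : ∀ j, j + 1 ≤ N' j := fun j => by nlinarith [hN j, hN' j]
  have hlim : Tendsto N' atTop atTop :=
    tendsto_atTop_mono (fun j => (Nat.le_succ j).trans (hle j)) tendsto_id
  -- The error is at most `N j / N' j ≤ 1 / (j + 1)`.
  have h1 : Tendsto (fun j => 1 / (N' j : ℝ) * ∑ n ∈ Finset.Icc 1 (N' j), a n - v j) atTop
      (𝓝 0) := by
    refine squeeze_zero_norm (fun j => ?_) (tendsto_one_div_add_atTop_nhds_zero_nat (𝕜 := ℝ))
    have hpos : 0 < N' j := by have := hle j; omega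
    refine (abs_average_sub_le ha (hv j) hpos (h j)).trans ?_
    rw [div_le_div_iff₀ (by exact_mod_cast hpos) (by positivity)]
    exact_mod_cast (hN' j).trans (by rw [one_mul])
  have h2 : Tendsto v atTop (𝓝 L) := by
    have := (hL.comp hlim).sub h1
    simpa using this
  have key : ∀ w, (∃ᶠ j in atTop, v j = w) → L = w := by
    intro w hw
    by_contra hLw
    exact hw ((h2.eventually_ne hLw).mono fun j hj => hj)
  exact hne ((key v₀ hv₀).symm.trans (key v₁ hv₁))

end Averages

/-! ### Enumeration of the patterns and matching of the blocks. -/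

/-- A sequence of nonempty patterns in which each pattern occurs infinitely often. -/
def patterns (j : ℕ) : List (Option ℕ) :=
  if (Encodable.decode (α := List (Option ℕ)) j.unpair.1).getD [] = [] then [none]
  else (Encodable.decode (α := List (Option ℕ)) j.unpair.1).getD []

theorem patterns_ne_nil (j : ℕ) : patterns j ≠ [] := by
  rw [patterns]
  split_ifs with h
  · simp
  · exact h

theorem frequently_patterns {L : List (Option ℕ)} (hL : L ≠ []) : ∃ᶠ j in atTop, patterns j = L := by
  refine frequently_atTop.2 fun n => ⟨Nat.pair (Encodable.encode L) n, Nat.right_le_pair _ _, ?_⟩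
  simp [patterns, hL]

/-- Blocks of length `h` starting at distinct values of `p` are disjoint; `toNat` is harmless since
these values are at least `h`. -/
theorem eq_of_gap {p : ℕ → ℤ} {N h : ℕ}
    (hN : ∀ n, N ≤ n → (h : ℤ) ≤ p n ∧ p n + h ≤ p (n + 1)) {a b d e : ℕ} (ha : N ≤ a) (hb : N ≤ b)
    (hd : d < h) (he : e < h) (hab : (p a).toNat + d = (p b).toNat + e) : a = b ∧ d = e := by
  have h1 := hN a ha
  have h2 := hN b hb
  rcases lt_trichotomy a b with hlt | rfl | hlt
  · have := add_le_of_gap hN ha hlt; omega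
  · exact ⟨rfl, by omega⟩
  · have := add_le_of_gap hN hb hlt; omega

/-- The identity for even `j`, the reflection of `[N, N']` for odd `j`. -/
def alternate (j N N' n : ℕ) : ℕ := if Even j then n else N + N' - n

theorem le_alternate {j N N' n : ℕ} (h : N ≤ n) (h' : n ≤ N') :
    N ≤ alternate j N N' n ∧ alternate j N N' n ≤ N' := by
  rw [alternate]; split_ifs <;> omega

theorem alternate_inj {j N N' a b : ℕ} (ha : a ≤ N') (hb : b ≤ N')
    (hab : alternate j N N' a = alternate j N N' b) : a = b := by
  rw [alternate, alternate] at hab; split_ifs at hab <;> omega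

/-- For each rank-one construction with long last spacers there is a permutation of the last
spacers that transports the copies `q n + [0, top)` to the copies `p (τ n) + [0, top)`. -/
theorem exists_rearrangement {p q : ℕ → ℤ} {j N N' h H : ℕ}
    (hp : ∀ n, N ≤ n → (h : ℤ) ≤ p n ∧ p n + h ≤ p (n + 1))
    (hq : ∀ n, N ≤ n → (h : ℤ) ≤ q n ∧ q n + h ≤ q (n + 1))
    (hH : h + ((p N').toNat + (q N').toNat) ≤ H) :
    ∃ σ : Equiv.Perm ℕ, (∀ u ∉ Finset.Ico h H, σ u = u) ∧ ∀ n, N ≤ n → n ≤ N' → ∀ d < h,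
      σ ((p (alternate j N N' n)).toNat + d) = (q n).toNat + d := by
  have hmono : ∀ {f : ℕ → ℤ}, (∀ n, N ≤ n → (h : ℤ) ≤ f n ∧ f n + h ≤ f (n + 1)) →
      ∀ n, N ≤ n → n ≤ N' → (f n).toNat ≤ (f N').toNat := by
    intro f hf n hn hn'
    rcases hn'.eq_or_lt with rfl | hlt
    · exact le_rfl
    · have := add_le_of_gap hf hn hlt; omega
  -- Both families of blocks lie in `[h, H)` and are parametrized injectively by the pair of `n` and
  -- the offset `d`; the matching extends to a permutation supported there.
  obtain ⟨σ, h1, h2⟩ := exists_perm_of_injOn (t := Finset.Ico h H)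
    (S := {i : ℕ × ℕ | N ≤ i.1 ∧ i.1 ≤ N' ∧ i.2 < h})
    (a := fun i => (p (alternate j N N' i.1)).toNat + i.2) (b := fun i => (q i.1).toNat + i.2)
    (by
      rintro ⟨a, d⟩ ⟨ha, ha', hd⟩ ⟨b, e⟩ ⟨hb, hb', he⟩ hab
      obtain ⟨h3, rfl⟩ := eq_of_gap hp (le_alternate ha ha').1 (le_alternate hb hb').1 hd he hab
      rw [Prod.mk.injEq]
      exact ⟨alternate_inj ha' hb' h3, rfl⟩)
    (by
      rintro ⟨a, d⟩ ⟨ha, ha', hd⟩ ⟨b, e⟩ ⟨hb, hb', he⟩ hab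
      obtain ⟨h3, h4⟩ := eq_of_gap hq ha hb hd he hab
      rw [Prod.mk.injEq]
      exact ⟨h3, h4⟩)
    (by
      rintro ⟨a, d⟩ ⟨ha, ha', hd⟩
      obtain ⟨hb, hb'⟩ := le_alternate (j := j) ha ha'
      have h3 := (hp _ hb).1
      have h4 := hmono hp _ hb hb'
      simp only at hd h3 h4
      refine Finset.mem_coe.2 (Finset.mem_Ico.2 ⟨?_, ?_⟩) <;> dsimp only <;> omega)
    (by
      rintro ⟨a, d⟩ ⟨ha, ha', hd⟩
      have h3 := (hq _ ha).1
      have h4 := hmono hq _ ha ha'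
      simp only at hd h3 h4
      refine Finset.mem_coe.2 (Finset.mem_Ico.2 ⟨?_, ?_⟩) <;> dsimp only <;> omega)
  exact ⟨σ, h1, fun n hn hn' d hd => h2 (n, d) ⟨hn, hn', hd⟩⟩

end

end PoissonRankOne

/-! ### The two automorphisms and the diverging averages. -/

theorem theorem2 (p q : ℕ → ℤ)
    (hp : Tendsto (fun n => p (n + 1) - p n) atTop atTop)
    (hq : Tendsto (fun n => q (n + 1) - q n) atTop atTop) :
    ∃ (X : Type) (_ : MeasurableSpace X) (_ : StandardBorelSpace X)
      (m : Measure X) (_ : SigmaFinite m) (_ : NullSingletonClass m) (s t : X ≃ᵐ X)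
      (μ : Measure (Configuration X))
      (hS : MeasurePreserving (poissonSuspension s) μ μ)
      (hT : MeasurePreserving (poissonSuspension t) μ μ),
      m univ = ∞ ∧ IsRankOne m s ∧ IsRankOne m t ∧ IsPoissonMeasure m μ ∧
      HasSimpleSpectrum (koopman hS) ∧ HasSingularSpectrum (koopman hS) ∧
      HasSimpleSpectrum (koopman hT) ∧ HasSingularSpectrum (koopman hT) ∧
      ∃ C : Set (Configuration X), MeasurableSet C ∧
        ¬ ∃ L : ℝ, Tendsto
          (fun N : ℕ => (1 / (N : ℝ)) * ∑ n ∈ Finset.Icc 1 N,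
            μ.real ((iter (poissonSuspension s) (p n) '' C) ∩
              (iter (poissonSuspension t) (q n) '' C)))
          atTop (𝓝 L) := by
  obtain ⟨μ, hμ⟩ := exists_hasVoidProbabilities
  have hprob := hμ.1
  choose Np hNp using exists_gap hp
  choose Nq hNq using exists_gap hq
  -- Adding one makes `N` positive, as the averages require.
  set N : ℕ → ℕ := fun h => max (Np h) (Nq h) + 1 with hN
  -- Now `N + N'` is odd, so the reflection of `[N, N']` has no fixed point, and `N'` exceeds `N` by
  -- a factor of at least `j + 1`.
  set N' : ℕ → ℕ → ℕ := fun j h => N h * (2 * j + 3) + 1 with hN'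
  -- The last spacers hold all blocks up to time `N'`. The required gap is the number of floors
  -- below the last spacers, hence the dependence on `h`.
  obtain ⟨s, h₀, r, sp, E, hC, hpat, hG⟩ := exists_isRankOneConstruction patterns patterns_ne_nil
    fun j h => (p (N' j h)).toNat + (q (N' j h)).toNat
  set h : ℕ → ℕ := top h₀ r sp with hh
  have hgp : ∀ j n, N (h j) ≤ n → (h j : ℤ) ≤ p n ∧ p n + h j ≤ p (n + 1) := fun j n hn =>
    hNp _ n (by simp only [hN] at hn; omega)
  have hgq : ∀ j n, N (h j) ≤ n → (h j : ℤ) ≤ q n ∧ q n + h j ≤ q (n + 1) := fun j n hn =>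
    hNq _ n (by simp only [hN] at hn; omega)
  have hH : ∀ j, h j + ((p (N' j (h j))).toNat + (q (N' j (h j))).toNat) ≤
      height h₀ r sp (j + 1) := hG
  choose σ hσ hσ' using fun j => exists_rearrangement (j := j) (hgp j) (hgq j) (hH j)
  set φ := hC.rearrangeEquiv hσ
  have hφ : MeasurePreserving φ volume volume := hC.measurePreserving_rearrangeEquiv hσ
  set t := conjugate φ s with ht
  have hC' := hC.conjugate hφ
  have hfreq : ∀ L : List (Option ℕ), L ≠ [] → ∃ᶠ j in atTop, FollowsPattern h₀ r sp j L :=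
    fun L hL => (frequently_patterns hL).mono fun j hj => hj ▸ hpat j
  have hS := measurePreserving_poissonSuspension hμ hC.measurePreserving
  have hT := measurePreserving_poissonSuspension hμ hC'.measurePreserving
  refine ⟨ℝ, inferInstance, inferInstance, volume, inferInstance, inferInstance, s, t, μ, hS, hT,
    Real.volume_univ, ⟨_, _, _, _, hC⟩, ⟨_, _, _, _, hC'⟩, hμ.isPoissonMeasure,
    hC.hasSimpleSpectrum hμ hS hfreq, hC.hasSingularSpectrum hμ hS hfreq,
    hC'.hasSimpleSpectrum hμ hT hfreq, hC'.hasSingularSpectrum hμ hT hfreq,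
    void (E 0), measurableSet_void (hC.measurableSet_base 0), ?_⟩
  have hE := hC.measurableSet_base 0
  set c := volume.real (E 0) with hc
  have hc0 : 0 < c := ENNReal.toReal_pos hC.base_pos.ne' hC.base_lt_top.ne
  have hshift : ∀ n : ℤ, MeasurableSet (iter s n '' E 0) := fun n => measurableSet_iter_image s n hE
  have hshift' : ∀ n : ℤ, volume (iter s n '' E 0) < ∞ := fun n => by
    rw [measure_iter_image hC.measurePreserving n hE]; exact hC.base_lt_top
  have hexp : ∀ x : ℝ, 0 ≤ x → Real.exp (-x) ∈ Icc (0 : ℝ) 1 := fun x hx =>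
    ⟨(Real.exp_pos _).le, Real.exp_le_one_iff.2 (by linarith)⟩
  refine not_tendsto_average (v := fun j => if Even j then Real.exp (-c) else Real.exp (-(2 * c)))
    (v₀ := Real.exp (-c)) (v₁ := Real.exp (-(2 * c))) (N := fun j => N (h j))
    (N' := fun j => N' j (h j)) (fun n => ⟨measureReal_nonneg, measureReal_le_one⟩)
    (fun j => ?_) ?_ ?_ ?_ (fun j => Nat.le_add_left _ _) (fun j => ?_) fun j n hn hn' => ?_
  · split_ifs
    · exact hexp c hc0.le
    · exact hexp (2 * c) (by linarith)
  · exact frequently_atTop.2 fun n => ⟨2 * n, by omega, if_pos (even_two_mul n)⟩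
  · exact frequently_atTop.2 fun n => ⟨2 * n + 1, by omega,
      if_neg (Nat.not_even_iff_odd.2 (odd_two_mul_add_one n))⟩
  · intro heq
    have := Real.exp_injective heq
    linarith
  · simp only [hN']
    nlinarith [Nat.zero_le (N (h j)), Nat.zero_le j, Nat.zero_le (N (h j) * j)]
  · obtain ⟨ha, ha'⟩ := le_alternate (j := j) hn hn'
    set a := alternate j (N (h j)) (N' j (h j)) n with hadef
    have hbound : ∀ k, N (h j) ≤ k → k ≤ N' j (h j) →
        (p k).toNat + h j ≤ height h₀ r sp (j + 1) := by
      intro k hk hk'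
      have h1 := hH j
      have h2 := hgp j k hk
      rcases hk'.eq_or_lt with rfl | hlt
      · omega
      · have h3 := add_le_of_gap (hgp j) hk hlt
        omega
    have hpa := (hgp j a ha).1
    have hpn := (hgp j n hn).1
    have hqn := (hgq j n hn).1
    -- On `[N, N']` the image under `t` is an image under `s`, at the same time for even `j` and at
    -- the reflected time for odd `j`.
    have htq : iter t (q n) '' E 0 = iter s (p a) '' E 0 := by
      have h1 := hC.iter_conjugate_base hσ (j := j) (a := (p a).toNat) (b := (q n).toNat)
        (by change h j ≤ _; omega) (hbound a ha ha') (hσ' j n hn hn')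
      rwa [Int.toNat_of_nonneg (by omega), Int.toNat_of_nonneg (by omega)] at h1
    -- The correlation is the probability that the union of the two copies of `E 0` is void; the
    -- union has measure `c` if they coincide and `2 * c` if they are disjoint.
    rw [iter_poissonSuspension_image_void, iter_poissonSuspension_image_void, htq, ← void_union,
      hμ.2 _ ((hshift _).union (hshift _)) (measure_union_lt_top (hshift' _) (hshift' _))]
    split_ifs with hj
    · have : a = n := by rw [hadef, alternate, if_pos hj]
      rw [this, union_self, measureReal_iter_image hC.measurePreserving _ hE]
    · have hane : a ≠ n := by
        rw [hadef, alternate, if_neg hj]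
        have h5 : N (h j) + N' j (h j) = 2 * (N (h j) * (j + 2)) + 1 := by
          simp only [hN']; ring
        omega
      have hdisj : ∀ k l, N (h j) ≤ k → l ≤ N' j (h j) → k < l →
          Disjoint (iter s (p k) '' E 0) (iter s (p l) '' E 0) := by
        intro k l hk hl hkl
        have h1 := hgp j k hk
        have h2 := add_le_of_gap (hgp j) hk hkl
        have h3 := hC.disjoint_iter_base (j := j) (a := (p k).toNat) (b := (p l).toNat)
          (by change _ + h j ≤ _; omega) (hbound l (by omega) hl)
        rwa [Int.toNat_of_nonneg (by omega), Int.toNat_of_nonneg (by omega)] at h3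
      have hd : Disjoint (iter s (p n) '' E 0) (iter s (p a) '' E 0) := by
        rcases lt_or_gt_of_ne hane with hlt | hlt
        · exact (hdisj a n ha hn' hlt).symm
        · exact hdisj n a hn ha' hlt
      rw [measureReal_union hd (hshift _) (hshift' _).ne (hshift' _).ne,
        measureReal_iter_image hC.measurePreserving _ hE,
        measureReal_iter_image hC.measurePreserving _ hE, two_mul]
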